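/- Let $\rho\in\mathbb C$ with $0<|\rho|<1$, let $\sigma>0$, $\eta=1/\sigma^2$, $\beta>1$, and let $M\ge 2$ be an integer. Consider a MIMO link $\mathbf r=\mathbf H\mathbf F\mathbf s+\boldsymbol\xi$ with $N_t$ transmit and $N_r=\beta N_t$ receive antennas, where $\mathbf H$, $\boldsymbol\xi$, $\mathbf s$ are independent: the rows $\mathbf h_m^T$ of $\mathbf H\in\mathbb C^{N_r\times N_t}$ are i.i.d. zero-mean circularly-symmetric complex Gaussian with $\mathbb E[\overline{h_{mi}}\,h_{mj}]=[\mathbf\Sigma]_{ij}$; $\boldsymbol\xi$ is circularly-symmetric complex Gaussian with covariance $\sigma^2\mathbf I$; and the entries of $\mathbf s$ are i.i.d. uniform on an $M$-point constellation $\mathcal S\subset\mathbb C$ of mean energy one. Here $\mathbf\Sigma=\mathbf\Sigma_{N_t}$ is the Kac-Murdock-Szegő (KMS) matrix, $[\mathbf\Sigma]_{mn}=\rho^{n-m}$ for $m\le n$ and $[\mathbf\Sigma]_{mn}=\overline{[\mathbf\Sigma]_{nm}}$ for $m>n$. With an eigenvalue decomposition $\mathbf\Sigma=\mathbf W\mathbf\Lambda\mathbf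 W^H$ ($\mathbf W$ unitary, $\mathbf\Lambda$ diagonal with increasing entries) and $\mathbf V$ the normalized $N_t\times N_t$ DFT matrix, the optimal precoder is $$\widetilde{\mathbf F}=\frac{1}{\sqrt{\operatorname{tr}(\mathbf\Lambda^{-1/2})}}\,\mathbf W\mathbf\Lambda^{-1/4}\mathbf V .$$ The receiver uses zero-forcing detection: with $\mathbf r'=\big((\mathbf H\mathbf F)^H\mathbf H\mathbf F\big)^{-1}(\mathbf H\mathbf F)^H\mathbf r$, it decides $\hat s_k\in\arg\min_{s\in\mathcal S}|r'_k-s|$. The average symbol error probability (SEP) is $\mathrm P_{N_t}(\mathbf F)=\frac1{N_t}\sum_{k=1}^{N_t}\Pr(\hat s_k\ne s_k)$, the probability being taken over $\mathbf H,\boldsymbol\xi,\mathbf s$. Put $Q(x)=\frac1{\sqrt{2\pi}}\int_x^\infty e^{-t^2/2}\,dt$, $\mathtt E(k)=\int_0^{\pi/2}\sqrt{1-k^2\sin^2\theta}\,d\theta$ (the complete elliptic integral of the second kind) and $E_\rho=\mathtt E\big(\tfrac{2\sqrt{|\rho|}}{1+|\rho|}\big)$. Then, as $N_t\to\infty$ with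 $N_r/N_t=\beta$ fixed, the limit of $\mathrm P_{N_t}(\widetilde{\mathbf F})$ exists and equals - for $M$-ary PAM ($M$ equally spaced real points centred at $0$): $$\frac{2(M-1)}{M}\,Q\!\left(\sqrt{\frac{3\pi^2\eta(1-|\rho|)(\beta-1)}{2(1+|\rho|)(M^2-1)E_\rho^2}}\right);$$ - for $M$-ary PSK (the $M$-th roots of unity): $$\frac1\pi\int_0^{(M-1)\pi/M}\exp\!\left(-\frac{\pi^2\eta(1-|\rho|)(\beta-1)\sin^2(\pi/M)}{4(1+|\rho|)E_\rho^2\sin^2\theta}\right)d\theta;$$ - for square $M$-ary QAM ($M=L^2$, an $L\times L$ square grid centred at $0$), with $q=Q\!\left(\sqrt{\frac{3\pi^2\eta(1-|\rho|)(\beta-1)}{4(1+|\rho|)(M-1)E_\rho^2}}\right)$: $$\frac{4(\sqrt M-1)}{\sqrt M}\,q-\frac{4(\sqrt M-1)^2}{M}\,q^2 .$$ -/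

import Mathlib

open MeasureTheory ProbabilityTheory Filter Topology
open scoped Matrix MatrixOrder

noncomputable section

namespace MassiveMIMO

/-! ### Gaussian laws -/

/-- The law `CN(0, v)` on `ℂ`: independent real and imaginary parts, each `N(0, v / 2)`. -/
def complexNormal (v : ℝ) : Measure ℂ :=
  ((gaussianReal 0 (v / 2).toNNReal).prod (gaussianReal 0 (v / 2).toNNReal)).map
    (fun p : ℝ × ℝ => (⟨p.1, p.2⟩ : ℂ))

/-- The zero-mean circularly-symmetric complex Gaussian law of a row vector `h` with
`E[conj (h i) * h j] = K i j`: the law of `g ᵥ* √K` with `g` a row of i.i.d. `CN(0, 1)` entries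
(for `K` positive semidefinite, with `√K` its positive semidefinite square root). -/
def complexGaussian {ι : Type*} [Fintype ι] [DecidableEq ι] (K : Matrix ι ι ℂ) :
    Measure (ι → ℂ) :=
  (Measure.pi (fun _ : ι => complexNormal 1)).map (fun g => g ᵥ* CFC.sqrt K)

/-- The law of the channel: the `Nr` rows are independent, each complex Gaussian with
covariance `K` (the covariance of the whole channel is `I ⊗ K`). -/
def channelLaw {Nt : ℕ} (K : Matrix (Fin Nt) (Fin Nt) ℂ) (Nr : ℕ) :
    Measure (Fin Nr → Fin Nt → ℂ) :=
  Measure.pi (fun _ : Fin Nr => complexGaussian K)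

/-- The law of the noise: circularly-symmetric complex Gaussian with covariance `σ ^ 2 • I`. -/
def noiseLaw (σ : ℝ) (Nr : ℕ) : Measure (Fin Nr → ℂ) :=
  Measure.pi (fun _ : Fin Nr => complexNormal (σ ^ 2))

/-- The law of the transmitted symbols: i.i.d. uniform on the constellation `S`. -/
def symbolLaw (S : Set ℂ) (Nt : ℕ) : Measure (Fin Nt → ℂ) :=
  Measure.pi (fun _ : Fin Nt => uniformOn S)

/-! ### Constellations of unit average energy -/

/-- `M`-ary pulse amplitude modulation: `M` equally spaced real points, centred at `0`. -/
def pam (M : ℕ) : Set ℂ :=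
  Set.range (fun m : Fin M =>
    ((√(3 / ((M : ℝ) ^ 2 - 1)) * (2 * (m : ℝ) + 1 - M) : ℝ) : ℂ))

/-- `M`-ary phase shift keying: the `M`-th roots of unity. -/
def psk (M : ℕ) : Set ℂ :=
  Set.range (fun m : Fin M =>
    Complex.exp (((2 * Real.pi * (m : ℝ) / M : ℝ) : ℂ) * Complex.I))

/-- Square quadrature amplitude modulation with `L * L` points: an `L` by `L` square grid,
centred at `0`. -/
def qam (L : ℕ) : Set ℂ :=
  Set.range (fun p : Fin L × Fin L =>
    (⟨√(3 / (2 * ((L : ℝ) ^ 2 - 1))) * (2 * (p.1 : ℝ) + 1 - L),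
      √(3 / (2 * ((L : ℝ) ^ 2 - 1))) * (2 * (p.2 : ℝ) + 1 - L)⟩ : ℂ))

/-! ### Zero-forcing detection and the symbol error probability -/

/-- The pseudo-inverse `(Aᴴ A)⁻¹ Aᴴ` of a matrix of full column rank. -/
def pseudoInverse {m n : ℕ} (A : Matrix (Fin m) (Fin n) ℂ) : Matrix (Fin n) (Fin m) ℂ :=
  (Aᴴ * A)⁻¹ * Aᴴ

/-- The equalized signal `(H F)⁺ r`, where `r = H F s + ξ` is the received signal. -/
def zfOutput {Nt Nr : ℕ} (F : Matrix (Fin Nt) (Fin Nt) ℂ) (H : Matrix (Fin Nr) (Fin Nt) ℂ)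
    (ξ : Fin Nr → ℂ) (s : Fin Nt → ℂ) : Fin Nt → ℂ :=
  pseudoInverse (H * F) *ᵥ ((H * F) *ᵥ s + ξ)

/-- `D` is a hard decision rule: it maps every point to a nearest point of `S`
(ties are broken arbitrarily). -/
def IsHardDecision (S : Set ℂ) (D : ℂ → ℂ) : Prop :=
  ∀ z, D z ∈ S ∧ ∀ s ∈ S, ‖z - D z‖ ≤ ‖z - s‖

/-- The probability that the `k`-th symbol is detected wrongly, over independent channel, noise
and symbols. -/
def symbolErrorProb (S : Set ℂ) (D : ℂ → ℂ) {Nt : ℕ} (K : Matrix (Fin Nt) (Fin Nt) ℂ)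
    (σ : ℝ) (Nr : ℕ) (F : Matrix (Fin Nt) (Fin Nt) ℂ) (k : Fin Nt) : ℝ :=
  ((channelLaw K Nr).prod ((noiseLaw σ Nr).prod (symbolLaw S Nt))).real
    {ω | D (zfOutput F (Matrix.of ω.1) ω.2.1 ω.2.2 k) ≠ ω.2.2 k}

/-- The average symbol error probability: the arithmetic mean over the `Nt` symbols. -/
def averageSEP (S : Set ℂ) (D : ℂ → ℂ) {Nt : ℕ} (K : Matrix (Fin Nt) (Fin Nt) ℂ)
    (σ : ℝ) (Nr : ℕ) (F : Matrix (Fin Nt) (Fin Nt) ℂ) : ℝ :=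
  (1 / (Nt : ℝ)) * ∑ k, symbolErrorProb S D K σ Nr F k

/-! ### Covariance matrix and precoder -/

/-- The non-symmetric Kac-Murdock-Szegő matrix: `ρ ^ (n - m)` on and above the diagonal,
the conjugate of the transposed entry below it. -/
def kmsMatrix (ρ : ℂ) (N : ℕ) : Matrix (Fin N) (Fin N) ℂ :=
  Matrix.of fun m n =>
    if m ≤ n then ρ ^ ((n : ℕ) - (m : ℕ)) else star (ρ ^ ((m : ℕ) - (n : ℕ)))

/-- The normalized discrete Fourier transform matrix. -/
def dftMatrix (N : ℕ) : Matrix (Fin N) (Fin N) ℂ :=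
  Matrix.of fun j k =>
    Complex.exp (-2 * Real.pi * Complex.I * ((j : ℕ) : ℂ) * ((k : ℕ) : ℂ) / (N : ℂ))
      / ((√(N : ℝ) : ℝ) : ℂ)

/-- `F` is an optimal precoder for the covariance matrix `K`:
`F = (tr Λ ^ (-1/2)) ^ (-1/2) • W Λ ^ (-1/4) V`, where `K = W Λ Wᴴ` is an eigenvalue
decomposition (eigenvalues in increasing order) and `V` is the normalized DFT matrix. -/
def IsOptimalPrecoder {N : ℕ} (K F : Matrix (Fin N) (Fin N) ℂ) : Prop :=
  ∃ W ∈ Matrix.unitaryGroup (Fin N) ℂ, ∃ ev : Fin N → ℝ, Monotone ev ∧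
    K = W * Matrix.diagonal (fun i => (ev i : ℂ)) * Wᴴ ∧
    F = ((1 / √(∑ i, ev i ^ (-(1 / 2) : ℝ)) : ℝ) : ℂ) •
      (W * Matrix.diagonal (fun i => ((ev i ^ (-(1 / 4) : ℝ) : ℝ) : ℂ)) * dftMatrix N)

/-! ### Special functions -/

/-- The Gaussian tail function `Q(x) = P(N(0, 1) > x)`. -/
def gaussQ (x : ℝ) : ℝ := (gaussianReal 0 1).real (Set.Ioi x)

/-- The complete elliptic integral of the second kind, as a function of the modulus. -/
def ellipticE (k : ℝ) : ℝ := ∫ θ in (0 : ℝ)..(Real.pi / 2), √(1 - k ^ 2 * Real.sin θ ^ 2)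

end MassiveMIMO

end

open MassiveMIMO

noncomputable section

namespace MassiveMIMO

open scoped ComplexOrder

/-! ### The complex normal law -/

/-! Fix the channel. Zero forcing inverts `H F` exactly, so the error on symbol `k` is a linear
functional of the noise alone: it is complex normal with variance `σ²` times the `k`-th diagonal
entry of `((H F)ᴴ H F)⁻¹`, and it is independent of the transmitted symbol. The conditional error
probability is thus `f(variance)` for a function `f` on `(0, ∞)` that depends only on the
constellation. It remains to show that the variance converges in probability to a constant, with
bounds uniform in `k`, and to compute `f`, which is continuous (`tendsto_averageSEP`).

Concentration. Write `H = G √Σ` with `G` i.i.d. standard. By unitary invariance the diagonal entry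
equals `a = ((Fᴴ Σ F)⁻¹)ₖₖ` times a diagonal entry of the inverse Gram matrix of `G`. The reciprocal
of the latter is the squared length of one Gaussian column projected onto the orthogonal complement
of the others, a quadratic form of rank `Nr - Nt + 1`. Chebyshev's inequality makes it concentrate
around its rank (`gram_inv_zero_zero_concentration`, `channel_inv_gram_concentration`). For the
optimal precoder `a = T² / Nt` for every `k`, where `T = tr Σ^(-1/2)`, because all DFT entries have
the same modulus (`optimalPrecoder_inv_apply`). Hence the variance tends to `σ² τ² / (β - 1)` with
`τ = lim T / Nt`.

The spectral mean `τ`. The KMS matrix is the covariance of a first-order autoregressive process, so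
it has an explicit factorization `Uᴴ D U`. This gives the quadratic forms of `Σ` and of `Σ⁻¹` at
Fourier vectors up to `O(1/N)`: they are the symbol `(1 - |ρ|²) / |1 - ρz|²` and its reciprocal.
Tangent-line bounds for the inverse square root squeeze the form of `Σ^(-1/2)` between them
(`exists_abs_sum_eigenvalue_sub_le`). The sum over the nodes is a Riemann sum of `|1 - ρ e^(-ix)|`,
whose integral is elliptic (`integral_norm_one_sub_eq_ellipticE`).

The function `f`. Decision rules differ only on ties, so the error event lies between a strict and a
weak nearest-point event. Under a complex normal error these agree almost surely
(`errorSet_real_eq`). For PAM and QAM the error event splits into real coordinates; for PSK a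
computation in polar coordinates gives Craig's integral. -/

instance isProbabilityMeasure_complexNormal (v : ℝ) : IsProbabilityMeasure (complexNormal v) := by
  refine Measure.isProbabilityMeasure_map (Measurable.aemeasurable ?_)
  exact Complex.measurableEquivRealProd.symm.measurable

lemma complexNormal_eq_map (v : ℝ) :
    complexNormal v = ((gaussianReal 0 (v / 2).toNNReal).prod
      (gaussianReal 0 (v / 2).toNNReal)).map
      (Complex.equivRealProdCLM.symm : ℝ × ℝ →L[ℝ] ℂ) := by
  rfl

lemma charFunDual_gaussianReal_zero {v : NNReal} (L : StrongDual ℝ ℝ) :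
    charFunDual (gaussianReal 0 v) L = Complex.exp (-(v * L 1 ^ 2 / 2 : ℝ)) := by
  have h : charFunDual (gaussianReal 0 v) L = charFun (gaussianReal 0 v) (L 1) := by
    rw [charFunDual_apply, charFun_apply_real]
    congr with x
    have : L x = x * L 1 := by
      conv_lhs => rw [← mul_one x, ← smul_eq_mul, map_smul, smul_eq_mul]
    rw [this]; push_cast; ring_nf
  rw [h, charFun_gaussianReal]
  simp

/-- The factor `v / 4` is half of the variance `v / 2` carried by each real coordinate. Only `‖b‖`
enters, which is the source of every unitary invariance below. -/
lemma charFunDual_complexNormal {v : ℝ} (hv : 0 ≤ v) (L : StrongDual ℝ ℂ) (b : ℂ)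
    (h : ∀ w, L w = (b * w).re) :
    charFunDual (complexNormal v) L = Complex.exp (-(v / 4 * ‖b‖ ^ 2 : ℝ)) := by
  rw [complexNormal_eq_map, charFunDual_map, charFunDual_prod, charFunDual_gaussianReal_zero,
    charFunDual_gaussianReal_zero, ← Complex.exp_add]
  congr 1
  have h1 : (Complex.equivRealProdCLM.symm : ℝ × ℝ →L[ℝ] ℂ) (1, 0) = 1 := by
    apply Complex.ext <;> simp
  have h2 : (Complex.equivRealProdCLM.symm : ℝ × ℝ →L[ℝ] ℂ) (0, 1) = Complex.I := by
    apply Complex.ext <;> simp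
  simp only [ContinuousLinearMap.comp_apply, ContinuousLinearMap.inl_apply,
    ContinuousLinearMap.inr_apply, h1, h2, h]
  rw [Real.coe_toNNReal _ (by positivity), Complex.sq_norm, Complex.normSq_apply]
  norm_cast
  simp
  ring

lemma exists_coeff_strongDual {ι : Type*} [Fintype ι] [DecidableEq ι]
    (L : StrongDual ℝ (ι → ℂ)) : ∃ b : ι → ℂ, ∀ w, L w = (b ⬝ᵥ w).re := by
  -- The pairing is bilinear, without conjugation, and `(b * I).re = -b.im`; hence the sign.
  refine ⟨fun i => ⟨L (Pi.single i 1), - L (Pi.single i Complex.I)⟩, fun w => ?_⟩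
  have hw : w = ∑ i, ((w i).re • (Pi.single i 1 : ι → ℂ)
      + (w i).im • (Pi.single i Complex.I : ι → ℂ)) := by
    ext j
    simp [Finset.sum_apply, Pi.single_apply, Finset.sum_add_distrib]
  conv_lhs => rw [hw]
  simp [dotProduct, mul_comm]

lemma charFunDual_pi_complexNormal {ι : Type*} [Fintype ι] [DecidableEq ι] {v : ℝ} (hv : 0 ≤ v)
    (L : StrongDual ℝ (ι → ℂ)) (b : ι → ℂ) (h : ∀ w, L w = (b ⬝ᵥ w).re) :
    charFunDual (Measure.pi fun _ : ι => complexNormal v) L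
      = Complex.exp (-(v / 4 * ∑ i, ‖b i‖ ^ 2 : ℝ)) := by
  rw [charFunDual_pi, Finset.prod_congr rfl fun i _ =>
    charFunDual_complexNormal hv (L.comp (.single ℝ (fun _ : ι => ℂ) i)) (b i) fun w => by
      simp [h], ← Complex.exp_sum]
  push_cast
  simp [Finset.mul_sum]

lemma sum_norm_sq_eq_dotProduct {ι : Type*} [Fintype ι] (b : ι → ℂ) :
    ((∑ i, ‖b i‖ ^ 2 : ℝ) : ℂ) = b ⬝ᵥ star b := by
  simp [dotProduct, Complex.mul_conj, Complex.normSq_eq_norm_sq]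

lemma measurable_matrix_mulVec {ι κ : Type*} [Fintype ι] (A : Matrix κ ι ℂ) :
    Measurable fun g : ι → ℂ => A *ᵥ g := by
  refine measurable_pi_lambda _ fun k => ?_
  simp only [Matrix.mulVec, dotProduct]
  fun_prop

/-- A matrix with orthogonal rows of the same length maps i.i.d. complex normals to i.i.d.
complex normals. -/
lemma map_mulVec_pi_complexNormal {ι κ : Type*} [Fintype ι] [DecidableEq ι] [Fintype κ]
    [DecidableEq κ] {v a : ℝ} (hv : 0 ≤ v) (ha : 0 ≤ a) (A : Matrix κ ι ℂ)
    (hA : A * Aᴴ = (a : ℂ) • 1) :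
    (Measure.pi fun _ : ι => complexNormal v).map (fun g => A *ᵥ g)
      = Measure.pi fun _ : κ => complexNormal (a * v) := by
  have := Measure.isProbabilityMeasure_map (μ := Measure.pi fun _ : ι => complexNormal v)
    (measurable_matrix_mulVec A).aemeasurable
  apply Measure.ext_of_charFunDual
  ext L
  let T : (ι → ℂ) →L[ℝ] (κ → ℂ) := (A.mulVecLin.restrictScalars ℝ).toContinuousLinearMap
  have hT : (fun g => A *ᵥ g) = T := rfl
  obtain ⟨b, hb⟩ := exists_coeff_strongDual L
  rw [charFunDual_pi_complexNormal (by positivity) L b hb, hT, charFunDual_map,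
    charFunDual_pi_complexNormal hv _ (b ᵥ* A) fun w => by
      simp [hb, T, Matrix.dotProduct_mulVec]]
  congr 3
  have : ((∑ i, ‖(b ᵥ* A) i‖ ^ 2 : ℝ) : ℂ) = ((a * ∑ i, ‖b i‖ ^ 2 : ℝ) : ℂ) := by
    rw [sum_norm_sq_eq_dotProduct, Matrix.star_vecMul, ← Matrix.dotProduct_mulVec,
      Matrix.mulVec_mulVec, hA, Complex.ofReal_mul, sum_norm_sq_eq_dotProduct]
    simp [Matrix.smul_mulVec]
  rw [Complex.ofReal_injective this]
  ring

/-- The vector `c` is a one-row matrix, whose product with its adjoint is the scalar `∑ ‖c i‖²`.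
This gives the variance of the equalized noise. -/
lemma map_dotProduct_pi_complexNormal {ι : Type*} [Fintype ι] [DecidableEq ι]
    {v : ℝ} (hv : 0 ≤ v) (c : ι → ℂ) :
    (Measure.pi fun _ : ι => complexNormal v).map (fun g => c ⬝ᵥ g)
      = complexNormal ((∑ i, ‖c i‖ ^ 2) * v) := by
  have h := map_mulVec_pi_complexNormal (a := ∑ i, ‖c i‖ ^ 2) hv (by positivity)
    (Matrix.of fun (_ : Unit) i => c i) (by
      ext i j
      rw [sum_norm_sq_eq_dotProduct]
      simp [Matrix.mul_apply, dotProduct])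
  have h2 := congrArg (fun m => m.map (fun x : Unit → ℂ => x ())) h
  rw [Measure.map_map (by fun_prop) (measurable_matrix_mulVec _)] at h2
  rw [(measurePreserving_eval (fun _ : Unit => complexNormal ((∑ i, ‖c i‖ ^ 2) * v)) ()).map_eq]
    at h2
  rw [← h2]
  rfl

/-- The density of the complex normal law. -/
lemma complexNormal_eq_withDensity {v : ℝ} (hv : 0 < v) :
    complexNormal v = (volume : Measure ℂ).withDensity
      fun w => ENNReal.ofReal ((Real.pi * v)⁻¹ * Real.exp (-‖w‖ ^ 2 / v)) := by
  have h0 : (v / 2).toNNReal ≠ 0 := by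
    simpa [Real.toNNReal_eq_zero] using hv
  have hp := Complex.volume_preserving_equiv_real_prod.symm
  rw [complexNormal, gaussianReal_of_var_ne_zero _ h0, prod_withDensity (by fun_prop)
    (by fun_prop), ← Measure.volume_eq_prod]
  ext s hs
  have hm : Measurable fun p : ℝ × ℝ => (⟨p.1, p.2⟩ : ℂ) :=
    Complex.measurableEquivRealProd.symm.measurable
  rw [Measure.map_apply hm hs, withDensity_apply _ (hm hs), withDensity_apply _ hs,
    ← hp.setLIntegral_comp_preimage hs (by fun_prop)]
  refine setLIntegral_congr_fun (hm hs) fun p _ => ?_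
  simp only [gaussianPDF]
  rw [← ENNReal.ofReal_mul (gaussianPDFReal_nonneg _ _ _)]
  congr 1
  simp only [gaussianPDFReal, Real.coe_toNNReal _ (by positivity : 0 ≤ v / 2)]
  rw [mul_mul_mul_comm, ← Real.exp_add, ← mul_inv, Real.mul_self_sqrt (by positivity)]
  congr 2
  · ring
  · have : ‖Complex.measurableEquivRealProd.symm p‖ ^ 2 = p.1 ^ 2 + p.2 ^ 2 := by
      rw [Complex.sq_norm, Complex.normSq_apply]; simp [sq]
    rw [this]; field_simp; ring

lemma complexNormal_absolutelyContinuous {v : ℝ} (hv : 0 < v) : complexNormal v ≪ volume := by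
  rw [complexNormal_eq_withDensity hv]; exact withDensity_absolutelyContinuous _ _

/-- The fourth moment of the normal law is what Chebyshev's inequality needs for sums of `‖g i‖²`.
-/
lemma memLp_norm_sq_complexNormal :
    MemLp (fun w : ℂ => ‖w‖ ^ 2) 2 (complexNormal 1) := by
  have hm : Measurable fun p : ℝ × ℝ => (⟨p.1, p.2⟩ : ℂ) :=
    Complex.measurableEquivRealProd.symm.measurable
  rw [complexNormal, memLp_map_measure_iff (by fun_prop) hm.aemeasurable]
  have h : MemLp (fun x : ℝ => x ^ 2) 2 (gaussianReal 0 (1 / 2 : ℝ).toNNReal) := by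
    rw [memLp_two_iff_integrable_sq (by fun_prop)]
    have := (memLp_id_gaussianReal' (μ := 0) (v := (1 / 2 : ℝ).toNNReal) 4
      (by simp)).integrable_norm_pow (p := 4) (by simp)
    refine this.congr (Eventually.of_forall fun x => ?_)
    simp only [id, Real.norm_eq_abs, ← pow_mul]
    exact Even.pow_abs (by decide) x
  have h1 := h.comp_fst (gaussianReal 0 (1 / 2 : ℝ).toNNReal)
  have h2 := h.comp_snd (gaussianReal 0 (1 / 2 : ℝ).toNNReal)
  refine (h1.add h2).ae_eq (Eventually.of_forall fun p => ?_)
  simp [Complex.sq_norm, Complex.normSq_apply, ← sq]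

lemma integral_norm_sq_complexNormal : ∫ w : ℂ, ‖w‖ ^ 2 ∂complexNormal 1 = 1 := by
  have hm : Measurable fun p : ℝ × ℝ => (⟨p.1, p.2⟩ : ℂ) :=
    Complex.measurableEquivRealProd.symm.measurable
  rw [complexNormal, integral_map hm.aemeasurable (by fun_prop)]
  have hv : ∫ x, x ^ 2 ∂(gaussianReal 0 (1 / 2 : ℝ).toNNReal) = 1 / 2 := by
    have h := variance_fun_id_gaussianReal (μ := 0) (v := (1 / 2 : ℝ).toNNReal)
    rw [variance_of_integral_eq_zero (by fun_prop) (by simp)] at h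
    rw [h, Real.coe_toNNReal _ (by norm_num)]
  have hi : Integrable (fun x : ℝ => x ^ 2) (gaussianReal 0 (1 / 2 : ℝ).toNNReal) :=
    (memLp_id_gaussianReal' (μ := 0) (v := (1 / 2 : ℝ).toNNReal) 2 (by simp)).integrable_sq
  have : (fun p : ℝ × ℝ => ‖(⟨p.1, p.2⟩ : ℂ)‖ ^ 2) = fun p => p.1 ^ 2 + p.2 ^ 2 := by
    ext p; simp [Complex.sq_norm, Complex.normSq_apply, ← sq]
  rw [this, integral_add (hi.comp_fst _) (hi.comp_snd _)]
  rw [integral_fun_fst (fun x : ℝ => x ^ 2), integral_fun_snd (fun x : ℝ => x ^ 2), hv]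
  simp; norm_num

/-! ### The Kac-Murdock-Szegő matrix -/

/-- The upper triangular factor of the KMS matrix. -/
def kmsUpper (ρ : ℂ) (N : ℕ) : Matrix (Fin N) (Fin N) ℂ :=
  Matrix.of fun m n => if m ≤ n then ρ ^ ((n : ℕ) - (m : ℕ)) else 0

/-- The pivots of the KMS matrix. -/
def kmsPivot (ρ : ℂ) (n : ℕ) : ℝ := if n = 0 then 1 else 1 - ‖ρ‖ ^ 2

lemma kmsPivot_pos {ρ : ℂ} (hρ : ‖ρ‖ < 1) (n : ℕ) : 0 < kmsPivot ρ n := by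
  have := norm_nonneg ρ
  unfold kmsPivot
  split_ifs
  · norm_num
  · nlinarith

/-- This is stationarity of a first-order autoregression: initial variance `1` and innovation
variances `1 - ‖ρ‖²` keep the variance equal to `1` at each time. -/
lemma sum_pow_mul_kmsPivot (ρ : ℂ) (m : ℕ) :
    ∑ k ∈ Finset.range (m + 1), (‖ρ‖ ^ 2) ^ (m - k) * kmsPivot ρ k = 1 := by
  induction m with
  | zero => simp [kmsPivot]
  | succ m ih =>
    rw [Finset.sum_range_succ]
    have : ∀ k ∈ Finset.range (m + 1), (‖ρ‖ ^ 2) ^ (m + 1 - k) * kmsPivot ρ k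
        = ‖ρ‖ ^ 2 * ((‖ρ‖ ^ 2) ^ (m - k) * kmsPivot ρ k) := fun k hk => by
      rw [Nat.succ_sub (by simpa [Nat.lt_succ_iff] using hk), pow_succ]; ring
    rw [Finset.sum_congr rfl this, ← Finset.mul_sum, ih]
    simp [kmsPivot]

lemma kmsMatrix_conjTranspose (ρ : ℂ) (N : ℕ) : (kmsMatrix ρ N)ᴴ = kmsMatrix ρ N := by
  ext m n
  rcases lt_trichotomy m n with h | h | h
  · simp [kmsMatrix, h.le, not_le.mpr h]
  · simp [kmsMatrix, h]
  · simp [kmsMatrix, h.le, not_le.mpr h]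

/-- For `m ≤ n` the factor `ρ ^ (n - m)` comes out of the `(m, n)` entry of the product, leaving the
unit variance of `sum_pow_mul_kmsPivot`. The other entries follow by Hermitian symmetry. -/
lemma kmsMatrix_eq (ρ : ℂ) (N : ℕ) :
    kmsMatrix ρ N = (kmsUpper ρ N)ᴴ * Matrix.diagonal (fun n : Fin N => (kmsPivot ρ n : ℂ))
      * kmsUpper ρ N := by
  set R := (kmsUpper ρ N)ᴴ * Matrix.diagonal (fun n : Fin N => (kmsPivot ρ n : ℂ))
      * kmsUpper ρ N with hR
  have hRH : Rᴴ = R := by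
    rw [hR, Matrix.conjTranspose_mul, Matrix.conjTranspose_mul, Matrix.diagonal_conjTranspose,
      Matrix.conjTranspose_conjTranspose, Matrix.mul_assoc]
    congr 2
    exact congrArg _ (funext fun i => Complex.conj_ofReal _)
  have key : ∀ m n : Fin N, m ≤ n → kmsMatrix ρ N m n = R m n := by
    intro m n hmn
    have h1 : R m n = ∑ k : Fin N, (fun k : ℕ => if k ≤ (m : ℕ) then
        ρ ^ ((n : ℕ) - m) * (((‖ρ‖ ^ 2) ^ ((m : ℕ) - k) * kmsPivot ρ k : ℝ) : ℂ) else 0) k := by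
      rw [hR, Matrix.mul_apply]
      refine Finset.sum_congr rfl fun k _ => ?_
      rw [Matrix.mul_diagonal]
      simp only [kmsUpper, Matrix.conjTranspose_apply, Matrix.of_apply, Fin.le_def]
      by_cases hk : (k : ℕ) ≤ m
      · have hkn : (k : ℕ) ≤ n := hk.trans hmn
        have e : (n : ℕ) - k = ((n : ℕ) - m) + (m - k) := by have := Fin.le_def.mp hmn; omega
        have e2 : ((‖ρ‖ : ℂ)) ^ 2 = (starRingEnd ℂ ρ) * ρ := (Complex.conj_mul' ρ).symm
        simp only [hk, hkn, if_true, e, pow_add]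
        push_cast
        rw [e2, mul_pow]
        simp
        ring
      · simp [hk]
    rw [h1, Fin.sum_univ_eq_sum_range (fun k : ℕ => if k ≤ (m : ℕ) then
        ρ ^ ((n : ℕ) - m) * (((‖ρ‖ ^ 2) ^ ((m : ℕ) - k) * kmsPivot ρ k : ℝ) : ℂ) else 0) N,
      ← Finset.sum_filter]
    have hf : (Finset.range N).filter (fun k => k ≤ (m : ℕ)) = Finset.range (m + 1) := by
      ext k; have := m.2; simp; omega
    rw [hf, ← Finset.mul_sum, ← Complex.ofReal_sum, sum_pow_mul_kmsPivot]
    simp [kmsMatrix, hmn]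
  ext m n
  rcases le_total m n with h | h
  · exact key m n h
  · rw [← kmsMatrix_conjTranspose, ← hRH, Matrix.conjTranspose_apply, Matrix.conjTranspose_apply,
      key n m h]

lemma det_kmsUpper (ρ : ℂ) (N : ℕ) : (kmsUpper ρ N).det = 1 := by
  rw [Matrix.det_of_isUpperTriangular]
  · simp [kmsUpper]
  · intro i j hij
    simp only [id] at hij
    simp [kmsUpper, not_le.mpr hij]

lemma kmsMatrix_posDef {ρ : ℂ} (hρ : ‖ρ‖ < 1) (N : ℕ) : (kmsMatrix ρ N).PosDef := by
  rw [kmsMatrix_eq]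
  refine Matrix.PosDef.conjTranspose_mul_mul_same ?_ ?_
  · exact Matrix.PosDef.diagonal fun n => by simpa using kmsPivot_pos hρ n
  · exact Matrix.mulVec_injective_of_isUnit
      ((Matrix.isUnit_iff_isUnit_det _).2 (by simp [det_kmsUpper]))

lemma dotProduct_mulVec_kmsMatrix (ρ : ℂ) (N : ℕ) (v : Fin N → ℂ) :
    star v ⬝ᵥ (kmsMatrix ρ N *ᵥ v)
      = ((∑ n : Fin N, kmsPivot ρ n * ‖(kmsUpper ρ N *ᵥ v) n‖ ^ 2 : ℝ) : ℂ) := by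
  rw [kmsMatrix_eq, ← Matrix.mulVec_mulVec, ← Matrix.mulVec_mulVec, Matrix.dotProduct_mulVec,
    ← Matrix.star_mulVec]
  simp only [dotProduct, Matrix.mulVec_diagonal, Pi.star_apply]
  push_cast
  refine Finset.sum_congr rfl fun n _ => ?_
  rw [← Complex.conj_mul']
  simp; ring

/-- Parametrizing the vector as `Uᴴ y` cancels the outer factors of `K⁻¹ = U⁻¹ D⁻¹ (Uᴴ)⁻¹`, so the
inverse of the triangular factor is never computed. -/
lemma dotProduct_mulVec_kmsMatrix_inv {ρ : ℂ} (hρ : ‖ρ‖ < 1) (N : ℕ) (y : Fin N → ℂ) :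
    star ((kmsUpper ρ N)ᴴ *ᵥ y) ⬝ᵥ ((kmsMatrix ρ N)⁻¹ *ᵥ ((kmsUpper ρ N)ᴴ *ᵥ y))
      = ((∑ n : Fin N, (kmsPivot ρ n)⁻¹ * ‖y n‖ ^ 2 : ℝ) : ℂ) := by
  have hu : IsUnit (kmsUpper ρ N).det := by simp [det_kmsUpper]
  have huH : IsUnit (kmsUpper ρ N)ᴴ.det := by simp [det_kmsUpper, Matrix.det_conjTranspose]
  rw [kmsMatrix_eq, Matrix.mul_inv_rev, Matrix.mul_inv_rev, Matrix.mulVec_mulVec,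
    Matrix.mul_assoc, Matrix.nonsing_inv_mul_cancel_right _ _ huH,
    Matrix.star_mulVec, Matrix.conjTranspose_conjTranspose, ← Matrix.dotProduct_mulVec,
    Matrix.mulVec_mulVec, Matrix.mul_nonsing_inv_cancel_left _ _ hu]
  have hd : (Matrix.diagonal (fun n : Fin N => (kmsPivot ρ n : ℂ)))⁻¹
      = Matrix.diagonal (fun n : Fin N => ((kmsPivot ρ n : ℂ))⁻¹) := by
    refine Matrix.inv_eq_right_inv ?_
    rw [Matrix.diagonal_mul_diagonal, ← Matrix.diagonal_one]
    congr 1; ext n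
    exact mul_inv_cancel₀ (by exact_mod_cast (kmsPivot_pos hρ n).ne')
  rw [hd]
  simp only [dotProduct, Matrix.mulVec_diagonal, Pi.star_apply]
  push_cast
  refine Finset.sum_congr rfl fun n _ => ?_
  rw [← Complex.conj_mul']
  simp; ring

/-! ### Fourier vectors -/

/-- The nodes of the discrete Fourier transform. -/
def dftNode (N k : ℕ) : ℂ := Complex.exp (((-(2 * Real.pi * k / N) : ℝ) : ℂ) * Complex.I)

lemma norm_dftNode (N k : ℕ) : ‖dftNode N k‖ = 1 := Complex.norm_exp_ofReal_mul_I _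

lemma dftMatrix_apply {N : ℕ} (j k : Fin N) :
    dftMatrix N j k = dftNode N k ^ (j : ℕ) / (√(N : ℝ) : ℝ) := by
  rw [dftNode, ← Complex.exp_nat_mul, dftMatrix, Matrix.of_apply]
  congr 2
  push_cast; ring

lemma norm_dftMatrix_sq {N : ℕ} (j k : Fin N) : ‖dftMatrix N j k‖ ^ 2 = 1 / N := by
  rw [dftMatrix_apply, norm_div, norm_pow, norm_dftNode, one_pow, Complex.norm_real,
    Real.norm_of_nonneg (by positivity), div_pow, Real.sq_sqrt (by positivity), one_pow]

lemma dftMatrix_conjTranspose_mul_self (N : ℕ) : (dftMatrix N)ᴴ * dftMatrix N = 1 := by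
  rcases Nat.eq_zero_or_pos N with rfl | hN
  · ext i; exact i.elim0
  have hN0 : (N : ℝ) ≠ 0 := by positivity
  ext k l
  rw [Matrix.mul_apply]
  by_cases hkl : k = l
  · subst hkl
    have : ∀ j, (dftMatrix N)ᴴ k j * dftMatrix N j k = ((1 / N : ℝ) : ℂ) := fun j => by
      rw [Matrix.conjTranspose_apply, ← norm_dftMatrix_sq j k]
      push_cast
      exact Complex.conj_mul' _
    rw [Finset.sum_congr rfl fun j _ => this j]
    simp [hN.ne']
  · rw [Matrix.one_apply_ne hkl]
    set q : ℂ := star (dftNode N k) * dftNode N l with hq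
    have hs : ∀ j : Fin N, (dftMatrix N)ᴴ k j * dftMatrix N j l = q ^ (j : ℕ) / N := fun j => by
      rw [Matrix.conjTranspose_apply, dftMatrix_apply, dftMatrix_apply, hq, mul_pow]
      have h2 : ((√(N : ℝ) : ℝ) : ℂ) * ((√(N : ℝ) : ℝ) : ℂ) = N := by
        rw [← Complex.ofReal_mul, Real.mul_self_sqrt (by positivity)]; simp
      rw [star_div₀, star_pow, div_mul_div_comm]
      congr 1
      rw [← h2]; simp
    have hqexp : q = Complex.exp (2 * Real.pi * Complex.I * ((k : ℂ) - l) / N) := by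
      rw [hq, dftNode, dftNode, Complex.star_def, ← Complex.exp_conj, ← Complex.exp_add]
      congr 1
      simp only [map_mul, Complex.conj_ofReal, Complex.conj_I]
      push_cast; ring
    have hqN : q ^ N = 1 := by
      rw [hqexp, ← Complex.exp_nat_mul]
      have : (N : ℂ) * (2 * Real.pi * Complex.I * ((k : ℂ) - l) / N)
          = ((k : ℤ) - (l : ℤ) : ℤ) * (2 * Real.pi * Complex.I) := by
        have : (N : ℂ) ≠ 0 := by exact_mod_cast hN.ne'
        field_simp; push_cast; ring
      rw [this, Complex.exp_int_mul_two_pi_mul_I]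
    have hq1 : q ≠ 1 := by
      rw [hqexp, Ne, Complex.exp_eq_one_iff]
      rintro ⟨n, hn⟩
      have hNc : (N : ℂ) ≠ 0 := by exact_mod_cast hN.ne'
      have hpi : (2 * Real.pi * Complex.I : ℂ) ≠ 0 := Complex.two_pi_I_ne_zero
      have h3 : ((k : ℂ) - l) = n * N := by
        rw [div_eq_iff hNc] at hn
        apply mul_left_cancel₀ hpi
        rw [hn]; ring
      have h4 : ((k : ℕ) : ℤ) - ((l : ℕ) : ℤ) = n * N := by exact_mod_cast h3
      have hk := k.2
      have hl := l.2
      have hn0 : n = 0 := by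
        by_contra hne
        rcases lt_or_gt_of_ne hne with h | h
        · nlinarith
        · nlinarith
      rw [hn0] at h4
      exact hkl (Fin.ext (by omega))
    rw [Finset.sum_congr rfl fun j _ => hs j, ← Finset.sum_div,
      Fin.sum_univ_eq_sum_range (fun j => q ^ j) N, geom_sum_eq hq1, hqN]
    simp

lemma dftMatrix_mem_unitaryGroup (N : ℕ) : dftMatrix N ∈ Matrix.unitaryGroup (Fin N) ℂ :=
  Matrix.mem_unitaryGroup_iff'.2 (dftMatrix_conjTranspose_mul_self N)

/-! ### Spectral means of the KMS matrix -/

lemma dotProduct_mulVec_spectral {N : ℕ} (W : Matrix (Fin N) (Fin N) ℂ) (d : Fin N → ℝ)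
    (v : Fin N → ℂ) :
    star v ⬝ᵥ ((W * Matrix.diagonal (fun i => (d i : ℂ)) * Wᴴ) *ᵥ v)
      = ((∑ i, d i * ‖(Wᴴ *ᵥ v) i‖ ^ 2 : ℝ) : ℂ) := by
  rw [← Matrix.mulVec_mulVec, ← Matrix.mulVec_mulVec, Matrix.dotProduct_mulVec,
    ← Matrix.conjTranspose_conjTranspose W, ← Matrix.star_mulVec]
  simp only [dotProduct, Matrix.mulVec_diagonal, Pi.star_apply, Matrix.conjTranspose_conjTranspose]
  push_cast
  refine Finset.sum_congr rfl fun n _ => ?_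
  rw [← Complex.conj_mul']
  simp; ring

lemma spectral_inv {N : ℕ} {W : Matrix (Fin N) (Fin N) ℂ} (hW : W ∈ Matrix.unitaryGroup (Fin N) ℂ)
    {d : Fin N → ℝ} (hd : ∀ i, d i ≠ 0) :
    (W * Matrix.diagonal (fun i => (d i : ℂ)) * Wᴴ)⁻¹
      = W * Matrix.diagonal (fun i => (((d i)⁻¹ : ℝ) : ℂ)) * Wᴴ := by
  have h1 : Wᴴ * W = 1 := Matrix.mem_unitaryGroup_iff'.1 hW
  have h2 : W * Wᴴ = 1 := Matrix.mem_unitaryGroup_iff.1 hW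
  refine Matrix.inv_eq_right_inv ?_
  have h3 : Matrix.diagonal (fun i => (d i : ℂ)) * Matrix.diagonal (fun i => (((d i)⁻¹ : ℝ) : ℂ))
      = 1 := by
    rw [Matrix.diagonal_mul_diagonal, ← Matrix.diagonal_one]
    congr 1; ext i
    rw [← Complex.ofReal_mul, mul_inv_cancel₀ (hd i), Complex.ofReal_one]
  calc _ = W * (Matrix.diagonal (fun i => (d i : ℂ)) * (Wᴴ * W)
        * Matrix.diagonal (fun i => (((d i)⁻¹ : ℝ) : ℂ))) * Wᴴ := by simp only [Matrix.mul_assoc]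
    _ = 1 := by rw [h1, Matrix.mul_one, h3, Matrix.mul_one, h2]

lemma spectral_pos {N : ℕ} {W K : Matrix (Fin N) (Fin N) ℂ}
    (hW : W ∈ Matrix.unitaryGroup (Fin N) ℂ) {d : Fin N → ℝ} (hK : K.PosDef)
    (h : K = W * Matrix.diagonal (fun i => (d i : ℂ)) * Wᴴ) (i : Fin N) : 0 < d i := by
  have h1 : Wᴴ * W = 1 := Matrix.mem_unitaryGroup_iff'.1 hW
  have hp : (Wᴴ * K * W).PosDef := by
    refine Matrix.PosDef.conjTranspose_mul_mul_same hK ?_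
    refine Matrix.mulVec_injective_of_isUnit ?_
    exact IsUnit.of_mul_eq_one_right _ h1
  have he : Wᴴ * K * W = Matrix.diagonal (fun i => (d i : ℂ)) := by
    calc _ = (Wᴴ * W) * Matrix.diagonal (fun i => (d i : ℂ)) * (Wᴴ * W) := by
          rw [h]; simp only [Matrix.mul_assoc]
      _ = _ := by rw [h1, Matrix.mul_one, Matrix.one_mul]
  rw [he, Matrix.posDef_diagonal_iff] at hp
  exact_mod_cast hp i

lemma sum_norm_sq_unitary_mulVec {N : ℕ} {W : Matrix (Fin N) (Fin N) ℂ}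
    (hW : W ∈ Matrix.unitaryGroup (Fin N) ℂ) (v : Fin N → ℂ) :
    ∑ i, ‖(W *ᵥ v) i‖ ^ 2 = ∑ i, ‖v i‖ ^ 2 := by
  have h1 : Wᴴ * W = 1 := Matrix.mem_unitaryGroup_iff'.1 hW
  apply Complex.ofReal_injective
  rw [sum_norm_sq_eq_dotProduct, sum_norm_sq_eq_dotProduct, Matrix.star_mulVec, dotProduct_comm,
    ← Matrix.dotProduct_mulVec, Matrix.mulVec_mulVec, h1, Matrix.one_mulVec, dotProduct_comm]

/-- The rows of a unitary matrix are unit vectors, so weights from its columns sum to one. -/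
lemma sum_norm_sq_row_unitary {N : ℕ} {W : Matrix (Fin N) (Fin N) ℂ}
    (hW : W ∈ Matrix.unitaryGroup (Fin N) ℂ) (i : Fin N) : ∑ k, ‖W i k‖ ^ 2 = 1 := by
  have h2 : W * Wᴴ = 1 := Matrix.mem_unitaryGroup_iff.1 hW
  have := congrFun (congrFun h2 i) i
  rw [Matrix.mul_apply] at this
  apply Complex.ofReal_injective
  rw [sum_norm_sq_eq_dotProduct]
  simpa [dotProduct] using this

/-- Here `b` stands for `e ^ (-1/2)`. The square root is concave, so it lies below its tangent at
`c²`, taken in the variable `1 / e`; averaging an affine function only needs the mean of `1 / e`. -/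
lemma sqrt_weighted_mean_le {ι : Type*} (s : Finset ι) {p e b : ι → ℝ} (hp : ∀ i ∈ s, 0 ≤ p i)
    (hp1 : ∑ i ∈ s, p i = 1) (hb2 : ∀ i ∈ s, b i ^ 2 = (e i)⁻¹)
    {c : ℝ} (hc : 0 < c) : ∑ i ∈ s, p i * b i ≤ (c + (∑ i ∈ s, (e i)⁻¹ * p i) / c) / 2 := by
  have : ∑ i ∈ s, p i * b i ≤ ∑ i ∈ s, (p i * c / 2 + ((e i)⁻¹ * p i) / c / 2) := by
    refine Finset.sum_le_sum fun i hi => ?_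
    rw [← hb2 i hi]
    have h1 : b i ≤ (c + b i ^ 2 / c) / 2 := by
      rw [le_div_iff₀ (by norm_num), ← sub_nonneg]
      have : c + b i ^ 2 / c - b i * 2 = (b i - c) ^ 2 / c := by field_simp; ring
      rw [this]; positivity
    calc p i * b i ≤ p i * ((c + b i ^ 2 / c) / 2) := mul_le_mul_of_nonneg_left h1 (hp i hi)
      _ = _ := by ring
  refine this.trans (le_of_eq ?_)
  rw [Finset.sum_add_distrib, ← Finset.sum_div, ← Finset.sum_div, ← Finset.sum_div,
    ← Finset.sum_mul, hp1]
  ring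

/-- The companion lower bound: `x ^ (-1/2)` is convex, so it lies above its tangent at `x = c ^
(-2)`, which is `3/2 c - 1/2 c³ x`. Both bounds are sharp at `b = c`. -/
lemma le_weighted_mean_rsqrt {ι : Type*} (s : Finset ι) {p e b : ι → ℝ} (hp : ∀ i ∈ s, 0 ≤ p i)
    (hp1 : ∑ i ∈ s, p i = 1) (hb : ∀ i ∈ s, 0 < b i) (hb2 : ∀ i ∈ s, b i ^ 2 = (e i)⁻¹)
    {c : ℝ} (hc : 0 < c) :
    3 / 2 * c - 1 / 2 * (c ^ 3 * ∑ i ∈ s, e i * p i) ≤ ∑ i ∈ s, p i * b i := by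
  have : ∑ i ∈ s, (p i * (3 / 2 * c) - 1 / 2 * (c ^ 3 * (e i * p i))) ≤ ∑ i ∈ s, p i * b i := by
    refine Finset.sum_le_sum fun i hi => ?_
    have hbi := hb i hi
    have he : e i = (b i ^ 2)⁻¹ := by rw [hb2 i hi, inv_inv]
    have h1 : 3 / 2 * c - 1 / 2 * (c ^ 3 * e i) ≤ b i := by
      rw [he, ← sub_nonneg]
      have : b i - (3 / 2 * c - 1 / 2 * (c ^ 3 * (b i ^ 2)⁻¹))
          = (b i - c) ^ 2 * (2 * b i + c) / (2 * b i ^ 2) := by field_simp; ring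
      rw [this]; positivity
    calc _ = p i * (3 / 2 * c - 1 / 2 * (c ^ 3 * e i)) := by ring
      _ ≤ _ := mul_le_mul_of_nonneg_left h1 (hp i hi)
  refine le_trans (le_of_eq ?_) this
  rw [Finset.sum_sub_distrib, ← Finset.sum_mul, hp1, ← Finset.mul_sum, ← Finset.mul_sum]
  ring

/-! ### Quadratic forms of the KMS matrix and of its inverse at Fourier vectors. -/

/-- The triangular factor turns a Fourier vector into a truncated geometric series of ratio `ρ z`.
Multiplying by `‖1 - ρ z‖²` sums it without a division. -/
lemma norm_sq_kmsUpper_mulVec_dft (ρ : ℂ) {N : ℕ} (n k : Fin N) :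
    ‖(kmsUpper ρ N *ᵥ fun m => dftMatrix N m k) n‖ ^ 2 * ‖1 - ρ * dftNode N k‖ ^ 2
      = 1 / N * ‖1 - (ρ * dftNode N k) ^ (N - (n : ℕ))‖ ^ 2 := by
  have h : (kmsUpper ρ N *ᵥ fun m => dftMatrix N m k) n
      = dftMatrix N n k * ∑ l ∈ Finset.range (N - n), (ρ * dftNode N k) ^ l := by
    have h1 : (kmsUpper ρ N *ᵥ fun m => dftMatrix N m k) n = ∑ m : Fin N, (fun m : ℕ =>
        if (n : ℕ) ≤ m then ρ ^ (m - n) * (dftNode N k ^ m / (√(N : ℝ) : ℝ)) else 0) m := by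
      simp only [Matrix.mulVec, dotProduct, kmsUpper, Matrix.of_apply, Fin.le_def, dftMatrix_apply]
      refine Finset.sum_congr rfl fun m _ => ?_
      split_ifs <;> simp
    rw [h1, Fin.sum_univ_eq_sum_range (fun m : ℕ =>
        if (n : ℕ) ≤ m then ρ ^ (m - n) * (dftNode N k ^ m / (√(N : ℝ) : ℝ)) else 0) N,
      ← Finset.sum_filter]
    have hf : (Finset.range N).filter (fun m => (n : ℕ) ≤ m) = Finset.Ico (n : ℕ) N := by
      ext m; simp; omega
    rw [hf, Finset.sum_Ico_eq_sum_range, Finset.mul_sum, dftMatrix_apply]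
    refine Finset.sum_congr rfl fun l _ => ?_
    rw [Nat.add_sub_cancel_left, pow_add, mul_pow]
    ring
  rw [h, norm_mul, mul_pow, norm_dftMatrix_sq, mul_assoc, ← mul_pow, ← norm_mul, geom_sum_mul_neg]

/-- Truncation matters only near the last index. With `(1 + x)² ≤ 1 + 3x` on `[0, 1]` the geometric
tails add at most `3 (1 + ‖ρ‖) ≤ 6`, and the exceptional pivot at `n = 0` adds at most `4`; together
`10`. -/
lemma sum_kmsPivot_mul_le {ρ : ℂ} (hρ : ‖ρ‖ < 1) (N : ℕ) :
    ∑ n : Fin N, kmsPivot ρ n * (1 + ‖ρ‖ ^ (N - (n : ℕ))) ^ 2 ≤ (1 - ‖ρ‖ ^ 2) * N + 10 := by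
  set r := ‖ρ‖ with hr
  have hr0 : 0 ≤ r := norm_nonneg ρ
  have hq : 0 ≤ 1 - r ^ 2 := by nlinarith
  have hterm : ∀ n ∈ Finset.range N, kmsPivot ρ n * (1 + r ^ (N - n)) ^ 2
      ≤ (1 - r ^ 2) + (1 - r ^ 2) * 3 * r ^ (N - 1 - n) + if n = 0 then 4 else 0 := by
    intro n hn
    have hlt := Finset.mem_range.1 hn
    have hx0 : 0 ≤ r ^ (N - n) := by positivity
    have hx1 : r ^ (N - n) ≤ 1 := pow_le_one₀ hr0 hρ.le
    have hxy : r ^ (N - n) ≤ r ^ (N - 1 - n) := pow_le_pow_of_le_one hr0 hρ.le (by omega)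
    have h3 : (1 + r ^ (N - n)) ^ 2 ≤ 1 + 3 * r ^ (N - 1 - n) := by nlinarith
    have h4 : 0 ≤ (1 - r ^ 2) * (1 + 3 * r ^ (N - 1 - n)) := by positivity
    by_cases h0 : n = 0
    · simp only [kmsPivot, h0, if_true, one_mul]
      subst h0
      nlinarith
    · simp only [kmsPivot, h0, if_false, ← hr, add_zero]
      nlinarith
  rw [Fin.sum_univ_eq_sum_range (fun n : ℕ => kmsPivot ρ n * (1 + r ^ (N - n)) ^ 2) N]
  refine (Finset.sum_le_sum hterm).trans ?_
  rw [Finset.sum_add_distrib, Finset.sum_add_distrib, ← Finset.mul_sum,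
    Finset.sum_range_reflect (fun j => r ^ j) N]
  have hg : (∑ j ∈ Finset.range N, r ^ j) * (1 - r) ≤ 1 := by
    rw [geom_sum_mul_neg]; linarith [pow_nonneg hr0 N]
  have hgs : 0 ≤ ∑ j ∈ Finset.range N, r ^ j := Finset.sum_nonneg fun _ _ => by positivity
  have h6 : (1 - r ^ 2) * 3 * ∑ j ∈ Finset.range N, r ^ j ≤ 6 := by
    calc _ = 3 * (1 + r) * ((∑ j ∈ Finset.range N, r ^ j) * (1 - r)) := by ring
      _ ≤ 3 * (1 + r) * 1 := mul_le_mul_of_nonneg_left hg (by positivity)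
      _ ≤ 6 := by linarith
  have h4 : (∑ n ∈ Finset.range N, if n = 0 then (4 : ℝ) else 0) ≤ 4 := by
    rw [Finset.sum_ite_eq']
    split_ifs <;> norm_num
  simp only [Finset.sum_const, Finset.card_range, nsmul_eq_mul]
  linarith

lemma kms_quadratic_dft_le {ρ : ℂ} (hρ : ‖ρ‖ < 1) {N : ℕ} (k : Fin N) :
    (∑ n : Fin N, kmsPivot ρ n * ‖(kmsUpper ρ N *ᵥ fun m => dftMatrix N m k) n‖ ^ 2)
      * ‖1 - ρ * dftNode N k‖ ^ 2 ≤ (1 - ‖ρ‖ ^ 2) + 10 / N := by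
  have hN : (0 : ℝ) < N := by exact_mod_cast k.pos
  rw [Finset.sum_mul]
  have : ∀ n : Fin N, kmsPivot ρ n * ‖(kmsUpper ρ N *ᵥ fun m => dftMatrix N m k) n‖ ^ 2
      * ‖1 - ρ * dftNode N k‖ ^ 2 ≤ 1 / N * (kmsPivot ρ n * (1 + ‖ρ‖ ^ (N - (n : ℕ))) ^ 2) := by
    intro n
    rw [mul_assoc, norm_sq_kmsUpper_mulVec_dft, mul_left_comm]
    refine mul_le_mul_of_nonneg_left ?_ (by positivity)
    refine mul_le_mul_of_nonneg_left ?_ (kmsPivot_pos hρ n).le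
    refine pow_le_pow_left₀ (norm_nonneg _) ((norm_sub_le _ _).trans ?_) 2
    rw [norm_pow, norm_mul, norm_dftNode, norm_one, mul_one]
  refine (Finset.sum_le_sum fun n _ => this n).trans ?_
  rw [← Finset.mul_sum]
  calc _ ≤ 1 / (N : ℝ) * ((1 - ‖ρ‖ ^ 2) * N + 10) :=
        mul_le_mul_of_nonneg_left (sum_kmsPivot_mul_le hρ N) (by positivity)
    _ = _ := by field_simp

/-- The image of a Fourier vector under the inverse of the lower triangular factor. -/
def dftInnovation (ρ : ℂ) (N k n : ℕ) : ℂ :=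
  if n = 0 then 1 / (√(N : ℝ) : ℝ)
  else (dftNode N k ^ n - (starRingEnd ℂ) ρ * dftNode N k ^ (n - 1)) / (√(N : ℝ) : ℝ)

/-- The lower triangular factor rebuilds a sequence from its innovations `v n - conj ρ * v (n - 1)`,
which are explicit for a Fourier vector. This brings the form of the inverse into the shape of
`dotProduct_mulVec_kmsMatrix_inv`. -/
lemma kmsUpper_conjTranspose_mulVec_dftInnovation (ρ : ℂ) {N : ℕ} (k : Fin N) :
    (kmsUpper ρ N)ᴴ *ᵥ (fun n : Fin N => dftInnovation ρ N k n) = fun m => dftMatrix N m k := by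
  ext m
  have h1 : ((kmsUpper ρ N)ᴴ *ᵥ fun n : Fin N => dftInnovation ρ N k n) m
      = ∑ n : Fin N, (fun n : ℕ => if n ≤ (m : ℕ) then
          (starRingEnd ℂ) ρ ^ ((m : ℕ) - n) * dftInnovation ρ N k n else 0) n := by
    simp only [Matrix.mulVec, dotProduct, kmsUpper, Matrix.of_apply, Fin.le_def,
      Matrix.conjTranspose_apply]
    refine Finset.sum_congr rfl fun n _ => ?_
    split_ifs <;> simp
  have hf : (Finset.range N).filter (fun k => k ≤ (m : ℕ)) = Finset.range (m + 1) := by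
    ext k; have := m.2; simp; omega
  rw [h1, Fin.sum_univ_eq_sum_range (fun n : ℕ => if n ≤ (m : ℕ) then
          (starRingEnd ℂ) ρ ^ ((m : ℕ) - n) * dftInnovation ρ N k n else 0) N,
    ← Finset.sum_filter, hf, dftMatrix_apply]
  generalize (m : ℕ) = j
  induction j with
  | zero => simp [dftInnovation]
  | succ j ih =>
    rw [Finset.sum_range_succ]
    have : ∀ i ∈ Finset.range (j + 1),
        (starRingEnd ℂ) ρ ^ (j + 1 - i) * dftInnovation ρ N k i
        = (starRingEnd ℂ) ρ * ((starRingEnd ℂ) ρ ^ (j - i) * dftInnovation ρ N k i) :=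
      fun i hi => by
        rw [Nat.succ_sub (by simpa [Nat.lt_succ_iff] using hi), pow_succ]; ring
    rw [Finset.sum_congr rfl this, ← Finset.mul_sum, ih]
    simp [dftInnovation]
    ring

lemma norm_sq_dftInnovation (ρ : ℂ) {N : ℕ} (k : Fin N) (n : ℕ) (hn : n ≠ 0) :
    ‖dftInnovation ρ N k n‖ ^ 2 = 1 / N * ‖1 - ρ * dftNode N k‖ ^ 2 := by
  obtain ⟨j, rfl⟩ := Nat.exists_eq_succ_of_ne_zero hn
  have h1 : dftNode N k ^ (j + 1) - (starRingEnd ℂ) ρ * dftNode N k ^ j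
      = dftNode N k ^ j * dftNode N k * (starRingEnd ℂ) (1 - ρ * dftNode N k) := by
    have : dftNode N k * (starRingEnd ℂ) (dftNode N k) = 1 := by
      rw [Complex.mul_conj, Complex.normSq_eq_norm_sq, norm_dftNode]; simp
    simp only [map_sub, map_one, map_mul]
    linear_combination ((starRingEnd ℂ) ρ * dftNode N k ^ j) * this
  simp only [dftInnovation, Nat.succ_eq_add_one, Nat.add_sub_cancel, hn, if_false]
  rw [h1]
  simp only [norm_div, norm_mul, norm_pow, norm_dftNode, RCLike.norm_conj, Complex.norm_real]
  rw [Real.norm_of_nonneg (by positivity), div_pow, Real.sq_sqrt (by positivity)]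
  simp; ring

/-- All innovations after the first have the same modulus, so the form is the reciprocal symbol up
to the contribution `1 / N` of the index `0`. -/
lemma kms_inv_quadratic_dft_le {ρ : ℂ} (hρ : ‖ρ‖ < 1) {N : ℕ} (k : Fin N) :
    ∑ n : Fin N, (kmsPivot ρ n)⁻¹ * ‖dftInnovation ρ N k n‖ ^ 2
      ≤ 1 / N + ‖1 - ρ * dftNode N k‖ ^ 2 / (1 - ‖ρ‖ ^ 2) := by
  have hN : (0 : ℝ) < N := by exact_mod_cast k.pos
  have hq : 0 < 1 - ‖ρ‖ ^ 2 := by have := norm_nonneg ρ; nlinarith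
  rw [Fin.sum_univ_eq_sum_range (fun n : ℕ => (kmsPivot ρ n)⁻¹ * ‖dftInnovation ρ N k n‖ ^ 2) N]
  have hterm : ∀ n ∈ Finset.range N, (kmsPivot ρ n)⁻¹ * ‖dftInnovation ρ N k n‖ ^ 2
      ≤ (if n = 0 then 1 / (N : ℝ) else 0)
        + 1 / N * (‖1 - ρ * dftNode N k‖ ^ 2 / (1 - ‖ρ‖ ^ 2)) := by
    intro n _
    by_cases h0 : n = 0
    · subst h0
      simp only [kmsPivot, dftInnovation, if_true, norm_div, Complex.norm_real]
      rw [Real.norm_of_nonneg (by positivity), div_pow, Real.sq_sqrt (by positivity)]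
      simp only [norm_one, inv_one, one_pow, one_mul, le_add_iff_nonneg_right]
      positivity
    · rw [norm_sq_dftInnovation ρ k n h0]
      simp only [kmsPivot, h0, if_false, zero_add]
      exact le_of_eq (by ring)
  refine (Finset.sum_le_sum hterm).trans ?_
  rw [Finset.sum_add_distrib, Finset.sum_ite_eq']
  simp only [Finset.sum_const, Finset.card_range, nsmul_eq_mul]
  have : (N : ℝ) * (1 / N * (‖1 - ρ * dftNode N k‖ ^ 2 / (1 - ‖ρ‖ ^ 2)))
      = ‖1 - ρ * dftNode N k‖ ^ 2 / (1 - ‖ρ‖ ^ 2) := by field_simp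
  rw [this]
  gcongr
  split_ifs
  · exact le_rfl
  · positivity

/-- The trace of `K ^ (-1/2)` for the KMS matrix is within a bounded distance of the sum of
the values of the inverse square root of the symbol at the Fourier nodes. -/
lemma exists_abs_sum_eigenvalue_sub_le {ρ : ℂ} (hρ : ‖ρ‖ < 1) :
    ∃ C : ℝ, ∀ (N : ℕ) (W : Matrix (Fin N) (Fin N) ℂ), W ∈ Matrix.unitaryGroup (Fin N) ℂ →
      ∀ ev : Fin N → ℝ, kmsMatrix ρ N = W * Matrix.diagonal (fun i => (ev i : ℂ)) * Wᴴ →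
      |∑ i, ev i ^ (-(1 / 2) : ℝ)
        - ∑ k : Fin N, ‖1 - ρ * dftNode N k‖ / √(1 - ‖ρ‖ ^ 2)| ≤ C := by
  set r := ‖ρ‖ with hr
  have hr0 : 0 ≤ r := norm_nonneg ρ
  have hq : 0 < 1 - r ^ 2 := by nlinarith
  set q := 1 - r ^ 2 with hqdef
  have hsq : 0 < √q := Real.sqrt_pos.2 hq
  -- The two terms dominate `N` times the lower and the upper error at one Fourier vector; summing
  -- over the `N` vectors gives a bound free of `N`.
  refine ⟨10 / (√q * q) + √q / (1 - r), fun N W hW ev hK => ?_⟩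
  have hpos := spectral_pos hW (kmsMatrix_posDef hρ N) hK
  have hWH : Wᴴ ∈ Matrix.unitaryGroup (Fin N) ℂ :=
    Matrix.mem_unitaryGroup_iff.2 (by
      rw [Matrix.star_eq_conjTranspose, Matrix.conjTranspose_conjTranspose]
      exact Matrix.mem_unitaryGroup_iff'.1 hW)
  set b : Fin N → ℝ := fun i => ev i ^ (-(1 / 2) : ℝ) with hb
  have hbpos : ∀ i, 0 < b i := fun i => Real.rpow_pos_of_pos (hpos i) _
  have hb2 : ∀ i, b i ^ 2 = (ev i)⁻¹ := fun i => by
    rw [hb]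
    simp only
    rw [← Real.rpow_natCast, ← Real.rpow_mul (hpos i).le, ← Real.rpow_neg_one]
    norm_num
  set p : Fin N → Fin N → ℝ := fun k i => ‖(Wᴴ *ᵥ fun m => dftMatrix N m k) i‖ ^ 2 with hp
  have hWV : Wᴴ * dftMatrix N ∈ Matrix.unitaryGroup (Fin N) ℂ :=
    mul_mem hWH (dftMatrix_mem_unitaryGroup N)
  have hpsum : ∀ i, ∑ k, p k i = 1 := fun i => by
    rw [← sum_norm_sq_row_unitary hWV i]
    rfl
  have hp1 : ∀ k, ∑ i, p k i = 1 := fun k => by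
    have hN : (0 : ℝ) < N := by exact_mod_cast k.pos
    rw [hp]
    simp only
    rw [sum_norm_sq_unitary_mulVec hWH]
    simp only [norm_dftMatrix_sq]
    simp
    field_simp
  have hp0 : ∀ k i, 0 ≤ p k i := fun k i => by positivity
  -- The squared moduli of the entries of the unitary matrix `Wᴴ V` are doubly stochastic. Hence the
  -- trace is a sum over Fourier vectors of weighted means of `ev ^ (-1/2)`.
  have htot : ∑ i, b i = ∑ k, ∑ i, p k i * b i := by
    rw [Finset.sum_comm]
    refine Finset.sum_congr rfl fun i _ => ?_
    rw [← Finset.sum_mul, hpsum, one_mul]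
  rw [htot, ← Finset.sum_sub_distrib]
  have hbound : ∀ k : Fin N, |∑ i, p k i * b i - ‖1 - ρ * dftNode N k‖ / √q|
      ≤ 1 / N * (10 / (√q * q) + √q / (1 - r)) := by
    intro k
    have hN : (0 : ℝ) < N := by exact_mod_cast k.pos
    set a := ‖1 - ρ * dftNode N k‖ with ha
    have hzr : ‖ρ * dftNode N k‖ = r := by rw [norm_mul, norm_dftNode, mul_one]
    have ha1 : 1 - r ≤ a := by
      have := norm_sub_norm_le (1 : ℂ) (ρ * dftNode N k)
      rwa [hzr, norm_one] at this
    have ha2 : a ≤ 2 := by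
      have := norm_sub_le (1 : ℂ) (ρ * dftNode N k)
      rw [hzr, norm_one] at this
      linarith
    have hapos : 0 < a := by linarith
    -- The tangency point `c = a / √q` is the inverse square root of the symbol at the node, so both
    -- tangent bounds are sharp to leading order.
    have hc : 0 < a / √q := by positivity
    have hs1 : ∑ i, ev i * p k i
        = ∑ n : Fin N, kmsPivot ρ n * ‖(kmsUpper ρ N *ᵥ fun m => dftMatrix N m k) n‖ ^ 2 := by
      apply Complex.ofReal_injective
      rw [← dotProduct_mulVec_kmsMatrix, hK, dotProduct_mulVec_spectral]
    have hs2 : ∑ i, (ev i)⁻¹ * p k i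
        = ∑ n : Fin N, (kmsPivot ρ n)⁻¹ * ‖dftInnovation ρ N k n‖ ^ 2 := by
      apply Complex.ofReal_injective
      rw [← dotProduct_mulVec_kmsMatrix_inv hρ N, kmsUpper_conjTranspose_mulVec_dftInnovation, hK,
        spectral_inv hW (fun i => (hpos i).ne'), dotProduct_mulVec_spectral]
    have hup := sqrt_weighted_mean_le Finset.univ (fun i _ => hp0 k i) (hp1 k)
      (fun i _ => hb2 i) hc
    have hlo := le_weighted_mean_rsqrt Finset.univ (fun i _ => hp0 k i) (hp1 k)
      (fun i _ => hbpos i) (fun i _ => hb2 i) hc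
    rw [hs2] at hup
    rw [hs1] at hlo
    have h1 := kms_quadratic_dft_le hρ k
    have h2 := kms_inv_quadratic_dft_le hρ k
    rw [← ha, ← hr, ← hqdef] at h1 h2
    set s := ∑ n : Fin N, kmsPivot ρ n * ‖(kmsUpper ρ N *ᵥ fun m => dftMatrix N m k) n‖ ^ 2
    set s' := ∑ n : Fin N, (kmsPivot ρ n)⁻¹ * ‖dftInnovation ρ N k n‖ ^ 2
    have hsqq : √q ^ 2 = q := Real.sq_sqrt hq.le
    have e1 : (a / √q) ^ 3 * s ≤ a / √q + 2 / √q * (10 / (N * q)) := by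
      calc (a / √q) ^ 3 * s = (a / √q) * (s * a ^ 2 / √q ^ 2) := by field_simp
        _ = (a / √q) * (s * a ^ 2 / q) := by rw [hsqq]
        _ ≤ (a / √q) * ((q + 10 / N) / q) := by gcongr
        _ = a / √q + a / √q * (10 / (N * q)) := by field_simp
        _ ≤ _ := by gcongr
    have e2 : s' / (a / √q) ≤ a / √q + 1 / N * (√q / (1 - r)) := by
      calc s' / (a / √q) ≤ (1 / N + a ^ 2 / q) / (a / √q) := by gcongr
        _ = 1 / N * (√q / a) + a / √q := by
            nth_rewrite 1 [← hsqq]; field_simp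
        _ ≤ a / √q + 1 / N * (√q / (1 - r)) := by
            have h1r : 0 < 1 - r := by linarith
            rw [add_comm]; gcongr
    have e3 : 2 / √q * (10 / (N * q)) = 2 * (1 / N * (10 / (√q * q))) := by field_simp
    have p1 : 0 ≤ 1 / N * (10 / (√q * q)) := by positivity
    have p2 : 0 ≤ 1 / N * (√q / (1 - r)) := by
      have h1r : 0 < 1 - r := by linarith
      positivity
    rw [abs_le, mul_add]
    constructor <;> linarith
  refine (Finset.abs_sum_le_sum_abs _ _).trans ((Finset.sum_le_sum fun k _ => hbound k).trans ?_)
  have h1r : 0 < 1 - r := by linarith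
  rcases Nat.eq_zero_or_pos N with rfl | hN
  · simp; positivity
  · rw [Finset.sum_const, Finset.card_univ, Fintype.card_fin, nsmul_eq_mul]
    have hN' : (0 : ℝ) < N := by exact_mod_cast hN
    refine le_of_eq ?_
    field_simp

/-! ### The limit of the spectral mean as an elliptic integral -/

lemma abs_riemann_sum_sub_integral_le {f : ℝ → ℝ} (hf : ∀ x y, |f x - f y| ≤ |x - y|)
    (hc : Continuous f) {N : ℕ} (hN : 0 < N) :
    |(∑ k ∈ Finset.range N, f (2 * Real.pi * k / N)) * (2 * Real.pi / N)
      - ∫ x in (0 : ℝ)..(2 * Real.pi), f x| ≤ (2 * Real.pi) ^ 2 / N := by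
  have hN' : (0 : ℝ) < N := by exact_mod_cast hN
  set a : ℕ → ℝ := fun k => 2 * Real.pi * k / N with ha
  have hstep : ∀ k, a (k + 1) - a k = 2 * Real.pi / N := fun k => by
    simp only [ha]; push_cast; field_simp; ring
  have h1 : ∫ x in (0 : ℝ)..(2 * Real.pi), f x
      = ∑ k ∈ Finset.range N, ∫ x in (a k)..(a (k + 1)), f x := by
    rw [intervalIntegral.sum_integral_adjacent_intervals
      (fun k _ => hc.intervalIntegrable _ _)]
    congr 1
    · simp [ha]
    · simp only [ha]; field_simp
  rw [h1, Finset.sum_mul, ← Finset.sum_sub_distrib]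
  have h2 : ∀ k ∈ Finset.range N, |f (a k) * (2 * Real.pi / N) - ∫ x in (a k)..(a (k + 1)), f x|
      ≤ (2 * Real.pi / N) * (2 * Real.pi / N) := by
    intro k _
    have hle : a k ≤ a (k + 1) := by
      have := hstep k
      have : 0 < 2 * Real.pi / N := by positivity
      linarith
    have h3 : f (a k) * (2 * Real.pi / N) - ∫ x in (a k)..(a (k + 1)), f x
        = ∫ x in (a k)..(a (k + 1)), (f (a k) - f x) := by
      rw [intervalIntegral.integral_sub (by simp) (hc.intervalIntegrable _ _),
        intervalIntegral.integral_const, hstep, smul_eq_mul, mul_comm]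
    rw [h3, ← Real.norm_eq_abs]
    refine (intervalIntegral.norm_integral_le_of_norm_le_const
      (C := 2 * Real.pi / N) fun x hx => ?_).trans (le_of_eq ?_)
    · rw [Set.uIoc_of_le hle] at hx
      rw [Real.norm_eq_abs]
      refine (hf _ _).trans ?_
      rw [abs_sub_comm, abs_of_nonneg (by linarith [hx.1]), ← hstep k]
      linarith [hx.2]
    · rw [hstep, abs_of_nonneg (by positivity)]
  refine (Finset.abs_sum_le_sum_abs _ _).trans ((Finset.sum_le_sum h2).trans (le_of_eq ?_))
  rw [Finset.sum_const, Finset.card_range, nsmul_eq_mul]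
  field_simp

/-- The reverse triangle inequality and `|e^(it) - 1| ≤ |t|` give the Lipschitz constant `1` that
the Riemann sum estimate asks for. -/
lemma abs_norm_one_sub_sub_le (ρ : ℂ) (hρ : ‖ρ‖ ≤ 1) (x y : ℝ) :
    |‖1 - ρ * Complex.exp (((-x : ℝ) : ℂ) * Complex.I)‖
      - ‖1 - ρ * Complex.exp (((-y : ℝ) : ℂ) * Complex.I)‖| ≤ |x - y| := by
  refine (abs_norm_sub_norm_le _ _).trans ?_
  have h1 : (1 - ρ * Complex.exp (((-x : ℝ) : ℂ) * Complex.I))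
      - (1 - ρ * Complex.exp (((-y : ℝ) : ℂ) * Complex.I))
      = ρ * Complex.exp (((-x : ℝ) : ℂ) * Complex.I)
        * (Complex.exp (Complex.I * ((x - y : ℝ) : ℂ)) - 1) := by
    have : Complex.exp (((-y : ℝ) : ℂ) * Complex.I)
        = Complex.exp (((-x : ℝ) : ℂ) * Complex.I) * Complex.exp (Complex.I * ((x - y : ℝ) : ℂ)) := by
      rw [← Complex.exp_add]; congr 1; push_cast; ring
    rw [this]; ring
  rw [h1, norm_mul, norm_mul, Complex.norm_exp_ofReal_mul_I, mul_one]
  calc _ ≤ 1 * ‖x - y‖ := by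
        gcongr
        exact Real.norm_exp_I_mul_ofReal_sub_one_le
    _ = _ := by rw [one_mul, Real.norm_eq_abs]

/-- Periodicity allows the phase of `ρ` to be absorbed into a shift, made so that the integrand
becomes `√(1 + r² + 2r cos t)`. The half-angle `t = 2θ` turns this into `(1 + r) √(1 - k² sin² θ)`
with `k² = 4r / (1 + r)²`, and reflection about `π / 2` leaves a quarter period. -/
lemma integral_norm_one_sub_eq_ellipticE (ρ : ℂ) :
    ∫ x in (0 : ℝ)..(2 * Real.pi), ‖1 - ρ * Complex.exp (((-x : ℝ) : ℂ) * Complex.I)‖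
      = 4 * (1 + ‖ρ‖) * ellipticE (2 * √‖ρ‖ / (1 + ‖ρ‖)) := by
  set r := ‖ρ‖ with hr
  have hr0 : 0 ≤ r := norm_nonneg ρ
  set G : ℝ → ℝ := fun t => √(1 + r ^ 2 + 2 * r * Real.cos t) with hG
  have hGc : Continuous G := by fun_prop
  have hGp : Function.Periodic G (2 * Real.pi) := fun t => by simp [hG]
  have h1 : ∀ x : ℝ, ‖1 - ρ * Complex.exp (((-x : ℝ) : ℂ) * Complex.I)‖
      = G (x + (Real.pi - ρ.arg)) := by
    intro x
    have hz : ρ * Complex.exp (((-x : ℝ) : ℂ) * Complex.I)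
        = r * Complex.exp (((ρ.arg - x : ℝ) : ℂ) * Complex.I) := by
      conv_lhs => rw [← Complex.norm_mul_exp_arg_mul_I ρ]
      rw [mul_assoc, ← Complex.exp_add]; congr 2; push_cast; ring
    have hcos : Real.cos (x + (Real.pi - ρ.arg)) = - Real.cos (ρ.arg - x) := by
      rw [show x + (Real.pi - ρ.arg) = Real.pi - (ρ.arg - x) by ring, Real.cos_pi_sub]
    rw [hz, hG]
    simp only
    rw [hcos, ← Real.sqrt_sq (norm_nonneg _)]
    congr 1
    rw [Complex.sq_norm, Complex.normSq_apply]
    simp only [Complex.sub_re, Complex.sub_im, Complex.one_re, Complex.one_im,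
      Complex.re_ofReal_mul, Complex.im_ofReal_mul, Complex.exp_ofReal_mul_I_re,
      Complex.exp_ofReal_mul_I_im]
    nlinarith [Real.sin_sq_add_cos_sq (ρ.arg - x)]
  simp_rw [h1]
  rw [intervalIntegral.integral_comp_add_right G, zero_add, add_comm (2 * Real.pi),
    hGp.intervalIntegral_add_eq _ 0, zero_add]
  set k := 2 * √r / (1 + r) with hk
  set J : ℝ → ℝ := fun θ => √(1 - k ^ 2 * Real.sin θ ^ 2) with hJ
  have hJc : Continuous J := by fun_prop
  have hGJ : ∀ θ, G (2 * θ) = (1 + r) * J θ := by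
    intro θ
    rw [hG, hJ]
    simp only
    conv_rhs => rw [← Real.sqrt_sq (by positivity : 0 ≤ 1 + r)]
    rw [← Real.sqrt_mul (by positivity)]
    congr 1
    have hk2 : (1 + r) ^ 2 * k ^ 2 = 4 * r := by
      rw [hk, div_pow, mul_pow, Real.sq_sqrt hr0]; field_simp; norm_num
    rw [mul_sub, ← mul_assoc, hk2, Real.cos_two_mul]
    nlinarith [Real.sin_sq_add_cos_sq θ]
  have h2 : ∫ x in (0 : ℝ)..(2 * Real.pi), G x = 2 * ∫ θ in (0 : ℝ)..Real.pi, G (2 * θ) := by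
    have := intervalIntegral.mul_integral_comp_mul_left (a := 0) (b := Real.pi) (f := G) (2 : ℝ)
    rw [this]; simp
  have h3 : ∫ θ in (0 : ℝ)..Real.pi, J θ = 2 * ∫ θ in (0 : ℝ)..(Real.pi / 2), J θ := by
    rw [← intervalIntegral.integral_add_adjacent_intervals
      (hJc.intervalIntegrable 0 (Real.pi / 2)) (hJc.intervalIntegrable (Real.pi / 2) Real.pi)]
    have : ∫ θ in (Real.pi / 2)..Real.pi, J θ = ∫ θ in (0 : ℝ)..(Real.pi / 2), J θ := by
      have h := intervalIntegral.integral_comp_sub_left (a := 0) (b := Real.pi / 2) J Real.pi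
      have e : ∀ x, J (Real.pi - x) = J x := fun x => by simp [hJ]
      simp only [e] at h
      rw [h]
      congr 1 <;> ring
    rw [this]; ring
  rw [h2]
  simp_rw [hGJ]
  rw [intervalIntegral.integral_const_mul, h3, ellipticE]
  ring

/-- The limiting spectral mean `lim (1 / N) tr K ^ (-1/2)` of the KMS matrix. -/
def kmsSpectralMean (r : ℝ) : ℝ :=
  2 * (1 + r) / (Real.pi * √(1 - r ^ 2)) * ellipticE (2 * √r / (1 + r))

/-- Both the passage from eigenvalues to symbol values and the Riemann sum have bounded total error,
so after division by `Nt` the error is `O(1 / Nt)`. -/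
lemma tendsto_spectral_mean {ρ : ℂ} (hρ : ‖ρ‖ < 1) {Nt : ℕ → ℕ} (hNt : Tendsto Nt atTop atTop)
    {W : ∀ n, Matrix (Fin (Nt n)) (Fin (Nt n)) ℂ}
    (hW : ∀ n, W n ∈ Matrix.unitaryGroup (Fin (Nt n)) ℂ) {ev : ∀ n, Fin (Nt n) → ℝ}
    (hK : ∀ n, kmsMatrix ρ (Nt n) = W n * Matrix.diagonal (fun i => (ev n i : ℂ)) * (W n)ᴴ) :
    Tendsto (fun n => (∑ i, ev n i ^ (-(1 / 2) : ℝ)) / Nt n) atTop (𝓝 (kmsSpectralMean ‖ρ‖)) := by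
  obtain ⟨C, hC⟩ := exists_abs_sum_eigenvalue_sub_le hρ
  have hq : 0 < 1 - ‖ρ‖ ^ 2 := by have := norm_nonneg ρ; nlinarith
  have hsq : 0 < √(1 - ‖ρ‖ ^ 2) := Real.sqrt_pos.2 hq
  set s := √(1 - ‖ρ‖ ^ 2) with hs
  set g : ℝ → ℝ := fun x => ‖1 - ρ * Complex.exp (((-x : ℝ) : ℂ) * Complex.I)‖ with hg
  have hgc : Continuous g := by fun_prop
  set B : ℝ := C + 2 * Real.pi / s with hB
  have hlim : Tendsto (fun n => B / (Nt n : ℝ)) atTop (𝓝 0) :=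
    Tendsto.const_div_atTop (tendsto_natCast_atTop_atTop.comp hNt) B
  refine tendsto_iff_norm_sub_tendsto_zero.2 (squeeze_zero' (Eventually.of_forall fun n =>
    norm_nonneg _) ?_ hlim)
  filter_upwards [hNt.eventually_gt_atTop 0] with n hn
  have hN : (0 : ℝ) < Nt n := by exact_mod_cast hn
  have h1 := hC (Nt n) (W n) (hW n) (ev n) (hK n)
  have h2 := abs_riemann_sum_sub_integral_le (abs_norm_one_sub_sub_le ρ hρ.le) hgc hn
  have h3 : ∑ k : Fin (Nt n), ‖1 - ρ * dftNode (Nt n) k‖ / s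
      = (∑ k ∈ Finset.range (Nt n), g (2 * Real.pi * k / Nt n)) / s := by
    rw [Fin.sum_univ_eq_sum_range (fun k => ‖1 - ρ * dftNode (Nt n) k‖ / s), ← Finset.sum_div]
    rfl
  rw [h3] at h1
  change |(∑ k ∈ Finset.range (Nt n), g (2 * Real.pi * k / Nt n)) * (2 * Real.pi / Nt n)
      - ∫ x in (0 : ℝ)..(2 * Real.pi), g x| ≤ _ at h2
  have h4 : ∫ x in (0 : ℝ)..(2 * Real.pi), g x = kmsSpectralMean ‖ρ‖ * (2 * Real.pi * s) := by
    rw [hg, integral_norm_one_sub_eq_ellipticE, kmsSpectralMean, ← hs]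
    field_simp; norm_num
  rw [h4] at h2
  set S := ∑ k ∈ Finset.range (Nt n), g (2 * Real.pi * k / Nt n)
  set T := ∑ i, ev n i ^ (-(1 / 2) : ℝ)
  rw [Real.norm_eq_abs]
  have e1 : T / Nt n - kmsSpectralMean ‖ρ‖ = (T - S / s) / Nt n
      + (S * (2 * Real.pi / Nt n) - kmsSpectralMean ‖ρ‖ * (2 * Real.pi * s))
        / (2 * Real.pi * s) := by
    field_simp; ring
  rw [e1]
  refine (abs_add_le _ _).trans ?_
  rw [abs_div, abs_div, abs_of_pos hN, abs_of_pos (by positivity : 0 < 2 * Real.pi * s)]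
  calc _ ≤ C / Nt n + ((2 * Real.pi) ^ 2 / Nt n) / (2 * Real.pi * s) := by gcongr
    _ = B / Nt n := by rw [hB]; field_simp

/-! ### Measurability of matrix expressions -/

section MatrixMeasurability

variable {α : Type*} [MeasurableSpace α]

/-- A matrix valued function all of whose entries are measurable. -/
def MeasurableEntries {m n : Type*} (A : α → Matrix m n ℂ) : Prop :=
  ∀ i j, Measurable fun a => A a i j

lemma MeasurableEntries.mul {l m n : Type*} [Fintype m] {A : α → Matrix l m ℂ}
    {B : α → Matrix m n ℂ} (hA : MeasurableEntries A) (hB : MeasurableEntries B) :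
    MeasurableEntries fun a => A a * B a := fun i j => by
  simp only [Matrix.mul_apply]
  exact Finset.measurable_fun_sum _ fun k _ => (hA i k).mul (hB k j)

lemma MeasurableEntries.conjTranspose {m n : Type*} {A : α → Matrix m n ℂ}
    (hA : MeasurableEntries A) : MeasurableEntries fun a => (A a)ᴴ := fun i j => by
  simp only [Matrix.conjTranspose_apply]
  exact Complex.continuous_conj.measurable.comp (hA j i)

lemma MeasurableEntries.const {m n : Type*} (A : Matrix m n ℂ) :
    MeasurableEntries fun _ : α => A := fun _ _ => measurable_const

lemma MeasurableEntries.sub {m n : Type*} {A B : α → Matrix m n ℂ}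
    (hA : MeasurableEntries A) (hB : MeasurableEntries B) :
    MeasurableEntries fun a => A a - B a := fun i j => by
  simp only [Matrix.sub_apply]
  exact (hA i j).sub (hB i j)

lemma MeasurableEntries.det {n : Type*} [Fintype n] [DecidableEq n] {A : α → Matrix n n ℂ}
    (hA : MeasurableEntries A) : Measurable fun a => (A a).det := by
  simp only [Matrix.det_apply]
  exact Finset.measurable_fun_sum _ fun σ _ =>
    (Finset.measurable_fun_prod _ fun i _ => hA _ _).const_smul _

lemma MeasurableEntries.inv {n : Type*} [Fintype n] [DecidableEq n] {A : α → Matrix n n ℂ}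
    (hA : MeasurableEntries A) : MeasurableEntries fun a => (A a)⁻¹ := fun i j => by
  simp only [Matrix.inv_def, Matrix.smul_apply, Ring.inverse_eq_inv', smul_eq_mul,
    Matrix.adjugate_apply]
  refine hA.det.inv.mul (MeasurableEntries.det fun k l => ?_)
  simp only [Matrix.updateRow_apply]
  split_ifs
  · exact measurable_const
  · exact hA k l

lemma MeasurableEntries.mulVec {m n : Type*} [Fintype n] {A : α → Matrix m n ℂ}
    (hA : MeasurableEntries A) {v : α → n → ℂ} (hv : Measurable v) :
    Measurable fun a => A a *ᵥ v a := by
  refine measurable_pi_lambda _ fun i => ?_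
  simp only [Matrix.mulVec, dotProduct]
  exact Finset.measurable_fun_sum _ fun k _ => (hA i k).mul ((measurable_pi_apply k).comp hv)

lemma measurable_dotProduct {n : Type*} [Fintype n] {u v : α → n → ℂ} (hu : Measurable u)
    (hv : Measurable v) : Measurable fun a => u a ⬝ᵥ v a := by
  simp only [dotProduct]
  exact Finset.measurable_fun_sum _ fun k _ =>
    ((measurable_pi_apply k).comp hu).mul ((measurable_pi_apply k).comp hv)

lemma measurable_star_vec {n : Type*} {u : α → n → ℂ} (hu : Measurable u) :
    Measurable fun a => star (u a) :=
  measurable_pi_lambda _ fun k => Complex.continuous_conj.measurable.comp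
    ((measurable_pi_apply k).comp hu)

end MatrixMeasurability

/-! ### Quadratic forms of Gaussian vectors -/

/-- The law of a vector of i.i.d. standard complex normals. -/
def stdComplexNormal (n : ℕ) : Measure (Fin n → ℂ) := Measure.pi fun _ => complexNormal 1

instance (n : ℕ) : IsProbabilityMeasure (stdComplexNormal n) := by
  unfold stdComplexNormal; infer_instance

lemma map_unitary_stdComplexNormal {n : ℕ} {U : Matrix (Fin n) (Fin n) ℂ}
    (hU : U ∈ Matrix.unitaryGroup (Fin n) ℂ) :
    (stdComplexNormal n).map (fun g => U *ᵥ g) = stdComplexNormal n := by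
  have h2 : U * Uᴴ = 1 := Matrix.mem_unitaryGroup_iff.1 hU
  have := map_mulVec_pi_complexNormal (v := 1) (a := 1) zero_le_one zero_le_one U (by simp [h2])
  rw [mul_one] at this
  exact this

/-- Idempotent weights are `0` or `1`, so mean and variance of the sum are both proportional to the
number `d` of ones. Chebyshev's inequality then gives a relative deviation bound of order `1 / d`.
-/
lemma sum_weight_norm_sq_concentration {n : ℕ} (w : Fin n → ℝ) (hw : ∀ i, w i ^ 2 = w i)
    {d : ℝ} (hd : 0 < d) (hsum : ∑ i, w i = d) {δ : ℝ} (hδ : 0 < δ) :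
    stdComplexNormal n {g | δ ≤ |(∑ i, w i * ‖g i‖ ^ 2) / d - 1|}
      ≤ ENNReal.ofReal (Var[fun z : ℂ => ‖z‖ ^ 2; complexNormal 1] / (d * δ ^ 2)) := by
  set X : Fin n → ℂ → ℝ := fun i z => w i * ‖z‖ ^ 2 with hX
  have hXm : ∀ i, MemLp (X i) 2 (complexNormal 1) := fun i =>
    memLp_norm_sq_complexNormal.const_mul _
  have hXe : ∀ i, MemLp (fun g : Fin n → ℂ => X i (g i)) 2 (stdComplexNormal n) := fun i =>
    (hXm i).comp_measurePreserving (measurePreserving_eval (fun _ => complexNormal 1) i)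
  have hS : MemLp (∑ i, fun g : Fin n → ℂ => X i (g i)) 2 (stdComplexNormal n) :=
    memLp_finsetSum' _ fun i _ => hXe i
  have hvar : Var[∑ i, fun g : Fin n → ℂ => X i (g i); stdComplexNormal n]
      = d * Var[fun z : ℂ => ‖z‖ ^ 2; complexNormal 1] := by
    rw [stdComplexNormal, variance_sum_pi hXm, ← hsum, Finset.sum_mul]
    refine Finset.sum_congr rfl fun i _ => ?_
    rw [hX, variance_const_mul, hw]
  have hmean : ∫ g, (∑ i, fun g : Fin n → ℂ => X i (g i)) g ∂stdComplexNormal n = d := by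
    simp only [Finset.sum_apply]
    rw [integral_finsetSum _ fun i _ => (hXe i).integrable (by norm_num), ← hsum]
    refine Finset.sum_congr rfl fun i _ => ?_
    rw [stdComplexNormal, integral_comp_eval (μ := fun _ : Fin n => complexNormal 1)
      (f := X i) (hXm i).1, hX]
    simp only
    rw [integral_const_mul, integral_norm_sq_complexNormal, mul_one]
  have h := meas_ge_le_variance_div_sq hS (c := d * δ) (by positivity)
  rw [hmean, hvar] at h
  refine (measure_mono fun g hg => ?_).trans (h.trans (le_of_eq ?_))
  · simp only [Set.mem_ofPred_eq, Finset.sum_apply, hX] at hg ⊢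
    have : (∑ i, w i * ‖g i‖ ^ 2) - d = d * ((∑ i, w i * ‖g i‖ ^ 2) / d - 1) := by field_simp
    rw [this, abs_mul, abs_of_pos hd]
    gcongr
  · congr 1; field_simp

/-- An eigenbasis of the projection is a unitary change of variables that preserves the Gaussian
law; in it the form has idempotent weights whose sum is the trace. -/
lemma projection_concentration {n : ℕ} {Q : Matrix (Fin n) (Fin n) ℂ} (hQ : Q.IsHermitian)
    (hQ2 : Q * Q = Q) {d : ℝ} (hd : 0 < d) (htr : Q.trace = d) {δ : ℝ} (hδ : 0 < δ) :
    stdComplexNormal n {g | δ ≤ |(star g ⬝ᵥ (Q *ᵥ g)).re / d - 1|}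
      ≤ ENNReal.ofReal (Var[fun z : ℂ => ‖z‖ ^ 2; complexNormal 1] / (d * δ ^ 2)) := by
  set U : Matrix (Fin n) (Fin n) ℂ := hQ.eigenvectorUnitary.1 with hU
  have hUm : U ∈ Matrix.unitaryGroup (Fin n) ℂ := hQ.eigenvectorUnitary.2
  have h1 : Uᴴ * U = 1 := Matrix.mem_unitaryGroup_iff'.1 hUm
  have h2 : U * Uᴴ = 1 := Matrix.mem_unitaryGroup_iff.1 hUm
  have hspec : Q = U * Matrix.diagonal (fun i => (hQ.eigenvalues i : ℂ)) * Uᴴ := by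
    have := hQ.spectral_theorem
    rwa [Unitary.conjStarAlgAut_apply] at this
  have hdiag : Matrix.diagonal (fun i => (hQ.eigenvalues i : ℂ)) = Uᴴ * Q * U := by
    calc _ = (Uᴴ * U) * Matrix.diagonal (fun i => (hQ.eigenvalues i : ℂ)) * (Uᴴ * U) := by
          rw [h1, Matrix.one_mul, Matrix.mul_one]
      _ = Uᴴ * (U * Matrix.diagonal (fun i => (hQ.eigenvalues i : ℂ)) * Uᴴ) * U := by
          simp only [Matrix.mul_assoc]
      _ = _ := by rw [← hspec]
  have hw : ∀ i, hQ.eigenvalues i ^ 2 = hQ.eigenvalues i := by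
    intro i
    have h3 : Matrix.diagonal (fun i => (hQ.eigenvalues i : ℂ))
        * Matrix.diagonal (fun i => (hQ.eigenvalues i : ℂ))
        = Matrix.diagonal (fun i => (hQ.eigenvalues i : ℂ)) := by
      calc _ = Uᴴ * (Q * (U * Uᴴ) * Q) * U := by rw [hdiag]; simp only [Matrix.mul_assoc]
        _ = _ := by rw [h2, Matrix.mul_one, hQ2, hdiag]
    rw [Matrix.diagonal_mul_diagonal] at h3
    have h4 := congrFun (Matrix.diagonal_injective h3) i
    rw [sq]; exact_mod_cast h4
  have hsum : ∑ i, hQ.eigenvalues i = d := by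
    apply Complex.ofReal_injective
    rw [← htr, hQ.trace_eq_sum_eigenvalues]
    simp
  have hset : {g : Fin n → ℂ | δ ≤ |(star g ⬝ᵥ (Q *ᵥ g)).re / d - 1|}
      = (fun g => Uᴴ *ᵥ g) ⁻¹' {g | δ ≤ |(∑ i, hQ.eigenvalues i * ‖g i‖ ^ 2) / d - 1|} := by
    ext g
    simp only [Set.mem_ofPred_eq, Set.mem_preimage]
    conv_lhs => rw [hspec, dotProduct_mulVec_spectral, Complex.ofReal_re]
  have hUH : Uᴴ ∈ Matrix.unitaryGroup (Fin n) ℂ :=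
    Matrix.mem_unitaryGroup_iff.2 (by
      rw [Matrix.star_eq_conjTranspose, Matrix.conjTranspose_conjTranspose]; exact h1)
  rw [hset]
  refine (Measure.le_map_apply (measurable_matrix_mulVec _).aemeasurable _).trans ?_
  rw [map_unitary_stdComplexNormal hUH]
  exact sum_weight_norm_sq_concentration _ hw hd hsum hδ

/-! ### Gram matrices of Gaussian columns -/

/-- The matrix with given columns. -/
def ofColumns {n p : ℕ} (C : Fin p → Fin n → ℂ) : Matrix (Fin n) (Fin p) ℂ := (Matrix.of C)ᵀ

lemma measurableEntries_ofColumns {n p : ℕ} {α : Type*} [MeasurableSpace α]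
    {C : α → Fin p → Fin n → ℂ} (hC : Measurable C) :
    MeasurableEntries fun a => ofColumns (C a) := fun i j => by
  simp only [ofColumns, Matrix.transpose_apply, Matrix.of_apply]
  exact (measurable_pi_apply i).comp ((measurable_pi_apply j).comp hC)

lemma det_gram_ne_zero_iff {n p : ℕ} (C : Fin p → Fin n → ℂ) :
    ((ofColumns C)ᴴ * ofColumns C).det ≠ 0 ↔ LinearIndependent ℂ C := by
  have h : LinearIndependent ℂ C ↔ Function.Injective (ofColumns C).mulVec :=
    (Matrix.mulVec_injective_iff (M := ofColumns C)).symm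
  rw [h, ← isUnit_iff_ne_zero, ← Matrix.isUnit_iff_isUnit_det, ← Matrix.mulVec_injective_iff_isUnit]
  have e : ∀ x, ((ofColumns C)ᴴ * ofColumns C) *ᵥ x = 0 ↔ ofColumns C *ᵥ x = 0 := fun x =>
    Matrix.conjTranspose_mul_self_mulVec_eq_zero _ x
  have key : ∀ {q : ℕ} (A : Matrix (Fin q) (Fin p) ℂ),
      Function.Injective A.mulVec ↔ ∀ x, A *ᵥ x = 0 → x = 0 := fun A =>
    injective_iff_map_eq_zero A.mulVecLin
  rw [key, key]
  simp only [e]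

/-- A proper subspace lies in the kernel of a nonzero functional. Under the Gaussian law this
functional is a complex normal of positive variance, which has no atom at `0`. -/
lemma stdComplexNormal_submodule_eq_zero {n : ℕ} {V : Submodule ℂ (Fin n → ℂ)} (hV : V < ⊤) :
    stdComplexNormal n (V : Set (Fin n → ℂ)) = 0 := by
  obtain ⟨f, hf0, hf⟩ := Submodule.exists_le_ker_of_lt_top V hV
  set c : Fin n → ℂ := fun i => f (Pi.single i 1) with hc
  have hfc : ∀ x, f x = c ⬝ᵥ x := by
    intro x
    have hx : x = ∑ i, x i • (Pi.single i 1 : Fin n → ℂ) := by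
      ext j; simp [Finset.sum_apply, Pi.single_apply]
    conv_lhs => rw [hx]
    simp [dotProduct, hc, mul_comm]
  have hcs : 0 < ∑ i, ‖c i‖ ^ 2 := by
    by_contra hcon
    have hz : ∑ i, ‖c i‖ ^ 2 = 0 := le_antisymm (not_lt.1 hcon) (by positivity)
    rw [Finset.sum_eq_zero_iff_of_nonneg (fun _ _ => by positivity)] at hz
    refine hf0 (LinearMap.ext fun x => ?_)
    rw [hfc, LinearMap.zero_apply]
    refine Finset.sum_eq_zero fun i hi => ?_
    have := hz i hi
    simp only [pow_eq_zero_iff, ne_eq, OfNat.ofNat_ne_zero, not_false_eq_true, norm_eq_zero] at this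
    rw [this, zero_mul]
  have h0 : complexNormal ((∑ i, ‖c i‖ ^ 2) * 1) {0} = 0 :=
    complexNormal_absolutelyContinuous (by simpa using hcs) (measure_singleton 0)
  rw [← map_dotProduct_pi_complexNormal zero_le_one c] at h0
  refine measure_mono_null (fun x hx => ?_) (nonpos_iff_eq_zero.1
    ((Measure.le_map_apply (measurable_dotProduct measurable_const
      measurable_id).aemeasurable _).trans h0.le))
  have := hf hx
  rw [LinearMap.mem_ker, hfc] at this
  exact this

lemma measure_prod_le_of_ae_section_le {α β : Type*} [MeasurableSpace α] [MeasurableSpace β]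
    (μ : Measure α) [SFinite μ] (ν : Measure β) [IsProbabilityMeasure ν] {s : Set (α × β)}
    (hs : MeasurableSet s) {c : ENNReal} (h : ∀ᵐ y ∂ν, μ {x | (x, y) ∈ s} ≤ c) :
    (μ.prod ν) s ≤ c := by
  rw [Measure.prod_apply_symm hs]
  refine (lintegral_mono_ae h).trans ?_
  simp

lemma measurable_fin_cons {n p : ℕ} :
    Measurable fun x : (Fin n → ℂ) × (Fin p → Fin n → ℂ) =>
      (Fin.cons x.1 x.2 : Fin (p + 1) → Fin n → ℂ) := by
  refine measurable_pi_lambda _ fun i => ?_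
  refine Fin.cases ?_ (fun j => ?_) i
  · exact measurable_fst
  · exact (measurable_pi_apply j).comp measurable_snd

lemma measurePreserving_splitColumn (n p : ℕ) :
    MeasurePreserving (fun C : Fin (p + 1) → Fin n → ℂ => (C 0, Fin.tail C))
      (Measure.pi fun _ : Fin (p + 1) => stdComplexNormal n)
      ((stdComplexNormal n).prod (Measure.pi fun _ : Fin p => stdComplexNormal n)) :=
  measurePreserving_piFinSuccAbove (fun _ : Fin (p + 1) => stdComplexNormal n) 0

/-- Induction on the number of columns: the others span a subspace of dimension `p < n`, which an
independent Gaussian column almost surely avoids. -/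
lemma ae_det_gram_ne_zero {n p : ℕ} (hpn : p ≤ n) :
    ∀ᵐ C ∂(Measure.pi fun _ : Fin p => stdComplexNormal n),
      ((ofColumns C)ᴴ * ofColumns C).det ≠ 0 := by
  induction p with
  | zero => exact Eventually.of_forall fun C => by simp
  | succ p ih =>
    have ih := ih (by omega)
    have key : ∀ᵐ x ∂((stdComplexNormal n).prod
        (Measure.pi fun _ : Fin p => stdComplexNormal n)),
        ((ofColumns (Fin.cons x.1 x.2 : Fin (p + 1) → Fin n → ℂ))ᴴ
          * ofColumns (Fin.cons x.1 x.2 : Fin (p + 1) → Fin n → ℂ)).det ≠ 0 := by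
      have hE := measurableEntries_ofColumns (measurable_fin_cons (n := n) (p := p))
      have hm := (hE.conjTranspose.mul hE).det
      rw [ae_iff]
      refine nonpos_iff_eq_zero.1 (measure_prod_le_of_ae_section_le _ _ ?_ ?_)
      · simp only [ne_eq, not_not]
        exact hm (measurableSet_singleton 0)
      · filter_upwards [ih] with C hC
        rw [det_gram_ne_zero_iff] at hC
        have hV : Submodule.span ℂ (Set.range C) < ⊤ := by
          refine lt_top_iff_ne_top.2 fun htop => ?_
          have h1 := finrank_span_eq_card hC
          rw [htop, finrank_top] at h1
          simp at h1
          omega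
        refine (measure_mono fun g hg => ?_).trans (stdComplexNormal_submodule_eq_zero hV).le
        by_contra hgV
        refine hg ?_
        rw [det_gram_ne_zero_iff, linearIndependent_finCons]
        exact ⟨hC, hgV⟩
    filter_upwards [(measurePreserving_splitColumn n p).quasiMeasurePreserving.ae key] with C hC
    simp only [Fin.cons_self_tail] at hC
    exact hC

/-- The residual projection onto the orthogonal complement of the column space. -/
def residual {n p : ℕ} (B : Matrix (Fin n) (Fin p) ℂ) : Matrix (Fin n) (Fin n) ℂ :=
  1 - B * (Bᴴ * B)⁻¹ * Bᴴ

lemma residual_isHermitian {n p : ℕ} (B : Matrix (Fin n) (Fin p) ℂ) :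
    (residual B).IsHermitian := by
  have h : ((Bᴴ * B)⁻¹)ᴴ = (Bᴴ * B)⁻¹ := by
    rw [Matrix.conjTranspose_nonsing_inv, Matrix.conjTranspose_mul,
      Matrix.conjTranspose_conjTranspose]
  rw [Matrix.IsHermitian, residual, Matrix.conjTranspose_sub, Matrix.conjTranspose_one,
    Matrix.conjTranspose_mul, Matrix.conjTranspose_mul, Matrix.conjTranspose_conjTranspose, h,
    Matrix.mul_assoc]

lemma residual_mul_self_right {n p : ℕ} {B : Matrix (Fin n) (Fin p) ℂ}
    (hB : (Bᴴ * B).det ≠ 0) : residual B * B = 0 := by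
  rw [residual, Matrix.sub_mul, Matrix.one_mul, Matrix.mul_assoc,
    Matrix.mul_assoc, Matrix.nonsing_inv_mul _ (isUnit_iff_ne_zero.2 hB), Matrix.mul_one, sub_self]

lemma residual_mul_residual {n p : ℕ} {B : Matrix (Fin n) (Fin p) ℂ}
    (hB : (Bᴴ * B).det ≠ 0) : residual B * residual B = residual B := by
  nth_rewrite 2 [residual]
  rw [Matrix.mul_sub, Matrix.mul_one, ← Matrix.mul_assoc, ← Matrix.mul_assoc,
    residual_mul_self_right hB]
  simp

lemma trace_residual {n p : ℕ} {B : Matrix (Fin n) (Fin p) ℂ}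
    (hB : (Bᴴ * B).det ≠ 0) : (residual B).trace = ((n - p : ℝ) : ℂ) := by
  rw [residual, Matrix.trace_sub, Matrix.trace_one, Matrix.mul_assoc, Matrix.trace_mul_comm,
    Matrix.mul_assoc, Matrix.nonsing_inv_mul _ (isUnit_iff_ne_zero.2 hB), Matrix.trace_one]
  simp

/-- This is the Schur complement in geometric form. The vector `y = A (Aᴴ A)⁻¹ e₀` is orthogonal to
the other columns and pairs to `1` with `C 0`, so it equals `((Aᴴ A)⁻¹)₀₀` times the residual of `C
0`. -/
lemma gram_inv_zero_zero_mul {n p : ℕ} (C : Fin (p + 1) → Fin n → ℂ)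
    (hC : ((ofColumns C)ᴴ * ofColumns C).det ≠ 0)
    (hB : ((ofColumns (Fin.tail C))ᴴ * ofColumns (Fin.tail C)).det ≠ 0) :
    ((ofColumns C)ᴴ * ofColumns C)⁻¹ 0 0
      * (star (C 0) ⬝ᵥ (residual (ofColumns (Fin.tail C)) *ᵥ C 0)) = 1 := by
  set A := ofColumns C with hA
  set B := ofColumns (Fin.tail C) with hBd
  set x : Fin (p + 1) → ℂ := (Aᴴ * A)⁻¹ *ᵥ Pi.single 0 1 with hx
  have hx0 : x 0 = (Aᴴ * A)⁻¹ 0 0 := by simp [hx]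
  set y := A *ᵥ x with hy
  have hAy : Aᴴ *ᵥ y = Pi.single 0 1 := by
    rw [hy, hx, Matrix.mulVec_mulVec, Matrix.mulVec_mulVec,
      Matrix.mul_nonsing_inv _ (isUnit_iff_ne_zero.2 hC), Matrix.one_mulVec]
  have hysum : y = x 0 • C 0 + B *ᵥ (Fin.tail x) := by
    ext i
    simp [hy, Matrix.mulVec, dotProduct, Fin.sum_univ_succ, hA, hBd, ofColumns, Fin.tail, mul_comm]
  have h0 : star (C 0) ⬝ᵥ y = 1 := by
    have := congrFun hAy 0
    simpa [Matrix.mulVec, dotProduct, hA, ofColumns] using this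
  have hBy : Bᴴ *ᵥ y = 0 := by
    ext j
    have := congrFun hAy j.succ
    simpa [Matrix.mulVec, dotProduct, hA, hBd, ofColumns, Fin.tail] using this
  have h1 : residual B *ᵥ y = y := by
    rw [residual, Matrix.sub_mulVec, Matrix.one_mulVec, ← Matrix.mulVec_mulVec, hBy]
    simp
  have h2 : y = x 0 • (residual B *ᵥ C 0) := by
    rw [← h1, hysum, Matrix.mulVec_add, Matrix.mulVec_mulVec, residual_mul_self_right hB,
      Matrix.mulVec_smul]
    simp
  rw [h2, dotProduct_smul, smul_eq_mul] at h0
  rw [← hx0, h0]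

/-- The reciprocal of a diagonal entry of the inverse Gram matrix of i.i.d. Gaussian columns
concentrates around the number of degrees of freedom. -/
lemma gram_inv_zero_zero_concentration {n p : ℕ} (hpn : p + 1 ≤ n) {δ : ℝ} (hδ : 0 < δ) :
    (Measure.pi fun _ : Fin (p + 1) => stdComplexNormal n)
      {C | ¬ (((ofColumns C)ᴴ * ofColumns C).det ≠ 0 ∧
        |((((ofColumns C)ᴴ * ofColumns C)⁻¹ 0 0)⁻¹).re / (n - p) - 1| < δ)}
      ≤ ENNReal.ofReal (Var[fun z : ℂ => ‖z‖ ^ 2; complexNormal 1] / ((n - p) * δ ^ 2)) := by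
  have hd : (0 : ℝ) < n - p := by
    have : (p + 1 : ℝ) ≤ n := by exact_mod_cast hpn
    linarith
  set T : Set ((Fin n → ℂ) × (Fin p → Fin n → ℂ)) :=
    {x | δ ≤ |(star x.1 ⬝ᵥ (residual (ofColumns x.2) *ᵥ x.1)).re / (n - p) - 1|} with hT
  have hTm : MeasurableSet T := by
    have hE := measurableEntries_ofColumns (n := n) (p := p)
      (measurable_snd (α := Fin n → ℂ) (β := Fin p → Fin n → ℂ))
    have hR : MeasurableEntries fun x : (Fin n → ℂ) × (Fin p → Fin n → ℂ) =>
        residual (ofColumns x.2) :=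
      (MeasurableEntries.const 1).sub ((hE.mul (hE.conjTranspose.mul hE).inv).mul hE.conjTranspose)
    have hm := measurable_dotProduct (measurable_star_vec measurable_fst)
      (hR.mulVec measurable_fst)
    exact measurableSet_le measurable_const
      (continuous_abs.measurable.comp
        (((Complex.measurable_re.comp hm).div_const _).sub_const _))
  have hTle : ((stdComplexNormal n).prod (Measure.pi fun _ : Fin p => stdComplexNormal n)) T
      ≤ ENNReal.ofReal (Var[fun z : ℂ => ‖z‖ ^ 2; complexNormal 1] / ((n - p) * δ ^ 2)) := by
    -- With the other columns frozen, the residual matrix is a fixed projection of rank `n - p`,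
    -- independent of column `0`.
    refine measure_prod_le_of_ae_section_le _ _ hTm ?_
    filter_upwards [ae_det_gram_ne_zero (n := n) (p := p) (by omega)] with C hC
    exact projection_concentration (residual_isHermitian _) (residual_mul_residual hC) hd
      (trace_residual hC) hδ
  have hmp := measurePreserving_splitColumn n p
  have hmp2 : ∀ᵐ C ∂(Measure.pi fun _ : Fin (p + 1) => stdComplexNormal n),
      ((ofColumns (Fin.tail C))ᴴ * ofColumns (Fin.tail C)).det ≠ 0 := by
    have h2 : ∀ᵐ x ∂((stdComplexNormal n).prod (Measure.pi fun _ : Fin p => stdComplexNormal n)),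
        ((ofColumns x.2)ᴴ * ofColumns x.2).det ≠ 0 :=
      Measure.quasiMeasurePreserving_snd.ae (ae_det_gram_ne_zero (by omega))
    exact hmp.quasiMeasurePreserving.ae h2
  refine le_trans (measure_mono_ae (t := (fun C : Fin (p + 1) → Fin n → ℂ =>
    (C 0, Fin.tail C)) ⁻¹' T) ?_) ((hmp.measure_preimage hTm.nullMeasurableSet).le.trans hTle)
  filter_upwards [hmp2, ae_det_gram_ne_zero hpn] with C hB hC hbad
  change δ ≤ _
  by_contra hlt
  refine hbad ⟨hC, ?_⟩
  have h := gram_inv_zero_zero_mul C hC hB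
  rw [← eq_inv_of_mul_eq_one_right h]
  exact not_le.1 hlt

/-! ### From columns to rows -/

lemma exists_coeff_strongDual_pi {n p : ℕ} (L : StrongDual ℝ (Fin n → Fin p → ℂ)) :
    ∃ b : Fin n → Fin p → ℂ, ∀ w, L w = (∑ i, b i ⬝ᵥ w i).re := by
  choose b hb using fun i => exists_coeff_strongDual
    (L.comp (ContinuousLinearMap.single ℝ (fun _ : Fin n => Fin p → ℂ) i))
  refine ⟨b, fun w => ?_⟩
  rw [← L.sum_comp_single, Complex.re_sum]
  exact Finset.sum_congr rfl fun i _ => hb i (w i)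

lemma charFunDual_pi_stdComplexNormal {n p : ℕ} (L : StrongDual ℝ (Fin n → Fin p → ℂ))
    (b : Fin n → Fin p → ℂ) (h : ∀ w, L w = (∑ i, b i ⬝ᵥ w i).re) :
    charFunDual (Measure.pi fun _ : Fin n => stdComplexNormal p) L
      = Complex.exp (∑ i, ∑ j, (-(1 / 4 * ‖b i j‖ ^ 2) : ℝ)) := by
  rw [charFunDual_pi, Complex.exp_sum]
  refine Finset.prod_congr rfl fun i _ => ?_
  rw [stdComplexNormal, charFunDual_pi_complexNormal zero_le_one _ (b i) fun w => ?_]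
  · congr 1
    push_cast
    rw [Finset.mul_sum, Finset.sum_neg_distrib]
  · rw [ContinuousLinearMap.comp_apply, h]
    congr 1
    rw [Finset.sum_eq_single i]
    · simp
    · intro j _ hj
      simp [hj]
    · simp

/-- The characteristic function depends only on the sum of all `‖b i j‖²`, which is symmetric in
rows and columns. -/
lemma map_transpose_pi_stdComplexNormal (n p : ℕ) :
    (Measure.pi fun _ : Fin n => stdComplexNormal p).map (fun G j i => G i j)
      = Measure.pi fun _ : Fin p => stdComplexNormal n := by
  let T : (Fin n → Fin p → ℂ) →L[ℝ] (Fin p → Fin n → ℂ) :=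
    ContinuousLinearMap.pi fun j => ContinuousLinearMap.pi fun i =>
      (ContinuousLinearMap.proj j : (Fin p → ℂ) →L[ℝ] ℂ).comp (ContinuousLinearMap.proj i)
  have hT : (fun (G : Fin n → Fin p → ℂ) j i => G i j) = T := rfl
  rw [hT]
  have := Measure.isProbabilityMeasure_map (μ := Measure.pi fun _ : Fin n => stdComplexNormal p)
    T.continuous.measurable.aemeasurable
  apply Measure.ext_of_charFunDual
  ext L
  obtain ⟨b, hb⟩ := exists_coeff_strongDual_pi L
  rw [charFunDual_map, charFunDual_pi_stdComplexNormal L b hb,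
    charFunDual_pi_stdComplexNormal _ (fun i j => b j i) fun w => ?_, Finset.sum_comm]
  rw [ContinuousLinearMap.comp_apply, hb]
  simp only [dotProduct]
  rw [Finset.sum_comm]
  rfl

lemma measurable_transpose_vec (n p : ℕ) :
    Measurable (fun (G : Fin n → Fin p → ℂ) (j : Fin p) (i : Fin n) => G i j) :=
  measurable_pi_lambda _ fun j => measurable_pi_lambda _ fun i =>
    (measurable_pi_apply j).comp (measurable_pi_apply i)

lemma measurable_vecMul {n p : ℕ} (A : Matrix (Fin n) (Fin p) ℂ) :
    Measurable fun g : Fin n → ℂ => g ᵥ* A := by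
  simp_rw [← Matrix.mulVec_transpose]
  exact measurable_matrix_mulVec _

lemma measurable_rows_vecMul {m n p : ℕ} (A : Matrix (Fin n) (Fin p) ℂ) :
    Measurable fun (G : Fin m → Fin n → ℂ) i => G i ᵥ* A :=
  measurable_pi_lambda _ fun i => (measurable_vecMul A).comp (measurable_pi_apply i)

lemma of_vecMul {m n p : ℕ} (G : Fin m → Fin n → ℂ) (A : Matrix (Fin n) (Fin p) ℂ) :
    Matrix.of (fun i => G i ᵥ* A) = Matrix.of G * A := by
  ext i j
  simp [Matrix.mul_apply, Matrix.vecMul, dotProduct]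

lemma map_rows_vecMul_unitary {n p : ℕ} {U : Matrix (Fin p) (Fin p) ℂ}
    (hU : U ∈ Matrix.unitaryGroup (Fin p) ℂ) :
    (Measure.pi fun _ : Fin n => stdComplexNormal p).map (fun G i => G i ᵥ* U)
      = Measure.pi fun _ : Fin n => stdComplexNormal p := by
  have hUT : Uᵀ ∈ Matrix.unitaryGroup (Fin p) ℂ := by
    have h : (Uᵀ)ᴴ = (Uᴴ)ᵀ := rfl
    rw [Matrix.mem_unitaryGroup_iff, Matrix.star_eq_conjTranspose, h, ← Matrix.transpose_mul,
      ← Matrix.star_eq_conjTranspose, Matrix.mem_unitaryGroup_iff'.1 hU, Matrix.transpose_one]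
  have h1 : (stdComplexNormal p).map (fun g => g ᵥ* U) = stdComplexNormal p := by
    simp_rw [← Matrix.mulVec_transpose]
    exact map_unitary_stdComplexNormal hUT
  have : IsProbabilityMeasure ((stdComplexNormal p).map (fun g => g ᵥ* U)) := by
    rw [h1]; infer_instance
  rw [Measure.pi_map_pi (f := fun _ g => g ᵥ* U) fun _ => (measurable_vecMul U).aemeasurable]
  simp_rw [h1]

lemma exists_unitary_column {N : ℕ} (i₀ : Fin N) {u : Fin N → ℂ} (hu : star u ⬝ᵥ u = 1) :
    ∃ U ∈ Matrix.unitaryGroup (Fin N) ℂ, ∀ i, U i i₀ = u i := by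
  have horth : Orthonormal ℂ (({i₀} : Set (Fin N)).domRestrict
      (fun _ => WithLp.toLp 2 u : Fin N → EuclideanSpace ℂ (Fin N))) := by
    refine ⟨fun i => ?_, fun i j hij => ?_⟩
    · have h1 : ‖(WithLp.toLp 2 u : EuclideanSpace ℂ (Fin N))‖ ^ 2 = 1 := by
        rw [EuclideanSpace.norm_sq_eq]
        apply Complex.ofReal_injective
        rw [sum_norm_sq_eq_dotProduct, dotProduct_comm]
        simpa using hu
      have h2 := (pow_eq_one_iff_of_nonneg (norm_nonneg _) two_ne_zero).1 h1
      exact h2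
    · exact absurd (Subsingleton.elim i j) hij
  obtain ⟨b, hb⟩ := horth.exists_orthonormalBasis_extension_of_card_eq (by simp)
  refine ⟨(EuclideanSpace.basisFun (Fin N) ℂ).toBasis.toMatrix b,
    (EuclideanSpace.basisFun (Fin N) ℂ).toMatrix_orthonormalBasis_mem_unitary b, fun i => ?_⟩
  rw [Module.Basis.toMatrix_apply, hb i₀ rfl]
  simp

/-- A quadratic form of the inverse of a complex Wishart matrix concentrates. -/
lemma wishart_inv_concentration {n N : ℕ} (hN : 0 < N) (hNn : N ≤ n) {u : Fin N → ℂ}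
    (hu : star u ⬝ᵥ u = 1) {δ : ℝ} (hδ : 0 < δ) :
    (Measure.pi fun _ : Fin n => stdComplexNormal N)
      {G | ¬ (((Matrix.of G)ᴴ * Matrix.of G).det ≠ 0 ∧
        |((star u ⬝ᵥ (((Matrix.of G)ᴴ * Matrix.of G)⁻¹ *ᵥ u))⁻¹).re / (n - N + 1) - 1| < δ)}
      ≤ ENNReal.ofReal
        (Var[fun z : ℂ => ‖z‖ ^ 2; complexNormal 1] / ((n - N + 1) * δ ^ 2)) := by
  obtain ⟨p, rfl⟩ := Nat.exists_eq_succ_of_ne_zero hN.ne'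
  -- Rotating the rows by a unitary with column `0` equal to `u` turns the quadratic form at `u`
  -- into the `(0, 0)` entry, and leaves the law unchanged.
  obtain ⟨U, hU, hUu⟩ := exists_unitary_column 0 hu
  have hUU : U * Uᴴ = 1 := Matrix.mem_unitaryGroup_iff.1 hU
  have hUU' : Uᴴ * U = 1 := Matrix.mem_unitaryGroup_iff'.1 hU
  have h := gram_inv_zero_zero_concentration hNn hδ
  have hcast : ((n : ℝ) - ((p.succ : ℕ) : ℝ) + 1) = n - p := by push_cast; ring
  rw [hcast]
  refine le_trans ?_ h
  rw [← map_transpose_pi_stdComplexNormal n (p + 1)]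
  -- Only the inequality between a set and its preimage is needed, so the bad event need not be
  -- shown measurable.
  refine le_trans ?_ (Measure.le_map_apply (measurable_transpose_vec _ _).aemeasurable _)
  have h3 := map_rows_vecMul_unitary (n := n) hU
  conv_rhs => rw [← h3]
  refine le_trans (measure_mono fun G hG => ?_)
    (Measure.le_map_apply (measurable_rows_vecMul U).aemeasurable _)
  simp only [Set.mem_preimage, Set.mem_ofPred_eq] at hG ⊢
  have hcols : (ofColumns fun j i => (G i ᵥ* U) j) = Matrix.of G * U := by
    rw [← of_vecMul]; rfl
  have hgram : (Matrix.of G * U)ᴴ * (Matrix.of G * U)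
      = Uᴴ * ((Matrix.of G)ᴴ * Matrix.of G) * U := by
    rw [Matrix.conjTranspose_mul]; simp only [Matrix.mul_assoc]
  rw [hcols, hgram]
  have hdet : (Uᴴ * ((Matrix.of G)ᴴ * Matrix.of G) * U).det
      = ((Matrix.of G)ᴴ * Matrix.of G).det := by
    have e := congrArg Matrix.det hUU'
    rw [Matrix.det_mul, Matrix.det_one] at e
    rw [Matrix.det_mul, Matrix.det_mul, mul_right_comm, e, one_mul]
  have hUinv : U⁻¹ = Uᴴ := Matrix.inv_eq_right_inv hUU
  have hUHinv : (Uᴴ)⁻¹ = U := Matrix.inv_eq_right_inv hUU'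
  have hinv : (Uᴴ * ((Matrix.of G)ᴴ * Matrix.of G) * U)⁻¹ 0 0
      = star u ⬝ᵥ (((Matrix.of G)ᴴ * Matrix.of G)⁻¹ *ᵥ u) := by
    have hu' : u = U *ᵥ Pi.single 0 1 := by ext i; simp [hUu]
    rw [Matrix.mul_inv_rev, Matrix.mul_inv_rev, hUinv, hUHinv, ← Matrix.mul_assoc]
    conv_rhs => rw [hu', Matrix.star_mulVec, ← Matrix.dotProduct_mulVec, Matrix.mulVec_mulVec,
      Matrix.mulVec_mulVec]
    simp
  rw [hdet, hinv]
  exact hG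

/-! ### The zero-forcing error variance -/

lemma channelLaw_eq_map {Nt : ℕ} (K : Matrix (Fin Nt) (Fin Nt) ℂ) (Nr : ℕ) :
    channelLaw K Nr = (Measure.pi fun _ : Fin Nr => stdComplexNormal Nt).map
      (fun G i => G i ᵥ* CFC.sqrt K) := by
  have : IsProbabilityMeasure ((stdComplexNormal Nt).map (fun g => g ᵥ* CFC.sqrt K)) :=
    Measure.isProbabilityMeasure_map (measurable_vecMul _).aemeasurable
  rw [Measure.pi_map_pi (f := fun _ g => g ᵥ* CFC.sqrt K)
    fun _ => (measurable_vecMul _).aemeasurable]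
  rfl

instance {Nt : ℕ} (K : Matrix (Fin Nt) (Fin Nt) ℂ) (Nr : ℕ) :
    IsProbabilityMeasure (channelLaw K Nr) := by
  rw [channelLaw_eq_map]
  exact Measure.isProbabilityMeasure_map (measurable_rows_vecMul _).aemeasurable

/-- With `H = G √K` and `B = √K F`, the diagonal entry is the form of `(Gᴴ G)⁻¹` at `u' = (Bᴴ)⁻¹
eₖ`. Since `‖u'‖² = ((Fᴴ K F)⁻¹)ₖₖ = a`, normalizing `u'` reduces the claim to
`wishart_inv_concentration`. -/
lemma channel_inv_gram_concentration {Nt Nr : ℕ} (hN : 0 < Nt) (hNr : Nt ≤ Nr)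
    {K F : Matrix (Fin Nt) (Fin Nt) ℂ} (hK : K.PosDef) (hF : F.det ≠ 0) {k : Fin Nt} {a : ℝ}
    (ha : 0 < a) (hFK : (Fᴴ * K * F)⁻¹ k k = a) {δ : ℝ} (hδ : 0 < δ) :
    channelLaw K Nr {H | ¬ (((Matrix.of H * F)ᴴ * (Matrix.of H * F)).det ≠ 0 ∧
        |((((Matrix.of H * F)ᴴ * (Matrix.of H * F))⁻¹ k k)⁻¹).re * a / (Nr - Nt + 1) - 1| < δ)}
      ≤ ENNReal.ofReal
        (Var[fun z : ℂ => ‖z‖ ^ 2; complexNormal 1] / ((Nr - Nt + 1) * δ ^ 2)) := by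
  set R := CFC.sqrt K with hR
  have hRR : R * R = K := CFC.sqrt_mul_sqrt_self K hK.posSemidef.nonneg
  have hRH : Rᴴ = R := (Matrix.nonneg_iff_posSemidef.1 (CFC.sqrt_nonneg K)).isHermitian
  set B := R * F with hB
  have hKdet : K.det ≠ 0 := (Matrix.isUnit_iff_isUnit_det _).1 hK.isUnit |>.ne_zero
  have hRdet : R.det ≠ 0 := by
    intro h0
    apply hKdet
    rw [← hRR, Matrix.det_mul, h0, zero_mul]
  have hBdet : B.det ≠ 0 := by rw [hB, Matrix.det_mul]; exact mul_ne_zero hRdet hF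
  have hBHdet : Bᴴ.det ≠ 0 := by rw [Matrix.det_conjTranspose]; exact star_ne_zero.2 hBdet
  set u' : Fin Nt → ℂ := (Bᴴ)⁻¹ *ᵥ Pi.single k 1 with hu'
  have hBB : Bᴴ * B = Fᴴ * K * F := by
    rw [hB, Matrix.conjTranspose_mul, hRH, ← hRR]; simp only [Matrix.mul_assoc]
  have hstar : star u' = Pi.single k 1 ᵥ* B⁻¹ := by
    rw [hu', Matrix.star_mulVec, Matrix.conjTranspose_nonsing_inv,
      Matrix.conjTranspose_conjTranspose]
    congr 1
    ext i; by_cases h : i = k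
    · subst h; simp
    · simp [h]
  have hu'a : star u' ⬝ᵥ u' = a := by
    rw [hstar, ← Matrix.dotProduct_mulVec, hu', Matrix.mulVec_mulVec, ← Matrix.mul_inv_rev, hBB,
      ← hFK]
    simp
  have hsa : ((√a : ℝ) : ℂ) ≠ 0 := by exact_mod_cast (Real.sqrt_pos.2 ha).ne'
  have hsa2 : ((√a : ℝ) : ℂ) * ((√a : ℝ) : ℂ) = a := by
    rw [← Complex.ofReal_mul, Real.mul_self_sqrt ha.le]
  have hac : (a : ℂ) ≠ 0 := by exact_mod_cast ha.ne'
  set u : Fin Nt → ℂ := ((√a : ℝ) : ℂ)⁻¹ • u' with hu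
  have hstaru : star u = ((√a : ℝ) : ℂ)⁻¹ • star u' := by
    rw [hu, star_smul, star_inv₀]
    congr 2
    exact Complex.conj_ofReal _
  have hu1 : star u ⬝ᵥ u = 1 := by
    rw [hstaru, hu, smul_dotProduct, dotProduct_smul, hu'a, ← hsa2]
    simp only [smul_eq_mul]
    field_simp
  have hA : MeasurableEntries fun H : Fin Nr → Fin Nt → ℂ => Matrix.of H * F :=
    MeasurableEntries.mul (fun i j => (measurable_pi_apply j).comp (measurable_pi_apply i))
      (MeasurableEntries.const F)
  have hG := hA.conjTranspose.mul hA
  rw [channelLaw_eq_map, Measure.map_apply (measurable_rows_vecMul _)]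
  · refine le_trans (measure_mono fun G hGbad => ?_) (wishart_inv_concentration hN hNr hu1 hδ)
    simp only [Set.mem_preimage, Set.mem_ofPred_eq, of_vecMul] at hGbad ⊢
    have hAB : Matrix.of G * CFC.sqrt K * F = Matrix.of G * B := by
      rw [hB, ← hR, Matrix.mul_assoc]
    have hgram : (Matrix.of G * B)ᴴ * (Matrix.of G * B)
        = Bᴴ * ((Matrix.of G)ᴴ * Matrix.of G) * B := by
      rw [Matrix.conjTranspose_mul]; simp only [Matrix.mul_assoc]
    rw [hAB, hgram] at hGbad
    have hinv : (Bᴴ * ((Matrix.of G)ᴴ * Matrix.of G) * B)⁻¹ k k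
        = a * (star u ⬝ᵥ (((Matrix.of G)ᴴ * Matrix.of G)⁻¹ *ᵥ u)) := by
      have e1 : (Bᴴ * ((Matrix.of G)ᴴ * Matrix.of G) * B)⁻¹ k k
          = star u' ⬝ᵥ (((Matrix.of G)ᴴ * Matrix.of G)⁻¹ *ᵥ u') := by
        rw [hstar, ← Matrix.dotProduct_mulVec, hu', Matrix.mulVec_mulVec, Matrix.mulVec_mulVec,
          Matrix.mul_inv_rev (Bᴴ * ((Matrix.of G)ᴴ * Matrix.of G)) B, Matrix.mul_inv_rev Bᴴ,
          ← Matrix.mul_assoc B⁻¹]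
        simp
      rw [e1, hstaru, hu, Matrix.mulVec_smul, smul_dotProduct, dotProduct_smul, ← hsa2]
      simp only [smul_eq_mul]
      field_simp
    rw [hinv] at hGbad
    rintro ⟨h1, h2⟩
    refine hGbad ⟨?_, ?_⟩
    · rw [Matrix.det_mul, Matrix.det_mul]
      exact mul_ne_zero (mul_ne_zero hBHdet h1) hBdet
    · have e2 : ((a * (star u ⬝ᵥ (((Matrix.of G)ᴴ * Matrix.of G)⁻¹ *ᵥ u)))⁻¹).re * a
          = ((star u ⬝ᵥ (((Matrix.of G)ᴴ * Matrix.of G)⁻¹ *ᵥ u))⁻¹).re := by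
        rw [mul_inv, ← Complex.ofReal_inv, Complex.re_ofReal_mul]
        field_simp
      rw [e2]
      exact h2
  · refine MeasurableSet.compl (MeasurableSet.inter ?_ ?_)
    · exact (hG.det (measurableSet_singleton 0)).compl
    · exact measurableSet_lt (continuous_abs.measurable.comp
        ((((Complex.measurable_re.comp (hG.inv k k).inv).mul_const _).div_const _).sub_const _))
        measurable_const

/-! ### The symbol error probability given the channel -/

instance (σ : ℝ) (Nr : ℕ) : IsProbabilityMeasure (noiseLaw σ Nr) := by
  unfold noiseLaw; infer_instance

lemma isProbabilityMeasure_symbolLaw {S : Set ℂ} (hS : S.Finite) (hne : S.Nonempty) (Nt : ℕ) :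
    IsProbabilityMeasure (symbolLaw S Nt) := by
  have := isProbabilityMeasure_uniformOn hS hne
  unfold symbolLaw; infer_instance

/-- A transmitted symbol `s` received with error `w` is strictly closer to another point. -/
def strictErrorSet (S : Set ℂ) : Set (ℂ × ℂ) :=
  {x | ∃ t ∈ S, ‖x.2 + x.1 - t‖ < ‖x.1‖}

/-- A transmitted symbol `s` received with error `w` is at least as close to another point. -/
def weakErrorSet (S : Set ℂ) : Set (ℂ × ℂ) :=
  {x | ∃ t ∈ S, x.2 ≠ t ∧ ‖x.2 + x.1 - t‖ ≤ ‖x.1‖}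

lemma measurableSet_strictErrorSet {S : Set ℂ} (hS : S.Finite) :
    MeasurableSet (strictErrorSet S) := by
  have : strictErrorSet S = ⋃ t ∈ S, {x : ℂ × ℂ | ‖x.2 + x.1 - t‖ < ‖x.1‖} := by
    ext x; simp [strictErrorSet]
  rw [this]
  exact hS.measurableSet_biUnion fun t _ => measurableSet_lt (by fun_prop) (by fun_prop)

lemma measurableSet_weakErrorSet {S : Set ℂ} (hS : S.Finite) :
    MeasurableSet (weakErrorSet S) := by
  have : weakErrorSet S
      = ⋃ t ∈ S, ({x : ℂ × ℂ | x.2 ≠ t} ∩ {x : ℂ × ℂ | ‖x.2 + x.1 - t‖ ≤ ‖x.1‖}) := by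
    ext x; simp [weakErrorSet, and_left_comm]
  rw [this]
  exact hS.measurableSet_biUnion fun t _ =>
    ((measurable_snd (measurableSet_singleton t)).compl).inter
      (measurableSet_le (by fun_prop) (by fun_prop))

lemma IsHardDecision.strict_subset {S : Set ℂ} {D : ℂ → ℂ} (hD : IsHardDecision S D) {z s : ℂ}
    (h : (z - s, s) ∈ strictErrorSet S) : D z ≠ s := by
  rintro rfl
  obtain ⟨t, ht, hlt⟩ := h
  simp only [add_sub_cancel] at hlt
  exact absurd hlt (not_lt.2 ((hD z).2 t ht))

lemma IsHardDecision.subset_weak {S : Set ℂ} {D : ℂ → ℂ} (hD : IsHardDecision S D) {z s : ℂ}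
    (hs : s ∈ S) (h : D z ≠ s) : (z - s, s) ∈ weakErrorSet S := by
  refine ⟨D z, (hD z).1, h.symm, ?_⟩
  simp only [add_sub_cancel]
  exact (hD z).2 s hs

/-! ### The zero-forcing error as a linear functional of the noise. -/

lemma pseudoInverse_mul_self {m n : ℕ} {A : Matrix (Fin m) (Fin n) ℂ}
    (hA : (Aᴴ * A).det ≠ 0) : pseudoInverse A * A = 1 := by
  rw [pseudoInverse, Matrix.mul_assoc, Matrix.nonsing_inv_mul _ (isUnit_iff_ne_zero.2 hA)]

lemma sum_norm_sq_pseudoInverse {m n : ℕ} {A : Matrix (Fin m) (Fin n) ℂ}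
    (hA : (Aᴴ * A).det ≠ 0) (k : Fin n) :
    ((∑ j, ‖pseudoInverse A k j‖ ^ 2 : ℝ) : ℂ) = (Aᴴ * A)⁻¹ k k := by
  have h : ((Aᴴ * A)⁻¹)ᴴ = (Aᴴ * A)⁻¹ := by
    rw [Matrix.conjTranspose_nonsing_inv, Matrix.conjTranspose_mul,
      Matrix.conjTranspose_conjTranspose]
  have hP : pseudoInverse A * (pseudoInverse A)ᴴ = (Aᴴ * A)⁻¹ := by
    rw [pseudoInverse, Matrix.conjTranspose_mul, Matrix.conjTranspose_conjTranspose, h,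
      Matrix.mul_assoc, ← Matrix.mul_assoc Aᴴ,
      Matrix.mul_nonsing_inv _ (isUnit_iff_ne_zero.2 hA), Matrix.mul_one]
  rw [sum_norm_sq_eq_dotProduct, ← hP, Matrix.mul_apply]
  rfl

lemma zfOutput_sub {Nt Nr : ℕ} {F : Matrix (Fin Nt) (Fin Nt) ℂ} {H : Matrix (Fin Nr) (Fin Nt) ℂ}
    (hA : ((H * F)ᴴ * (H * F)).det ≠ 0) (ξ : Fin Nr → ℂ) (s : Fin Nt → ℂ) (k : Fin Nt) :
    zfOutput F H ξ s k - s k = pseudoInverse (H * F) k ⬝ᵥ ξ := by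
  rw [zfOutput, Matrix.mulVec_add, Matrix.mulVec_mulVec, pseudoInverse_mul_self hA,
    Matrix.one_mulVec, Pi.add_apply, add_sub_cancel_left]
  rfl

/-- For a fixed full-rank channel the problem becomes two-dimensional: the error depends on the
noise only, the symbol `s k` is independent of it, and the row of the pseudo-inverse has squared
length `((Aᴴ A)⁻¹)ₖₖ`. -/
lemma zf_section_measure {Nt Nr : ℕ} {F : Matrix (Fin Nt) (Fin Nt) ℂ}
    {H : Matrix (Fin Nr) (Fin Nt) ℂ} (hA : ((H * F)ᴴ * (H * F)).det ≠ 0) {S : Set ℂ}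
    (hS : S.Finite) (hne : S.Nonempty) (σ : ℝ) (k : Fin Nt) {E : Set (ℂ × ℂ)}
    (hE : MeasurableSet E) :
    ((noiseLaw σ Nr).prod (symbolLaw S Nt))
      {x | (zfOutput F H x.1 x.2 k - x.2 k, x.2 k) ∈ E}
      = ((complexNormal ((((H * F)ᴴ * (H * F))⁻¹ k k).re * σ ^ 2)).prod (uniformOn S)) E := by
  have := isProbabilityMeasure_uniformOn hS hne
  have := isProbabilityMeasure_symbolLaw hS hne Nt
  have h1 : MeasurePreserving (fun ξ : Fin Nr → ℂ => pseudoInverse (H * F) k ⬝ᵥ ξ)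
      (noiseLaw σ Nr) (complexNormal ((((H * F)ᴴ * (H * F))⁻¹ k k).re * σ ^ 2)) := by
    refine ⟨measurable_dotProduct measurable_const measurable_id, ?_⟩
    rw [noiseLaw, map_dotProduct_pi_complexNormal (sq_nonneg σ), ← sum_norm_sq_pseudoInverse hA,
      Complex.ofReal_re]
  have h2 : MeasurePreserving (fun s : Fin Nt → ℂ => s k) (symbolLaw S Nt) (uniformOn S) :=
    measurePreserving_eval (fun _ : Fin Nt => uniformOn S) k
  rw [← (h1.prod h2).measure_preimage hE.nullMeasurableSet]
  congr 1
  ext x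
  simp only [Set.mem_preimage, Prod.map, Set.mem_ofPred_eq, zfOutput_sub hA]

lemma measurable_zf_pair {Nt Nr : ℕ} (F : Matrix (Fin Nt) (Fin Nt) ℂ) (k : Fin Nt) :
    Measurable fun ω : (Fin Nr → Fin Nt → ℂ) × (Fin Nr → ℂ) × (Fin Nt → ℂ) =>
      (zfOutput F (Matrix.of ω.1) ω.2.1 ω.2.2 k - ω.2.2 k, ω.2.2 k) := by
  have hA : MeasurableEntries fun ω : (Fin Nr → Fin Nt → ℂ) × (Fin Nr → ℂ) × (Fin Nt → ℂ) =>
      Matrix.of ω.1 * F :=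
    MeasurableEntries.mul (fun i j => (measurable_pi_apply j).comp
      ((measurable_pi_apply i).comp measurable_fst)) (MeasurableEntries.const F)
  have hP : MeasurableEntries fun ω : (Fin Nr → Fin Nt → ℂ) × (Fin Nr → ℂ) × (Fin Nt → ℂ) =>
      pseudoInverse (Matrix.of ω.1 * F) := (hA.conjTranspose.mul hA).inv.mul hA.conjTranspose
  have hs : Measurable fun ω : (Fin Nr → Fin Nt → ℂ) × (Fin Nr → ℂ) × (Fin Nt → ℂ) => ω.2.2 :=
    measurable_snd.comp measurable_snd
  have hξ : Measurable fun ω : (Fin Nr → Fin Nt → ℂ) × (Fin Nr → ℂ) × (Fin Nt → ℂ) => ω.2.1 :=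
    measurable_fst.comp measurable_snd
  have hz := hP.mulVec ((hA.mulVec hs).add hξ)
  exact (((measurable_pi_apply k).comp hz).sub ((measurable_pi_apply k).comp hs)).prodMk
    ((measurable_pi_apply k).comp hs)

/-- Sections over `bad` are bounded trivially by `1`. Replacing `bad` by its measurable hull costs
no measure, so `bad` may be arbitrary. -/
lemma measure_prod_le_of_section_le_of_notMem {α β : Type*} [MeasurableSpace α]
    [MeasurableSpace β] (μ : Measure α) [IsProbabilityMeasure μ] (ν : Measure β)
    [IsProbabilityMeasure ν] {T : Set (α × β)} (hT : MeasurableSet T) {bad : Set α}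
    {b c : ENNReal} (hb : μ bad ≤ b) (h : ∀ x ∉ bad, ν {y | (x, y) ∈ T} ≤ c) :
    (μ.prod ν) T ≤ b + c := by
  rw [Measure.prod_apply hT]
  calc ∫⁻ x, ν (Prod.mk x ⁻¹' T) ∂μ
      ≤ ∫⁻ x, ((toMeasurable μ bad).indicator 1 x + c) ∂μ := by
        refine lintegral_mono fun x => ?_
        by_cases hx : x ∈ bad
        · rw [Set.indicator_of_mem (subset_toMeasurable μ bad hx)]
          exact prob_le_one.trans le_self_add
        · exact (h x hx).trans le_add_self
    _ = μ bad + c := by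
        rw [lintegral_add_right _ measurable_const, lintegral_indicator_one
          (measurableSet_toMeasurable μ bad), measure_toMeasurable]
        simp
    _ ≤ b + c := by gcongr

/-- If, off a set of channels of small probability, the conditional error probability is close
to `L`, then so is the symbol error probability. -/
lemma abs_symbolErrorProb_sub_le {Nt Nr : ℕ} {K F : Matrix (Fin Nt) (Fin Nt) ℂ} {S : Set ℂ}
    (hS : S.Finite) (hne : S.Nonempty) {D : ℂ → ℂ} (hD : IsHardDecision S D) {σ : ℝ} {k : Fin Nt}
    {bad : Set (Fin Nr → Fin Nt → ℂ)} {b ε L : ℝ} (hb0 : 0 ≤ b)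
    (hbad : channelLaw K Nr bad ≤ ENNReal.ofReal b)
    (hdet : ∀ H ∉ bad, ((Matrix.of H * F)ᴴ * (Matrix.of H * F)).det ≠ 0)
    (hstrict : ∀ H ∉ bad, L - ε ≤ ((complexNormal
      ((((Matrix.of H * F)ᴴ * (Matrix.of H * F))⁻¹ k k).re * σ ^ 2)).prod (uniformOn S)).real
        (strictErrorSet S))
    (hweak : ∀ H ∉ bad, ((complexNormal
      ((((Matrix.of H * F)ᴴ * (Matrix.of H * F))⁻¹ k k).re * σ ^ 2)).prod (uniformOn S)).real
        (weakErrorSet S) ≤ L + ε)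
    (hL0 : 0 ≤ L + ε) (hL1 : 0 ≤ 1 - L + ε) :
    |symbolErrorProb S D K σ Nr F k - L| ≤ b + ε := by
  have := isProbabilityMeasure_uniformOn hS hne
  have := isProbabilityMeasure_symbolLaw hS hne Nt
  set P := (channelLaw K Nr).prod ((noiseLaw σ Nr).prod (symbolLaw S Nt)) with hP
  set Z : (Fin Nr → Fin Nt → ℂ) × (Fin Nr → ℂ) × (Fin Nt → ℂ) → ℂ × ℂ :=
    fun ω => (zfOutput F (Matrix.of ω.1) ω.2.1 ω.2.2 k - ω.2.2 k, ω.2.2 k) with hZ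
  have hZm : Measurable Z := measurable_zf_pair F k
  have hEs := measurableSet_strictErrorSet hS
  have hEw := measurableSet_weakErrorSet hS
  have hup : P (Z ⁻¹' weakErrorSet S) ≤ ENNReal.ofReal b + ENNReal.ofReal (L + ε) := by
    refine measure_prod_le_of_section_le_of_notMem _ _ (hZm hEw) hbad fun H hH => ?_
    refine (zf_section_measure (hdet H hH) hS hne σ k hEw).le.trans ?_
    rw [← ofReal_measureReal]
    exact ENNReal.ofReal_le_ofReal (hweak H hH)
  -- The lower bound is obtained as an upper bound for the complementary event, so the same section
  -- estimate serves both.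
  have hlo : P (Z ⁻¹' (strictErrorSet S)ᶜ) ≤ ENNReal.ofReal b + ENNReal.ofReal (1 - L + ε) := by
    refine measure_prod_le_of_section_le_of_notMem _ _ (hZm hEs.compl) hbad fun H hH => ?_
    refine (zf_section_measure (hdet H hH) hS hne σ k hEs.compl).le.trans ?_
    rw [← ofReal_measureReal]
    refine ENNReal.ofReal_le_ofReal ?_
    rw [probReal_compl_eq_one_sub hEs]
    linarith [hstrict H hH]
  have hup' : P.real (Z ⁻¹' weakErrorSet S) ≤ b + (L + ε) := by
    rw [← ENNReal.ofReal_add hb0 hL0] at hup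
    exact ENNReal.toReal_le_of_le_ofReal (by linarith) hup
  have hlo' : 1 - P.real (Z ⁻¹' strictErrorSet S) ≤ b + (1 - L + ε) := by
    rw [← ENNReal.ofReal_add hb0 hL1] at hlo
    rw [← probReal_compl_eq_one_sub (hZm hEs)]
    exact ENNReal.toReal_le_of_le_ofReal (by linarith) hlo
  have hs_ae : ∀ᵐ ω ∂P, ω.2.2 k ∈ S := by
    have h1 : ∀ᵐ s ∂uniformOn S, s ∈ S := by
      rw [ae_iff]
      have : {a | a ∉ S} = Sᶜ := rfl
      rw [this, prob_compl_eq_zero_iff hS.measurableSet]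
      exact uniformOn_self hS hne
    have h2 : ∀ᵐ s ∂symbolLaw S Nt, s k ∈ S :=
      (measurePreserving_eval (fun _ : Fin Nt => uniformOn S) k).quasiMeasurePreserving.ae h1
    have h3 : ∀ᵐ x ∂(noiseLaw σ Nr).prod (symbolLaw S Nt), x.2 k ∈ S :=
      Measure.quasiMeasurePreserving_snd.ae h2
    exact Measure.quasiMeasurePreserving_snd.ae h3
  -- The rule `D` may break ties non-measurably. The sandwich uses only monotonicity, which holds
  -- for arbitrary sets.
  have hle1 : symbolErrorProb S D K σ Nr F k ≤ P.real (Z ⁻¹' weakErrorSet S) := by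
    refine ENNReal.toReal_mono (measure_ne_top _ _) (measure_mono_ae ?_)
    filter_upwards [hs_ae] with ω hω hne
    exact hD.subset_weak hω hne
  have hle2 : P.real (Z ⁻¹' strictErrorSet S) ≤ symbolErrorProb S D K σ Nr F k :=
    ENNReal.toReal_mono (measure_ne_top _ _) (measure_mono fun ω hω => hD.strict_subset hω)
  rw [abs_le]
  constructor <;> linarith

/-! ### The optimal precoder -/

/-- The powers combine to `Fᴴ K F = T⁻¹ Vᴴ Λ^(1/2) V`, with inverse `T Vᴴ Λ^(-1/2) V`. As `|V j k|²
= 1 / N`, every diagonal entry of the inverse is `T` times the mean of `ev ^ (-1/2)`: the DFT gives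
all symbols the same error variance. -/
lemma optimalPrecoder_inv_apply {N : ℕ} {K F W : Matrix (Fin N) (Fin N) ℂ} {ev : Fin N → ℝ}
    (hW : W ∈ Matrix.unitaryGroup (Fin N) ℂ) (hev : ∀ i, 0 < ev i)
    (hK : K = W * Matrix.diagonal (fun i => (ev i : ℂ)) * Wᴴ)
    (hF : F = ((1 / √(∑ i, ev i ^ (-(1 / 2) : ℝ)) : ℝ) : ℂ) •
      (W * Matrix.diagonal (fun i => ((ev i ^ (-(1 / 4) : ℝ) : ℝ) : ℂ)) * dftMatrix N))
    (k : Fin N) :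
    F.det ≠ 0 ∧ (Fᴴ * K * F)⁻¹ k k = (((∑ i, ev i ^ (-(1 / 2) : ℝ)) ^ 2 / N : ℝ) : ℂ) := by
  set T := ∑ i, ev i ^ (-(1 / 2) : ℝ) with hT
  have hTpos : 0 < T := Finset.sum_pos (fun i _ => Real.rpow_pos_of_pos (hev i) _) ⟨k, by simp⟩
  set c : ℂ := ((1 / √T : ℝ) : ℂ) with hc
  have hc2 : c * c * T = 1 := by
    rw [hc, ← Complex.ofReal_mul, ← Complex.ofReal_mul]
    have : 1 / √T * (1 / √T) * T = 1 := by
      rw [div_mul_div_comm, Real.mul_self_sqrt hTpos.le]; field_simp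
    rw [this, Complex.ofReal_one]
  have hcs : star c = c := Complex.conj_ofReal _
  set V := dftMatrix N with hV
  set D := Matrix.diagonal (fun i => ((ev i ^ (-(1 / 4) : ℝ) : ℝ) : ℂ)) with hD
  set Λ := Matrix.diagonal (fun i => (ev i : ℂ)) with hΛ
  set Bm := Matrix.diagonal (fun i => ((ev i ^ (-(1 / 2) : ℝ) : ℝ) : ℂ)) with hBm
  have hDH : Dᴴ = D := by
    rw [hD, Matrix.diagonal_conjTranspose]
    exact congrArg _ (funext fun i => Complex.conj_ofReal _)
  have hVV : Vᴴ * V = 1 := dftMatrix_conjTranspose_mul_self N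
  have hVV' : V * Vᴴ = 1 := Matrix.mem_unitaryGroup_iff.1 (dftMatrix_mem_unitaryGroup N)
  have hWW : Wᴴ * W = 1 := Matrix.mem_unitaryGroup_iff'.1 hW
  have hdiag : D * Λ * D * Bm = 1 := by
    rw [hD, hΛ, hBm, Matrix.diagonal_mul_diagonal, Matrix.diagonal_mul_diagonal,
      Matrix.diagonal_mul_diagonal, ← Matrix.diagonal_one]
    refine congrArg Matrix.diagonal (funext fun i => ?_)
    rw [← Complex.ofReal_mul, ← Complex.ofReal_mul, ← Complex.ofReal_mul]
    have : ev i ^ (-(1 / 4) : ℝ) * ev i * ev i ^ (-(1 / 4) : ℝ) * ev i ^ (-(1 / 2) : ℝ) = 1 := by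
      nth_rewrite 2 [← Real.rpow_one (ev i)]
      rw [← Real.rpow_add (hev i), ← Real.rpow_add (hev i), ← Real.rpow_add (hev i)]
      norm_num
    rw [this, Complex.ofReal_one]
  have hFKF : Fᴴ * K * F = (c * c) • (Vᴴ * (D * Λ * D) * V) := by
    rw [hF, hK, Matrix.conjTranspose_smul, hcs, Matrix.conjTranspose_mul, Matrix.conjTranspose_mul,
      hDH]
    simp only [Matrix.smul_mul, Matrix.mul_smul, smul_smul]
    refine congrArg (fun X => (c * c) • X) ?_
    calc _ = Vᴴ * D * (Wᴴ * W) * Λ * (Wᴴ * W) * D * V := by simp only [Matrix.mul_assoc]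
      _ = _ := by rw [hWW]; simp only [Matrix.mul_assoc, Matrix.mul_one]
  have hinv : (Fᴴ * K * F) * ((T : ℂ) • (Vᴴ * Bm * V)) = 1 := by
    rw [hFKF, Matrix.smul_mul, Matrix.mul_smul, smul_smul, hc2, one_smul]
    calc _ = Vᴴ * (D * Λ * D) * (V * Vᴴ) * Bm * V := by simp only [Matrix.mul_assoc]
      _ = Vᴴ * (D * Λ * D * Bm) * V := by rw [hVV']; simp only [Matrix.mul_assoc, Matrix.mul_one]
      _ = 1 := by rw [hdiag, Matrix.mul_one, hVV]
  refine ⟨fun h0 => ?_, ?_⟩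
  · have := congrArg Matrix.det hinv
    rw [Matrix.det_mul, Matrix.det_mul, Matrix.det_mul, h0] at this
    simp at this
  · rw [Matrix.inv_eq_right_inv hinv, Matrix.smul_apply, Matrix.mul_apply]
    have : ∀ j, (Vᴴ * Bm) k j * V j k = ((ev j ^ (-(1 / 2) : ℝ) * (1 / N) : ℝ) : ℂ) := fun j => by
      rw [hBm, Matrix.mul_diagonal, Matrix.conjTranspose_apply, ← norm_dftMatrix_sq j k]
      push_cast
      rw [← hV, ← Complex.conj_mul' (V j k)]
      simp only [Complex.star_def]
      ring
    rw [Finset.sum_congr rfl fun j _ => this j, ← Complex.ofReal_sum, ← Finset.sum_mul, smul_eq_mul,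
      ← Complex.ofReal_mul, Complex.ofReal_inj, ← hT]
    ring

/-- Positivity of the elliptic integral is read off its representation as the integral of `|1 - r
e^(-ix)| ≥ 1 - r > 0`. -/
lemma kmsSpectralMean_pos {r : ℝ} (hr0 : 0 ≤ r) (hr1 : r < 1) : 0 < kmsSpectralMean r := by
  have hq : 0 < 1 - r ^ 2 := by nlinarith
  have h := integral_norm_one_sub_eq_ellipticE (r : ℂ)
  rw [Complex.norm_real, Real.norm_of_nonneg hr0] at h
  have hge : (1 - r) * (2 * Real.pi)
      ≤ ∫ x in (0 : ℝ)..(2 * Real.pi), ‖1 - (r : ℂ) * Complex.exp (((-x : ℝ) : ℂ) * Complex.I)‖ := by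
    have := intervalIntegral.integral_mono_on (a := 0) (b := 2 * Real.pi) (μ := volume) (by positivity)
      (f := fun _ => 1 - r)
      (g := fun x : ℝ => ‖1 - (r : ℂ) * Complex.exp (((-x : ℝ) : ℂ) * Complex.I)‖)
      intervalIntegrable_const
      (Continuous.intervalIntegrable (by fun_prop) _ _) fun x _ => by
        have := norm_sub_norm_le (1 : ℂ) ((r : ℂ) * Complex.exp (((-x : ℝ) : ℂ) * Complex.I))
        rwa [norm_mul, Complex.norm_exp_ofReal_mul_I, mul_one, norm_one, Complex.norm_real,
          Real.norm_of_nonneg hr0] at this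
    rw [intervalIntegral.integral_const] at this
    simpa [mul_comm] using this
  rw [h] at hge
  have hE : 0 < ellipticE (2 * √r / (1 + r)) := by
    have h1 : 0 < (1 - r) * (2 * Real.pi) := by
      have : 0 < 1 - r := by linarith
      positivity
    exact pos_of_mul_pos_right (h1.trans_le hge) (by positivity)
  rw [kmsSpectralMean]
  have := Real.sqrt_pos.2 hq
  positivity

/-! ### The limit of the average symbol error probability -/

/-- The limiting error variance of the zero-forcing receiver. -/
def limitVariance (r σ β : ℝ) : ℝ := kmsSpectralMean r ^ 2 / (β - 1) * σ ^ 2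

lemma limitVariance_pos {r σ β : ℝ} (hr0 : 0 ≤ r) (hr1 : r < 1) (hσ : 0 < σ) (hβ : 1 < β) :
    0 < limitVariance r σ β := by
  have := kmsSpectralMean_pos hr0 hr1
  have : 0 < β - 1 := by linarith
  unfold limitVariance
  positivity

/-- The average symbol error probability converges to the symbol error probability under
complex Gaussian noise with the limiting variance. -/
theorem tendsto_averageSEP {ρ : ℂ} (hρ1 : ‖ρ‖ < 1) {σ β : ℝ} (hσ : 0 < σ) (hβ : 1 < β)
    {Nt Nr : ℕ → ℕ} (hNt : Tendsto Nt atTop atTop) (hNr : ∀ n, (Nr n : ℝ) = β * (Nt n : ℝ))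
    {F : ∀ n, Matrix (Fin (Nt n)) (Fin (Nt n)) ℂ}
    (hF : ∀ n, IsOptimalPrecoder (kmsMatrix ρ (Nt n)) (F n))
    {S : Set ℂ} (hS : S.Finite) (hne : S.Nonempty) {D : ℂ → ℂ} (hD : IsHardDecision S D)
    {f : ℝ → ℝ}
    (hstrict : ∀ v, 0 < v →
      f v ≤ ((complexNormal v).prod (uniformOn S)).real (strictErrorSet S))
    (hweak : ∀ v, 0 < v → ((complexNormal v).prod (uniformOn S)).real (weakErrorSet S) ≤ f v)
    (hf : ContinuousAt f (limitVariance ‖ρ‖ σ β)) :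
    Tendsto (fun n => averageSEP S D (kmsMatrix ρ (Nt n)) σ (Nr n) (F n)) atTop
      (𝓝 (f (limitVariance ‖ρ‖ σ β))) := by
  have := isProbabilityMeasure_uniformOn hS hne
  choose W hW ev hmono hK hFeq using hF
  have hβ1 : 0 < β - 1 := by linarith
  have hvpos := limitVariance_pos (norm_nonneg ρ) hρ1 hσ hβ
  set L := f (limitVariance ‖ρ‖ σ β) with hL
  have hL0 : 0 ≤ L := measureReal_nonneg.trans (hweak _ hvpos)
  have hL1 : L ≤ 1 := (hstrict _ hvpos).trans measureReal_le_one
  set τ := kmsSpectralMean ‖ρ‖ with hτ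
  set T : ℕ → ℝ := fun n => ∑ i, ev n i ^ (-(1 / 2) : ℝ) with hT
  have hTlim : Tendsto (fun n => T n / Nt n) atTop (𝓝 τ) := tendsto_spectral_mean hρ1 hNt hW hK
  set d : ℕ → ℝ := fun n => Nr n - Nt n + 1 with hd
  have hdeq : ∀ n, d n = (β - 1) * Nt n + 1 := fun n => by simp only [hd, hNr]; ring
  have hNtR : Tendsto (fun n => (Nt n : ℝ)) atTop atTop := tendsto_natCast_atTop_atTop.comp hNt
  have hdlim : Tendsto d atTop atTop := by
    simp only [funext hdeq]
    exact tendsto_atTop_add_const_right _ _ (hNtR.const_mul_atTop hβ1)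
  set a : ℕ → ℝ := fun n => T n ^ 2 / Nt n with ha
  have hadlim : Tendsto (fun n => a n / d n) atTop (𝓝 (τ ^ 2 / (β - 1))) := by
    have h1 : Tendsto (fun n => (T n / Nt n) ^ 2 / ((β - 1) + (Nt n : ℝ)⁻¹)) atTop
        (𝓝 (τ ^ 2 / ((β - 1) + 0))) :=
      (hTlim.pow 2).div (tendsto_const_nhds.add (tendsto_inv_atTop_zero.comp hNtR))
        (by rw [add_zero]; exact hβ1.ne')
    rw [add_zero] at h1
    refine h1.congr' ?_
    filter_upwards [hNt.eventually_gt_atTop 0] with n hn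
    have hN : (0 : ℝ) < Nt n := by exact_mod_cast hn
    rw [hdeq, ha]
    simp only
    field_simp
  set C := Var[fun z : ℂ => ‖z‖ ^ 2; complexNormal 1] with hC
  have hC0 : 0 ≤ C := variance_nonneg _ _
  rw [Metric.tendsto_nhds]
  intro ε hε
  -- The random factor of the variance is `(a / d) / t`, with `a / d` deterministic and `t` the
  -- concentrating ratio near `1`. Joint continuity treats both perturbations at once.
  have hg : ContinuousAt (fun x : ℝ × ℝ => f (x.1 / x.2 * σ ^ 2)) (τ ^ 2 / (β - 1), 1) := by
    refine ContinuousAt.comp (f := fun x : ℝ × ℝ => x.1 / x.2 * σ ^ 2) (g := f) ?_ ?_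
    · simpa [limitVariance, ← hτ] using hf
    · exact (continuousAt_fst.div continuousAt_snd one_ne_zero).mul continuousAt_const
  obtain ⟨δ', hδ'0, hδ'⟩ := Metric.continuousAt_iff.1 hg (ε / 3) (by positivity)
  -- The cap `1 / 2` keeps `t` away from `0` on the good event, so that the variance is positive
  -- there.
  set δ := min δ' (1 / 2) with hδ
  have hδ0 : 0 < δ := by positivity
  have hδle : δ ≤ δ' := min_le_left _ _
  have hδhalf : δ ≤ 1 / 2 := min_le_right _ _
  have hClim : Tendsto (fun n => C / δ ^ 2 / d n) atTop (𝓝 0) :=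
    Tendsto.const_div_atTop hdlim _
  have hx : ∀ᶠ n in atTop, dist (a n / d n) (τ ^ 2 / (β - 1)) < δ' :=
    Metric.tendsto_nhds.1 hadlim _ hδ'0
  filter_upwards [hx, hNt.eventually_gt_atTop 0,
    hClim.eventually (gt_mem_nhds (by positivity : 0 < ε / 3))] with n hxn hn hCn
  have hN : (0 : ℝ) < Nt n := by exact_mod_cast hn
  have hdn : 0 < d n := by rw [hdeq]; positivity
  have hev := spectral_pos (hW n) (kmsMatrix_posDef hρ1 (Nt n)) (hK n)
  have hTpos : 0 < T n :=
    Finset.sum_pos (fun i _ => Real.rpow_pos_of_pos (hev i) _) ⟨⟨0, hn⟩, by simp⟩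
  have han : 0 < a n := by simp only [ha]; positivity
  have hle : Nt n ≤ Nr n := by
    have : (Nt n : ℝ) ≤ Nr n := by rw [hNr]; nlinarith
    exact_mod_cast this
  -- The bound does not depend on `k`, so it passes to the average over the symbols.
  have hk : ∀ k, |symbolErrorProb S D (kmsMatrix ρ (Nt n)) σ (Nr n) (F n) k - L|
      ≤ C / (d n * δ ^ 2) + ε / 3 := by
    intro k
    obtain ⟨hdetF, hinv⟩ := optimalPrecoder_inv_apply (hW n) hev (hK n) (hFeq n) k
    have hconc := channel_inv_gram_concentration hn hle (kmsMatrix_posDef hρ1 (Nt n)) hdetF han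
      hinv hδ0
    refine abs_symbolErrorProb_sub_le hS hne hD (by positivity) hconc ?_ ?_ ?_
      (by positivity) (by linarith)
    · intro H hH
      exact (not_not.1 hH).1
    all_goals
      intro H hH
      obtain ⟨hdet, hlt⟩ := not_not.1 hH
      set w := ∑ j, ‖pseudoInverse (Matrix.of H * F n) k j‖ ^ 2 with hw
      have hwc : ((Matrix.of H * F n)ᴴ * (Matrix.of H * F n))⁻¹ k k = (w : ℂ) :=
        (sum_norm_sq_pseudoInverse hdet k).symm
      rw [hwc, ← Complex.ofReal_inv, Complex.ofReal_re] at hlt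
      rw [hwc, Complex.ofReal_re]
      change |w⁻¹ * a n / d n - 1| < δ at hlt
      set t := w⁻¹ * a n / d n with ht
      have htpos : 0 < t := by have := (abs_lt.1 hlt).1; linarith
      have hw0 : w ≠ 0 := by rintro h0; rw [ht, h0] at htpos; simp at htpos
      have hwpos : 0 < w := lt_of_le_of_ne (by positivity) hw0.symm
      have hwt : a n / d n / t = w := by rw [ht]; field_simp
      have hclose := hδ' (x := (a n / d n, t)) (by
        rw [Prod.dist_eq, max_lt_iff]
        exact ⟨hxn, by rw [Real.dist_eq]; exact hlt.trans_le hδle⟩)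
      simp only [hwt, div_one] at hclose
      have hclose' : |f (w * σ ^ 2) - L| < ε / 3 := hclose
      have h1 := abs_lt.1 hclose'
    · have := hstrict (w * σ ^ 2) (by positivity)
      linarith
    · have := hweak (w * σ ^ 2) (by positivity)
      linarith
  have hCe : C / (d n * δ ^ 2) = C / δ ^ 2 / d n := by field_simp
  rw [Real.dist_eq, averageSEP]
  have havg : 1 / (Nt n : ℝ) * ∑ k, symbolErrorProb S D (kmsMatrix ρ (Nt n)) σ (Nr n) (F n) k - L
      = 1 / (Nt n : ℝ) * ∑ k, (symbolErrorProb S D (kmsMatrix ρ (Nt n)) σ (Nr n) (F n) k - L) := by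
    rw [Finset.sum_sub_distrib, Finset.sum_const, Finset.card_univ, Fintype.card_fin,
      nsmul_eq_mul]
    field_simp
  rw [havg, abs_mul, abs_of_pos (by positivity : 0 < 1 / (Nt n : ℝ))]
  have hsum := (Finset.abs_sum_le_sum_abs (fun k =>
    symbolErrorProb S D (kmsMatrix ρ (Nt n)) σ (Nr n) (F n) k - L) Finset.univ).trans
    (Finset.sum_le_sum fun k _ => hk k)
  rw [Finset.sum_const, Finset.card_univ, Fintype.card_fin, nsmul_eq_mul, hCe] at hsum
  calc _ ≤ 1 / (Nt n : ℝ) * (Nt n * (C / δ ^ 2 / d n + ε / 3)) := by gcongr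
    _ = C / δ ^ 2 / d n + ε / 3 := by field_simp
    _ < ε := by linarith

/-! ### Averages over a constellation -/

/-- Ties lie on the perpendicular bisector of `-a` and `0`, a line of area zero. -/
lemma complexNormal_norm_add_eq_null {v : ℝ} (hv : 0 < v) {a : ℂ} (ha : a ≠ 0) :
    complexNormal v {w | ‖a + w‖ = ‖w‖} = 0 := by
  refine complexNormal_absolutelyContinuous hv ?_
  have h := Measure.addHaar_affineSubspace (volume : Measure ℂ)
    (AffineSubspace.perpBisector (-a) 0)
    (by rw [Ne, AffineSubspace.perpBisector_eq_top]; simpa using ha)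
  refine measure_mono_null (fun w hw => ?_) h
  rw [SetLike.mem_coe, AffineSubspace.mem_perpBisector_iff_dist_eq, dist_eq_norm, dist_eq_norm,
    sub_neg_eq_add, sub_zero, add_comm]
  exact hw

lemma real_prod_uniformOn_range {ι : Type*} [Fintype ι] [Nonempty ι] {e : ι → ℂ}
    (he : Function.Injective e) (μ : Measure ℂ) [IsProbabilityMeasure μ] {E : Set (ℂ × ℂ)}
    (hE : MeasurableSet E) :
    (μ.prod (uniformOn (Set.range e))).real E
      = (∑ i, μ.real {w | (w, e i) ∈ E}) / Fintype.card ι := by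
  classical
  have := isProbabilityMeasure_uniformOn (Set.finite_range e) (Set.range_nonempty e)
  have h1 : uniformOn (Set.range e) = (Fintype.card ι : ENNReal)⁻¹ •
      ∑ i, Measure.dirac (e i) := by
    ext t ht
    have hr : Set.range e = ↑(Finset.univ.image e) := by simp
    rw [uniformOn, ProbabilityTheory.cond_apply (Set.finite_range e).measurableSet, hr,
      Measure.count_apply_finset, Finset.card_image_of_injective _ he, Finset.card_univ,
      Measure.smul_apply, smul_eq_mul, Measure.finsetSum_apply]
    congr 1
    have h2 : (↑(Finset.univ.image e) ∩ t : Set ℂ) = ↑((Finset.univ.filter fun i => e i ∈ t).image e) := by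
      ext x
      simp only [Finset.coe_image, Finset.coe_univ, Set.image_univ, Finset.coe_filter,
        Finset.mem_univ, true_and, Set.mem_inter_iff, Set.mem_range, Set.mem_image,
        Set.mem_ofPred_eq]
      constructor
      · rintro ⟨⟨i, rfl⟩, hi⟩; exact ⟨i, hi, rfl⟩
      · rintro ⟨i, hi, rfl⟩; exact ⟨⟨i, rfl⟩, hi⟩
    rw [h2, Measure.count_apply_finset, Finset.card_image_of_injective _ he]
    simp [Measure.dirac_apply' _ ht, Set.indicator_apply]
  rw [measureReal_def, Measure.prod_apply_symm hE, h1, lintegral_smul_measure,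
    lintegral_finsetSum_measure]
  simp only [lintegral_dirac, smul_eq_mul]
  rw [ENNReal.toReal_mul, ENNReal.toReal_inv, ENNReal.toReal_sum fun i _ => measure_ne_top _ _]
  simp only [ENNReal.toReal_natCast]
  rw [mul_comm, ← div_eq_mul_inv]
  rfl

/-- The conditional error probability is the average of the probabilities of any family of
error regions between the strict and the weak ones. -/
lemma errorSet_real_eq {ι : Type*} [Fintype ι] [Nonempty ι] {e : ι → ℂ}
    (he : Function.Injective e) {v : ℝ} (hv : 0 < v) {Err : ι → Set ℂ}
    (hs : ∀ i w, (w, e i) ∈ strictErrorSet (Set.range e) → w ∈ Err i)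
    (hw : ∀ i w, w ∈ Err i → (w, e i) ∈ weakErrorSet (Set.range e)) :
    (∑ i, (complexNormal v).real (Err i)) / Fintype.card ι
        ≤ ((complexNormal v).prod (uniformOn (Set.range e))).real (strictErrorSet (Set.range e)) ∧
      ((complexNormal v).prod (uniformOn (Set.range e))).real (weakErrorSet (Set.range e))
        ≤ (∑ i, (complexNormal v).real (Err i)) / Fintype.card ι := by
  have hfin := Set.finite_range e
  rw [real_prod_uniformOn_range he _ (measurableSet_strictErrorSet hfin),
    real_prod_uniformOn_range he _ (measurableSet_weakErrorSet hfin)]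
  -- Beyond the strict event, the weak one contains only points on finitely many bisectors; hence
  -- the two have the same probability.
  have key : ∀ i, complexNormal v {w | (w, e i) ∈ weakErrorSet (Set.range e)}
      ≤ complexNormal v {w | (w, e i) ∈ strictErrorSet (Set.range e)} := by
    intro i
    have hnull : complexNormal v (⋃ j ∈ {j | j ≠ i}, {w | ‖(e i - e j) + w‖ = ‖w‖}) = 0 := by
      refine (measure_biUnion_null_iff (Set.to_countable _)).2 fun j hj => ?_
      exact complexNormal_norm_add_eq_null hv (sub_ne_zero.2 fun h => hj (he h.symm))
    refine (measure_mono (t := {w | (w, e i) ∈ strictErrorSet (Set.range e)}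
      ∪ ⋃ j ∈ {j | j ≠ i}, {w | ‖(e i - e j) + w‖ = ‖w‖}) ?_).trans
      ((measure_union_le _ _).trans (by rw [hnull, add_zero]))
    rintro w ⟨_, ⟨j, rfl⟩, hne, hle⟩
    simp only at hne hle
    rcases hle.lt_or_eq with hlt | heq
    · exact Or.inl ⟨_, ⟨j, rfl⟩, hlt⟩
    · refine Or.inr ?_
      simp only [Set.mem_iUnion]
      refine ⟨j, fun h => hne (by rw [h]), ?_⟩
      rw [Set.mem_ofPred_eq, ← heq]
      congr 1; ring
  constructor
  · refine div_le_div_of_nonneg_right (Finset.sum_le_sum fun i _ => ?_) (Nat.cast_nonneg _)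
    refine ENNReal.toReal_mono (measure_ne_top _ _) (le_trans (measure_mono fun w h => ?_) (key i))
    exact hw i w h
  · refine div_le_div_of_nonneg_right (Finset.sum_le_sum fun i _ => ?_) (Nat.cast_nonneg _)
    refine ENNReal.toReal_mono (measure_ne_top _ _) ((key i).trans (measure_mono fun w h => ?_))
    exact hs i w h

/-! ### Grid constellations -/

/-- The error event for the coordinate `m` of a grid of `L` points with half-distance `d`. -/
def gridError (L : ℕ) (d : ℝ) (m : Fin L) : Set ℝ :=
  {x | ((m : ℕ) ≠ 0 ∧ x < -d) ∨ ((m : ℕ) + 1 ≠ L ∧ d < x)}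

lemma measurableSet_gridError (L : ℕ) (d : ℝ) (m : Fin L) : MeasurableSet (gridError L d m) := by
  refine MeasurableSet.union (MeasurableSet.inter (MeasurableSet.const _) ?_)
    (MeasurableSet.inter (MeasurableSet.const _) ?_)
  · exact measurableSet_Iio
  · exact measurableSet_Ioi

/-- The coordinate `m` of a centred grid of `L` points with half-distance `d`. -/
def gridPoint (L : ℕ) (d : ℝ) (m : Fin L) : ℝ := d * (2 * (m : ℝ) + 1 - L)

lemma gridPoint_injective (L : ℕ) {d : ℝ} (hd : 0 < d) : Function.Injective (gridPoint L d) := by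
  intro i j h
  have h1 := mul_left_cancel₀ hd.ne' h
  have h2 : (i : ℝ) = (j : ℝ) := by linarith
  exact Fin.ext (by exact_mod_cast h2)

lemma mem_gridError_of_lt {L : ℕ} {d : ℝ} (hd : 0 < d) {m j : Fin L} {x : ℝ}
    (h : (gridPoint L d m + x - gridPoint L d j) ^ 2 < x ^ 2) : x ∈ gridError L d m := by
  have he : gridPoint L d m + x - gridPoint L d j = 2 * d * ((m : ℝ) - j) + x := by
    unfold gridPoint; ring
  rw [he] at h
  rcases lt_trichotomy j m with hjm | hjm | hjm
  · left
    have h1 : (j : ℝ) + 1 ≤ m := by exact_mod_cast hjm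
    have h0 : (m : ℕ) ≠ 0 := by have := Fin.lt_def.1 hjm; omega
    refine ⟨h0, ?_⟩
    by_contra hx
    have hx' := not_lt.1 hx
    -- The strict inequality amounts to `d (m - j) (d (m - j) + x) < 0`, impossible when `x ≥ -d`
    -- and `m - j ≥ 1`.
    nlinarith [mul_pos hd (by linarith : (0 : ℝ) < (m : ℝ) - j), mul_nonneg
      (mul_pos hd (by linarith : (0 : ℝ) < (m : ℝ) - j)).le (by nlinarith :
        0 ≤ d * ((m : ℝ) - j) + x)]
  · subst hjm; simp at h
  · right
    have h1 : (m : ℝ) + 1 ≤ j := by exact_mod_cast hjm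
    have h0 : (m : ℕ) + 1 ≠ L := by have := Fin.lt_def.1 hjm; have := j.2; omega
    refine ⟨h0, ?_⟩
    by_contra hx
    have hx' := not_lt.1 hx
    nlinarith [mul_nonneg (mul_pos hd (by linarith : (0 : ℝ) < (j : ℝ) - m)).le (by nlinarith :
        0 ≤ d * ((j : ℝ) - m) - x)]

/-- The witness is the adjacent grid point on the side of the displacement; the index conditions in
`gridError` guarantee that it exists. -/
lemma exists_of_mem_gridError {L : ℕ} {d : ℝ} (hd : 0 < d) {m : Fin L} {x : ℝ}
    (h : x ∈ gridError L d m) :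
    ∃ j, j ≠ m ∧ (gridPoint L d m + x - gridPoint L d j) ^ 2 ≤ x ^ 2 := by
  rcases h with ⟨h0, hx⟩ | ⟨h0, hx⟩
  · refine ⟨⟨(m : ℕ) - 1, by have := m.2; omega⟩, fun h => by
      have := congrArg Fin.val h; simp at this; omega, ?_⟩
    have hc : (((m : ℕ) - 1 : ℕ) : ℝ) = (m : ℝ) - 1 := by
      rw [Nat.cast_sub (by omega)]; simp
    simp only [gridPoint, hc]
    nlinarith
  · refine ⟨⟨(m : ℕ) + 1, by have := m.2; omega⟩, fun h => by
      have := congrArg Fin.val h; simp at this, ?_⟩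
    simp only [gridPoint]
    push_cast
    nlinarith

lemma gaussianReal_real_Ioi {v : ℝ} (hv : 0 < v) (d : ℝ) :
    (gaussianReal 0 v.toNNReal).real (Set.Ioi d) = gaussQ (d / √v) := by
  have hs : 0 < √v := Real.sqrt_pos.2 hv
  have h := gaussianReal_map_const_mul (μ := 0) (v := 1) (√v)
  have hvv : NNReal.mk (√v ^ 2) (sq_nonneg _) * 1 = v.toNNReal := by
    ext; simp [Real.sq_sqrt hv.le, hv.le]
  rw [mul_zero, hvv] at h
  rw [gaussQ, ← h, map_measureReal_apply (by fun_prop) measurableSet_Ioi]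
  congr 1
  ext x
  simp only [Set.mem_preimage, Set.mem_Ioi]
  rw [div_lt_iff₀ hs, mul_comm]

lemma gaussianReal_real_Iio_neg {v : ℝ} (hv : 0 < v) (d : ℝ) :
    (gaussianReal 0 v.toNNReal).real (Set.Iio (-d)) = gaussQ (d / √v) := by
  rw [← gaussianReal_real_Ioi hv]
  have h := gaussianReal_map_neg (μ := 0) (v := v.toNNReal)
  rw [neg_zero] at h
  conv_lhs => rw [← h]
  rw [map_measureReal_apply (by fun_prop) measurableSet_Iio]
  congr 1
  ext x
  simp

lemma gaussianReal_real_gridError {L : ℕ} {d v : ℝ} (hd : 0 < d) (hv : 0 < v) (m : Fin L) :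
    (gaussianReal 0 v.toNNReal).real (gridError L d m)
      = (if (m : ℕ) = 0 then 0 else gaussQ (d / √v))
        + (if (m : ℕ) + 1 = L then 0 else gaussQ (d / √v)) := by
  by_cases h0 : (m : ℕ) = 0 <;> by_cases h1 : (m : ℕ) + 1 = L
  · have : gridError L d m = ∅ := by
      ext x; simp only [gridError, Set.mem_ofPred_eq, Set.mem_empty_iff_false]; tauto
    rw [this, if_pos h0, if_pos h1]; simp
  · have : gridError L d m = Set.Ioi d := by
      ext x; simp only [gridError, Set.mem_ofPred_eq, Set.mem_Ioi]; tauto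
    rw [this, gaussianReal_real_Ioi hv, if_pos h0, if_neg h1, zero_add]
  · have : gridError L d m = Set.Iio (-d) := by
      ext x; simp only [gridError, Set.mem_ofPred_eq, Set.mem_Iio]; tauto
    rw [this, gaussianReal_real_Iio_neg hv, if_neg h0, if_pos h1, add_zero]
  · have : gridError L d m = Set.Iio (-d) ∪ Set.Ioi d := by
      ext x
      simp only [gridError, Set.mem_ofPred_eq, Set.mem_Iio, Set.mem_Ioi, Set.mem_union]
      tauto
    rw [this, measureReal_union _ measurableSet_Ioi, gaussianReal_real_Iio_neg hv,
      gaussianReal_real_Ioi hv, if_neg h0, if_neg h1]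
    rw [Set.disjoint_left]
    intro x hx hx'
    simp only [Set.mem_Iio, Set.mem_Ioi] at hx hx'
    linarith

/-- Each one-sided tail is counted once for every point having a neighbour on that side, that is `L
- 1` times. -/
lemma sum_gaussianReal_gridError {L : ℕ} (hL : 0 < L) {d v : ℝ} (hd : 0 < d) (hv : 0 < v) :
    ∑ m : Fin L, (gaussianReal 0 v.toNNReal).real (gridError L d m)
      = 2 * (L - 1) * gaussQ (d / √v) := by
  simp_rw [gaussianReal_real_gridError hd hv]
  obtain ⟨k, rfl⟩ := Nat.exists_eq_succ_of_ne_zero hL.ne'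
  rw [Finset.sum_add_distrib, Fin.sum_univ_succ, Fin.sum_univ_castSucc]
  simp only [Fin.val_zero, if_true, Fin.val_succ, Nat.add_eq_zero_iff, one_ne_zero, and_false,
    if_false, Finset.sum_const, Finset.card_univ, Fintype.card_fin, nsmul_eq_mul, zero_add,
    Fin.val_castSucc, Fin.val_last, Nat.succ_eq_add_one, Nat.add_right_cancel_iff]
  have : ∀ x : Fin k, ((x : ℕ) = k) = False := fun x => by simp [x.2.ne]
  simp only [this, if_false, Finset.sum_const, Finset.card_univ, Fintype.card_fin, nsmul_eq_mul]
  push_cast; ring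

/-! ### Conditional error probabilities of PAM and QAM. -/

lemma complexNormal_real_re {v : ℝ} {A : Set ℝ} (hA : MeasurableSet A) :
    (complexNormal v).real {w | w.re ∈ A} = (gaussianReal 0 (v / 2).toNNReal).real A := by
  have hm : Measurable fun p : ℝ × ℝ => (⟨p.1, p.2⟩ : ℂ) :=
    Complex.measurableEquivRealProd.symm.measurable
  have hE : MeasurableSet {w : ℂ | w.re ∈ A} := Complex.measurable_re hA
  rw [complexNormal, map_measureReal_apply hm hE]
  have : ((fun p : ℝ × ℝ => (⟨p.1, p.2⟩ : ℂ)) ⁻¹' {w | w.re ∈ A}) = A ×ˢ Set.univ := by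
    ext p; simp
  rw [this, measureReal_prod_prod]
  simp

/-- The complement is a product event, and the two coordinates are independent. -/
lemma complexNormal_real_re_im {v : ℝ} {A B : Set ℝ} (hA : MeasurableSet A)
    (hB : MeasurableSet B) :
    (complexNormal v).real {w | w.re ∈ A ∨ w.im ∈ B}
      = 1 - (1 - (gaussianReal 0 (v / 2).toNNReal).real A)
        * (1 - (gaussianReal 0 (v / 2).toNNReal).real B) := by
  have hm : Measurable fun p : ℝ × ℝ => (⟨p.1, p.2⟩ : ℂ) :=
    Complex.measurableEquivRealProd.symm.measurable
  have hE : MeasurableSet {w : ℂ | w.re ∈ A ∨ w.im ∈ B} :=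
    (Complex.measurable_re hA).union (Complex.measurable_im hB)
  have h : (complexNormal v).real {w : ℂ | w.re ∈ A ∨ w.im ∈ B}ᶜ
      = (1 - (gaussianReal 0 (v / 2).toNNReal).real A)
        * (1 - (gaussianReal 0 (v / 2).toNNReal).real B) := by
    rw [complexNormal, map_measureReal_apply hm hE.compl, ← probReal_compl_eq_one_sub hA,
      ← probReal_compl_eq_one_sub hB, ← measureReal_prod_prod]
    congr 1
    ext p
    simp
  rw [probReal_compl_eq_one_sub hE] at h
  linarith

lemma pam_eq_range (M : ℕ) :
    pam M = Set.range fun m : Fin M => ((gridPoint M (√(3 / ((M : ℝ) ^ 2 - 1))) m : ℝ) : ℂ) := rfl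

lemma pam_errorSet_real {M : ℕ} (hM : 2 ≤ M) {v : ℝ} (hv : 0 < v) :
    2 * ((M : ℝ) - 1) / M * gaussQ (√(3 / ((M : ℝ) ^ 2 - 1)) / √(v / 2))
        ≤ ((complexNormal v).prod (uniformOn (pam M))).real (strictErrorSet (pam M)) ∧
      ((complexNormal v).prod (uniformOn (pam M))).real (weakErrorSet (pam M))
        ≤ 2 * ((M : ℝ) - 1) / M * gaussQ (√(3 / ((M : ℝ) ^ 2 - 1)) / √(v / 2)) := by
  have hM2 : (2 : ℝ) ≤ M := by exact_mod_cast hM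
  have hd : 0 < √(3 / ((M : ℝ) ^ 2 - 1)) := Real.sqrt_pos.2 (div_pos (by norm_num) (by nlinarith))
  set d := √(3 / ((M : ℝ) ^ 2 - 1)) with hdd
  have : Nonempty (Fin M) := ⟨⟨0, by omega⟩⟩
  have hnorm : ∀ (m j : Fin M) (w : ℂ),
      ‖((gridPoint M d m : ℝ) : ℂ) + w - ((gridPoint M d j : ℝ) : ℂ)‖ ^ 2
        = (gridPoint M d m + w.re - gridPoint M d j) ^ 2 + w.im ^ 2 := by
    intro m j w
    rw [Complex.sq_norm, Complex.normSq_apply]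
    simp; ring
  have hnw : ∀ w : ℂ, ‖w‖ ^ 2 = w.re ^ 2 + w.im ^ 2 := fun w => by
    rw [Complex.sq_norm, Complex.normSq_apply]; ring
  have h := errorSet_real_eq (e := fun m : Fin M => ((gridPoint M d m : ℝ) : ℂ))
    (Complex.ofReal_injective.comp (gridPoint_injective M hd)) hv
    (Err := fun m => {w | w.re ∈ gridError M d m})
    (by
      rintro m w ⟨_, ⟨j, rfl⟩, hlt⟩
      refine mem_gridError_of_lt hd (j := j) ?_
      have := pow_lt_pow_left₀ hlt (norm_nonneg _) two_ne_zero
      simp only at this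
      rw [hnorm, hnw] at this
      linarith)
    (by
      intro m w hw
      obtain ⟨j, hjm, hle⟩ := exists_of_mem_gridError hd hw
      refine ⟨_, ⟨j, rfl⟩, fun h => hjm (gridPoint_injective M hd (Complex.ofReal_injective h)).symm,
        ?_⟩
      refine (pow_le_pow_iff_left₀ (norm_nonneg _) (norm_nonneg _) two_ne_zero).1 ?_
      simp only
      rw [hnorm, hnw]
      linarith)
  have hsum : (∑ m : Fin M, (complexNormal v).real {w | w.re ∈ gridError M d m})
      / Fintype.card (Fin M) = 2 * ((M : ℝ) - 1) / M * gaussQ (d / √(v / 2)) := by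
    simp_rw [fun m : Fin M => complexNormal_real_re (v := v) (measurableSet_gridError M d m)]
    rw [sum_gaussianReal_gridError (by omega) hd (by positivity : 0 < v / 2), Fintype.card_fin]
    ring
  rw [hsum] at h
  exact h

lemma qam_eq_range (L : ℕ) :
    qam L = Set.range fun p : Fin L × Fin L =>
      (⟨gridPoint L (√(3 / (2 * ((L : ℝ) ^ 2 - 1)))) p.1,
        gridPoint L (√(3 / (2 * ((L : ℝ) ^ 2 - 1)))) p.2⟩ : ℂ) := rfl

lemma qam_errorSet_real {L : ℕ} (hL : 2 ≤ L) {v : ℝ} (hv : 0 < v) :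
    1 - (1 - 2 * ((L : ℝ) - 1) / L * gaussQ (√(3 / (2 * ((L : ℝ) ^ 2 - 1))) / √(v / 2))) ^ 2
        ≤ ((complexNormal v).prod (uniformOn (qam L))).real (strictErrorSet (qam L)) ∧
      ((complexNormal v).prod (uniformOn (qam L))).real (weakErrorSet (qam L))
        ≤ 1 - (1 - 2 * ((L : ℝ) - 1) / L
          * gaussQ (√(3 / (2 * ((L : ℝ) ^ 2 - 1))) / √(v / 2))) ^ 2 := by
  have hL2 : (2 : ℝ) ≤ L := by exact_mod_cast hL
  have hd : 0 < √(3 / (2 * ((L : ℝ) ^ 2 - 1))) :=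
    Real.sqrt_pos.2 (div_pos (by norm_num) (by nlinarith))
  set d := √(3 / (2 * ((L : ℝ) ^ 2 - 1))) with hdd
  have : Nonempty (Fin L) := ⟨⟨0, by omega⟩⟩
  set e : Fin L × Fin L → ℂ := fun p => ⟨gridPoint L d p.1, gridPoint L d p.2⟩ with he
  have hinj : Function.Injective e := fun p q h => by
    have h1 := congrArg Complex.re h
    have h2 := congrArg Complex.im h
    exact Prod.ext (gridPoint_injective L hd h1) (gridPoint_injective L hd h2)
  have hnorm : ∀ (p q : Fin L × Fin L) (w : ℂ), ‖e p + w - e q‖ ^ 2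
        = (gridPoint L d p.1 + w.re - gridPoint L d q.1) ^ 2
          + (gridPoint L d p.2 + w.im - gridPoint L d q.2) ^ 2 := by
    intro p q w
    rw [Complex.sq_norm, Complex.normSq_apply]
    simp [he]; ring
  have hnw : ∀ w : ℂ, ‖w‖ ^ 2 = w.re ^ 2 + w.im ^ 2 := fun w => by
    rw [Complex.sq_norm, Complex.normSq_apply]; ring
  have h := errorSet_real_eq hinj hv
    (Err := fun p => {w | w.re ∈ gridError L d p.1 ∨ w.im ∈ gridError L d p.2})
    (by
      rintro p w ⟨_, ⟨q, rfl⟩, hlt⟩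
      have := pow_lt_pow_left₀ hlt (norm_nonneg _) two_ne_zero
      simp only at this
      rw [hnorm, hnw] at this
      -- If the sum of two squares decreases, at least one of the squares does.
      by_cases h1 : (gridPoint L d p.1 + w.re - gridPoint L d q.1) ^ 2 < w.re ^ 2
      · exact Or.inl (mem_gridError_of_lt hd h1)
      · exact Or.inr (mem_gridError_of_lt hd (j := q.2) (by linarith)))
    (by
      intro p w hw
      rcases hw with hw | hw
      · obtain ⟨j, hjm, hle⟩ := exists_of_mem_gridError hd hw
        refine ⟨_, ⟨(j, p.2), rfl⟩, fun h => hjm (congrArg Prod.fst (hinj h)).symm, ?_⟩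
        refine (pow_le_pow_iff_left₀ (norm_nonneg _) (norm_nonneg _) two_ne_zero).1 ?_
        simp only
        rw [hnorm, hnw]
        simp only [add_sub_cancel_left]
        linarith
      · obtain ⟨j, hjm, hle⟩ := exists_of_mem_gridError hd hw
        refine ⟨_, ⟨(p.1, j), rfl⟩, fun h => hjm (congrArg Prod.snd (hinj h)).symm, ?_⟩
        refine (pow_le_pow_iff_left₀ (norm_nonneg _) (norm_nonneg _) two_ne_zero).1 ?_
        simp only
        rw [hnorm, hnw]
        simp only [add_sub_cancel_left]
        linarith)
  have hsum : (∑ p : Fin L × Fin L,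
      (complexNormal v).real {w | w.re ∈ gridError L d p.1 ∨ w.im ∈ gridError L d p.2})
      / Fintype.card (Fin L × Fin L)
      = 1 - (1 - 2 * ((L : ℝ) - 1) / L * gaussQ (d / √(v / 2))) ^ 2 := by
    simp_rw [fun p : Fin L × Fin L => complexNormal_real_re_im (v := v)
      (measurableSet_gridError L d p.1) (measurableSet_gridError L d p.2)]
    -- The probability of a correct decision is a product over the two coordinates, so its sum over
    -- the grid is the square of a one-dimensional sum.
    rw [Finset.sum_sub_distrib, Fintype.sum_prod_type, Fintype.sum_prod_type]
    simp only
    simp_rw [← Finset.mul_sum]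
    rw [← Finset.sum_mul]
    have hS : ∑ m : Fin L, (1 - (gaussianReal 0 (v / 2).toNNReal).real (gridError L d m))
        = L - 2 * (L - 1) * gaussQ (d / √(v / 2)) := by
      rw [Finset.sum_sub_distrib, sum_gaussianReal_gridError (by omega) hd
        (by positivity : 0 < v / 2)]
      simp
    rw [hS]
    simp only [Finset.sum_const, Finset.card_univ, Fintype.card_fin, nsmul_eq_mul,
      Fintype.card_prod]
    push_cast
    have : (L : ℝ) ≠ 0 := by positivity
    field_simp
  rw [hsum] at h
  exact h

lemma continuous_gaussQ : Continuous gaussQ := by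
  have hint : Integrable (gaussianPDFReal 0 1) := integrable_gaussianPDFReal 0 1
  have h : ∀ x, gaussQ x = gaussQ 0 - ∫ t in (0 : ℝ)..x, gaussianPDFReal 0 1 t := by
    have h1 : ∀ x, gaussQ x = ∫ t in Set.Ioi x, gaussianPDFReal 0 1 t := fun x => by
      rw [gaussQ, measureReal_def, gaussianReal_apply_eq_integral 0 one_ne_zero,
        ENNReal.toReal_ofReal (setIntegral_nonneg measurableSet_Ioi fun _ _ =>
          gaussianPDFReal_nonneg _ _ _)]
    intro x
    rw [h1, h1, ← intervalIntegral.integral_Ioi_sub_Ioi' hint.integrableOn hint.integrableOn]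
    ring
  rw [funext h]
  exact continuous_const.sub (intervalIntegral.continuous_primitive
    (fun a b => hint.intervalIntegrable) 0)

/-! ### Phase shift keying -/

lemma exists_coeff_strongDual_complex (L : StrongDual ℝ ℂ) :
    ∃ b : ℂ, ∀ w, L w = (b * w).re := by
  refine ⟨⟨L 1, -L Complex.I⟩, fun w => ?_⟩
  have hw : w = w.re • (1 : ℂ) + w.im • Complex.I := by
    apply Complex.ext <;> simp
  conv_lhs => rw [hw, map_add, map_smul, map_smul]
  simp only [smul_eq_mul, Complex.mul_re]
  ring

lemma map_mul_complexNormal {v : ℝ} (hv : 0 ≤ v) {c : ℂ} (hc : ‖c‖ = 1) :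
    (complexNormal v).map (fun w => c * w) = complexNormal v := by
  have hT : (fun w => c * w) = ContinuousLinearMap.mul ℝ ℂ c := rfl
  have : IsProbabilityMeasure ((complexNormal v).map (ContinuousLinearMap.mul ℝ ℂ c)) :=
    Measure.isProbabilityMeasure_map (by fun_prop)
  rw [hT]
  apply Measure.ext_of_charFunDual
  ext L
  obtain ⟨b, hb⟩ := exists_coeff_strongDual_complex L
  rw [charFunDual_map, charFunDual_complexNormal hv L b hb,
    charFunDual_complexNormal hv _ (b * c) fun w => by simp [hb, mul_assoc], norm_mul, hc, mul_one]

lemma map_conj_complexNormal {v : ℝ} (hv : 0 ≤ v) :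
    (complexNormal v).map (starRingEnd ℂ) = complexNormal v := by
  have hT : (starRingEnd ℂ : ℂ → ℂ) = (Complex.conjCLE : ℂ →L[ℝ] ℂ) := rfl
  have : IsProbabilityMeasure ((complexNormal v).map (Complex.conjCLE : ℂ →L[ℝ] ℂ)) :=
    Measure.isProbabilityMeasure_map (by fun_prop)
  rw [hT]
  apply Measure.ext_of_charFunDual
  ext L
  obtain ⟨b, hb⟩ := exists_coeff_strongDual_complex L
  rw [charFunDual_map, charFunDual_complexNormal hv L b hb,
    charFunDual_complexNormal hv _ (starRingEnd ℂ b) fun w => by simp [hb], RCLike.norm_conj]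

lemma measurable_im_mul_sub_re_mul (a b : ℝ) : Measurable fun u : ℂ => u.im * a - u.re * b :=
  (Complex.measurable_im.mul_const _).sub (Complex.measurable_re.mul_const _)

/-- The error event, relative to the transmitted symbol `1`, of a phase decision with
half-angle `α`. -/
def sectorError (α : ℝ) : Set ℂ :=
  {u | Real.sin α < u.im * Real.cos α - u.re * Real.sin α ∨
    u.im * Real.cos α + u.re * Real.sin α < -Real.sin α}

/-- The Jacobian of polar coordinates makes the radial Gaussian density an exact derivative. -/
lemma lintegral_rayleigh_Ioi {v : ℝ} (hv : 0 < v) {R : ℝ} (hR : 0 ≤ R) :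
    ∫⁻ t in Set.Ioi R, ENNReal.ofReal (t / (Real.pi * v) * Real.exp (-t ^ 2 / v))
      = ENNReal.ofReal (1 / (2 * Real.pi) * Real.exp (-R ^ 2 / v)) := by
  set F : ℝ → ℝ := fun t => -(1 / (2 * Real.pi) * Real.exp (-t ^ 2 / v)) with hF
  have hderiv : ∀ t ∈ Set.Ici R, HasDerivAt F (t / (Real.pi * v) * Real.exp (-t ^ 2 / v)) t := by
    intro t _
    have h1 : HasDerivAt (fun t : ℝ => -t ^ 2 / v) (-(2 * t) / v) t := by
      simpa using ((hasDerivAt_pow 2 t).neg.div_const v)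
    have h2 := (h1.exp.const_mul (1 / (2 * Real.pi))).neg
    refine h2.congr_deriv ?_
    field_simp
  have hpos : ∀ t ∈ Set.Ioi R, 0 ≤ t / (Real.pi * v) * Real.exp (-t ^ 2 / v) := by
    intro t ht
    have : 0 ≤ t := hR.trans (le_of_lt ht)
    positivity
  have hlim : Tendsto F atTop (𝓝 0) := by
    have h1 : Tendsto (fun t : ℝ => -t ^ 2 / v) atTop atBot := by
      have : Tendsto (fun t : ℝ => t ^ 2 / v) atTop atTop :=
        (tendsto_pow_atTop two_ne_zero).atTop_div_const hv
      refine (tendsto_neg_atTop_atBot.comp this).congr fun t => ?_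
      simp only [Function.comp]; ring
    have h2 := ((Real.tendsto_exp_atBot.comp h1).const_mul (1 / (2 * Real.pi))).neg
    simpa [hF] using h2
  have hint := integrableOn_Ioi_deriv_of_nonneg' hderiv hpos hlim
  rw [← ofReal_integral_eq_lintegral_ofReal hint
    ((ae_restrict_iff' measurableSet_Ioi).2 (Eventually.of_forall hpos)),
    integral_Ioi_of_hasDerivAt_of_tendsto' hderiv hint hlim]
  simp [hF]

lemma integrable_craig {v a b s : ℝ} (hv : 0 < v) :
    IntegrableOn (fun θ => Real.exp (-s ^ 2 / (v * Real.sin θ ^ 2))) (Set.Ioc a b) := by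
  -- Where `sin θ = 0`, division by zero gives exponent `0` and value `1`, so the bound holds
  -- everywhere.
  refine Measure.integrableOn_of_bounded (M := 1) (by simp) ?_ ?_
  · exact (Measurable.exp (by fun_prop)).aestronglyMeasurable
  · refine Eventually.of_forall fun θ => ?_
    rw [Real.norm_of_nonneg (Real.exp_pos _).le, Real.exp_le_one_iff]
    exact div_nonpos_of_nonpos_of_nonneg (by nlinarith [sq_nonneg s]) (by positivity)

/-- Craig's computation: in polar coordinates the event reads `t sin (φ - α) > sin α`. It forces `φ
> α`, and on each ray it is a half-line `t > sin α / sin (φ - α)`, whose radial integral is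
explicit; then `θ = φ - α`. -/
lemma complexNormal_upper_sectorError {v α : ℝ} (hv : 0 < v) (hα0 : 0 < α) (hα : α < Real.pi) :
    (complexNormal v).real
      {u : ℂ | 0 < u.im ∧ Real.sin α < u.im * Real.cos α - u.re * Real.sin α}
      = 1 / (2 * Real.pi) * ∫ θ in (0 : ℝ)..(Real.pi - α),
        Real.exp (-Real.sin α ^ 2 / (v * Real.sin θ ^ 2)) := by
  have hsα : 0 < Real.sin α := Real.sin_pos_of_pos_of_lt_pi hα0 hα
  set X : Set ℂ := {u : ℂ | 0 < u.im ∧ Real.sin α < u.im * Real.cos α - u.re * Real.sin α}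
    with hX
  have hXm : MeasurableSet X :=
    (measurableSet_lt measurable_const Complex.measurable_im).inter
      (measurableSet_lt measurable_const (measurable_im_mul_sub_re_mul _ _))
  set h : ℝ → ℝ := fun θ => 1 / (2 * Real.pi) *
    Real.exp (-Real.sin α ^ 2 / (v * Real.sin θ ^ 2)) with hh
  set Y : Set (ℝ × ℝ) := {p | 0 < Real.sin p.2 ∧ Real.sin α < p.1 * Real.sin (p.2 - α)} with hY
  have hYm : MeasurableSet Y :=
    (measurableSet_lt measurable_const (Real.measurable_sin.comp measurable_snd)).inter
      (measurableSet_lt measurable_const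
        (measurable_fst.mul (Real.measurable_sin.comp (measurable_snd.sub_const α))))
  set g : ℝ × ℝ → ENNReal := Y.indicator fun p =>
    ENNReal.ofReal (p.1 / (Real.pi * v) * Real.exp (-p.1 ^ 2 / v)) with hg
  have hgm : Measurable g := Measurable.indicator (by fun_prop) hYm
  have h1 : complexNormal v X = ∫⁻ p in polarCoord.target, g p := by
    rw [complexNormal_eq_withDensity hv, withDensity_apply _ hXm,
      ← lintegral_indicator hXm, ← Complex.lintegral_comp_polarCoord_symm]
    refine setLIntegral_congr_fun polarCoord.open_target.measurableSet fun p hp => ?_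
    have hp1 : 0 < p.1 := by simpa [polarCoord] using hp.1
    have hre : (Complex.polarCoord.symm p).re = p.1 * Real.cos p.2 := by
      rw [Complex.polarCoord_symm_apply, Complex.re_ofReal_mul]
      simp only [Complex.add_re, Complex.mul_re, Complex.ofReal_re, Complex.ofReal_im,
        Complex.I_re, Complex.I_im]
      ring
    have him : (Complex.polarCoord.symm p).im = p.1 * Real.sin p.2 := by
      rw [Complex.polarCoord_symm_apply, Complex.im_ofReal_mul]
      simp only [Complex.add_im, Complex.mul_im, Complex.ofReal_re, Complex.ofReal_im,
        Complex.I_re, Complex.I_im]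
      ring
    have hmem : Complex.polarCoord.symm p ∈ X ↔ p ∈ Y := by
      simp only [hX, hY, Set.mem_ofPred_eq, hre, him, Real.sin_sub, mul_pos_iff_of_pos_left hp1]
      rw [show p.1 * Real.sin p.2 * Real.cos α - p.1 * Real.cos p.2 * Real.sin α
        = p.1 * (Real.sin p.2 * Real.cos α - Real.cos p.2 * Real.sin α) by ring]
    simp only [hg]
    by_cases hpY : p ∈ Y
    · rw [Set.indicator_of_mem hpY, Set.indicator_of_mem (hmem.2 hpY), smul_eq_mul,
        ← ENNReal.ofReal_mul hp1.le, Complex.norm_polarCoord_symm, sq_abs]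
      congr 1; ring
    · rw [Set.indicator_of_notMem hpY, Set.indicator_of_notMem (fun hc => hpY (hmem.1 hc))]
      simp
  have h2 : ∀ φ ∈ Set.Ioo (-Real.pi) Real.pi, ∫⁻ t in Set.Ioi 0, g (t, φ)
      = (Set.Ioc α Real.pi).indicator (fun φ => ENNReal.ofReal (h (φ - α))) φ := by
    intro φ hφ
    by_cases hφα : α < φ
    · have hs1 : 0 < Real.sin (φ - α) :=
        Real.sin_pos_of_pos_of_lt_pi (by linarith) (by linarith [hφ.2])
      have hs2 : 0 < Real.sin φ := Real.sin_pos_of_pos_of_lt_pi (by linarith) hφ.2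
      have hR : 0 ≤ Real.sin α / Real.sin (φ - α) := by positivity
      rw [Set.indicator_of_mem (show φ ∈ Set.Ioc α Real.pi from ⟨hφα, hφ.2.le⟩)]
      have h3 : ∀ t, g (t, φ) = (Set.Ioi (Real.sin α / Real.sin (φ - α))).indicator
          (fun t => ENNReal.ofReal (t / (Real.pi * v) * Real.exp (-t ^ 2 / v))) t := by
        intro t
        simp only [hg, hY, Set.indicator_apply, Set.mem_ofPred_eq, Set.mem_Ioi, hs2, true_and,
          div_lt_iff₀ hs1]
      simp_rw [h3]
      rw [setLIntegral_indicator measurableSet_Ioi,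
        Set.inter_eq_left.2 (Set.Ioi_subset_Ioi hR), lintegral_rayleigh_Ioi hv hR]
      congr 1
      simp only [hh]
      rw [div_pow, neg_div, neg_div, div_div, mul_comm (Real.sin (φ - α) ^ 2)]
    · rw [Set.indicator_of_notMem (fun hc : φ ∈ Set.Ioc α Real.pi => hφα hc.1)]
      have h3 : ∀ t ∈ Set.Ioi (0 : ℝ), g (t, φ) = 0 := by
        intro t ht
        refine Set.indicator_of_notMem ?_ _
        rintro ⟨hs, hlt⟩
        simp only at hs hlt
        have hφ0 : 0 < φ := by
          by_contra hneg
          exact absurd hs (not_lt.2 (Real.sin_nonpos_of_nonpos_of_neg_pi_le (not_lt.1 hneg) hφ.1.le))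
        have : Real.sin (φ - α) ≤ 0 :=
          Real.sin_nonpos_of_nonpos_of_neg_pi_le (by linarith) (by linarith)
        have ht' : 0 < t := ht
        nlinarith
      rw [setLIntegral_congr_fun measurableSet_Ioi h3]
      simp
  have h4 : complexNormal v X = ∫⁻ φ in Set.Ioc α Real.pi, ENNReal.ofReal (h (φ - α)) := by
    rw [h1, show polarCoord.target = Set.Ioi 0 ×ˢ Set.Ioo (-Real.pi) Real.pi from rfl,
      Measure.volume_eq_prod, ← Measure.prod_restrict, lintegral_prod_symm _ hgm.aemeasurable,
      setLIntegral_congr_fun measurableSet_Ioo h2,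
      setLIntegral_congr (Ioo_ae_eq_Ioc (a := -Real.pi) (b := Real.pi)),
      setLIntegral_indicator measurableSet_Ioc,
      Set.inter_eq_left.2 (Set.Ioc_subset_Ioc_left (by linarith))]
  have hhpos : ∀ θ, 0 ≤ h θ := fun θ => by positivity
  have hhint : IntervalIntegrable h volume 0 (Real.pi - α) := by
    rw [intervalIntegrable_iff_integrableOn_Ioc_of_le (by linarith)]
    exact (integrable_craig hv).const_mul _
  have hhint2 : IntervalIntegrable (fun φ => h (φ - α)) volume α Real.pi := by
    have := hhint.comp_sub_right α
    simpa using this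
  rw [measureReal_def, h4, ← ofReal_integral_eq_lintegral_ofReal
    ((intervalIntegrable_iff_integrableOn_Ioc_of_le hα.le).1 hhint2)
    (Eventually.of_forall fun φ => hhpos _),
    ENNReal.toReal_ofReal (integral_nonneg fun φ => hhpos _),
    ← intervalIntegral.integral_of_le hα.le, intervalIntegral.integral_comp_sub_right h α,
    sub_self, intervalIntegral.integral_const_mul]

/-- Off the real axis the event is the disjoint union of an upper half-plane part and its conjugate,
which have equal probability. Since `cos α ≥ 0`, in either half-plane the condition belonging to the
other half implies the condition belonging to this one. -/
lemma complexNormal_real_sectorError {v α : ℝ} (hv : 0 < v) (hα0 : 0 < α)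
    (hα : α ≤ Real.pi / 2) :
    (complexNormal v).real (sectorError α)
      = 1 / Real.pi * ∫ θ in (0 : ℝ)..(Real.pi - α),
        Real.exp (-Real.sin α ^ 2 / (v * Real.sin θ ^ 2)) := by
  have hαpi : α < Real.pi := by linarith [Real.pi_pos]
  have hc : 0 ≤ Real.cos α := Real.cos_nonneg_of_neg_pi_div_two_le_of_le (by linarith) hα
  set A : Set ℂ := {u : ℂ | 0 < u.im ∧ Real.sin α < u.im * Real.cos α - u.re * Real.sin α}
    with hA
  have hAm : MeasurableSet A :=
    (measurableSet_lt measurable_const Complex.measurable_im).inter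
      (measurableSet_lt measurable_const (measurable_im_mul_sub_re_mul _ _))
  have hcm : Measurable (starRingEnd ℂ) := Complex.continuous_conj.measurable
  set B : Set ℂ := starRingEnd ℂ ⁻¹' A with hB
  have hBA : (complexNormal v).real B = (complexNormal v).real A := by
    rw [hB, ← map_measureReal_apply hcm hAm, map_conj_complexNormal hv.le]
  have hmemB : ∀ u : ℂ, u ∈ B ↔ u.im < 0 ∧ u.im * Real.cos α + u.re * Real.sin α < -Real.sin α := by
    intro u
    simp only [hB, hA, Set.mem_preimage, Set.mem_ofPred_eq, Complex.conj_re, Complex.conj_im]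
    constructor
    · rintro ⟨h1, h2⟩; exact ⟨by linarith, by linarith⟩
    · rintro ⟨h1, h2⟩; exact ⟨by linarith, by linarith⟩
  have hnull : complexNormal v {w : ℂ | w.im = 0} = 0 := by
    have h := complexNormal_real_re_im (v := v) MeasurableSet.empty (measurableSet_singleton (0 : ℝ))
    have hv2 : (v / 2).toNNReal ≠ 0 := by simpa [Real.toNNReal_eq_zero] using hv
    have := nullSingletonClass_gaussianReal (μ := 0) hv2
    simp only [Set.mem_empty_iff_false, false_or, Set.mem_singleton_iff,
      measureReal_def, measure_singleton, measure_empty, ENNReal.toReal_zero, sub_zero, mul_one, sub_self] at h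
    exact (ENNReal.toReal_eq_zero_iff _).1 h |>.resolve_right (measure_ne_top _ _)
  have hae : sectorError α =ᵐ[complexNormal v] (A ∪ B : Set ℂ) := by
    have h0 : ∀ᵐ u ∂complexNormal v, u.im ≠ 0 := by
      rw [ae_iff]; simpa using hnull
    filter_upwards [h0] with u hu
    apply propext
    change u ∈ sectorError α ↔ u ∈ A ∪ B
    rw [Set.mem_union, hmemB]
    simp only [sectorError, hA, Set.mem_ofPred_eq]
    rcases lt_or_gt_of_ne hu with h | h
    · have hmul : u.im * Real.cos α ≤ 0 := mul_nonpos_of_nonpos_of_nonneg h.le hc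
      constructor
      · rintro (h1 | h1)
        · exact Or.inr ⟨h, by linarith⟩
        · exact Or.inr ⟨h, h1⟩
      · rintro (h1 | h1)
        · exact Or.inl h1.2
        · exact Or.inr h1.2
    · have hmul : 0 ≤ u.im * Real.cos α := mul_nonneg h.le hc
      constructor
      · rintro (h1 | h1)
        · exact Or.inl ⟨h, h1⟩
        · exact Or.inl ⟨h, by linarith⟩
      · rintro (h1 | h1)
        · exact Or.inl h1.2
        · exact Or.inr h1.2
  have hdisj : Disjoint A B := by
    rw [Set.disjoint_left]
    intro u h1 h2
    have := h1.1
    have := ((hmemB u).1 h2).1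
    linarith
  rw [measureReal_congr hae, measureReal_union hdisj (hcm hAm), hBA,
    complexNormal_upper_sectorError hv hα0 hαpi]
  field_simp
  ring

/-! ### Roots of unity and the conditional error probability of PSK. -/

/-- The points of the PSK constellation. -/
def pskPoint (M m : ℕ) : ℂ :=
  Complex.exp (((2 * Real.pi * (m : ℝ) / M : ℝ) : ℂ) * Complex.I)

lemma psk_eq_range (M : ℕ) : psk M = Set.range fun m : Fin M => pskPoint M m := rfl

lemma pskPoint_eq_pow {M : ℕ} (m : ℕ) :
    pskPoint M m = Complex.exp (2 * Real.pi * Complex.I / M) ^ m := by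
  rw [pskPoint, ← Complex.exp_nat_mul]
  congr 1; push_cast; ring

lemma norm_pskPoint (M m : ℕ) : ‖pskPoint M m‖ = 1 := Complex.norm_exp_ofReal_mul_I _

lemma pskPoint_pow {M : ℕ} (hM : M ≠ 0) (m : ℕ) : pskPoint M m ^ M = 1 := by
  rw [pskPoint_eq_pow, ← pow_mul, mul_comm m M, pow_mul,
    (Complex.isPrimitiveRoot_exp M hM).pow_eq_one,
    one_pow]

lemma pskPoint_injective {M : ℕ} (hM : M ≠ 0) :
    Function.Injective fun m : Fin M => pskPoint M m := by
  intro i j h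
  simp only [pskPoint_eq_pow] at h
  exact Fin.ext ((Complex.isPrimitiveRoot_exp M hM).pow_inj i.2 j.2 h)

lemma exists_pskPoint_of_pow_eq_one {M : ℕ} (hM : M ≠ 0) {z : ℂ} (hz : z ^ M = 1) :
    ∃ m : Fin M, pskPoint M m = z := by
  have : NeZero M := ⟨hM⟩
  obtain ⟨i, hi, h⟩ := (Complex.isPrimitiveRoot_exp M hM).eq_pow_of_pow_eq_one hz
  exact ⟨⟨i, hi⟩, by rw [pskPoint_eq_pow]; exact h⟩

/-- Writing the root as `e^(2iθ)` makes the bisector between it and `1` the line of direction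
`e^(iθ)` through `0`, so the comparison of distances is linear in `sin θ` and `cos θ`. -/
lemma norm_sq_one_add_sub_exp (θ : ℝ) (u : ℂ) :
    ‖1 + u - Complex.exp (((2 * θ : ℝ) : ℂ) * Complex.I)‖ ^ 2
      = ‖u‖ ^ 2 + 4 * Real.sin θ * (Real.sin θ * (1 + u.re) - Real.cos θ * u.im) := by
  rw [Complex.sq_norm, Complex.sq_norm, Complex.normSq_apply, Complex.normSq_apply]
  simp only [Complex.sub_re, Complex.sub_im, Complex.add_re, Complex.add_im, Complex.one_re,
    Complex.one_im, Complex.exp_ofReal_mul_I_re, Complex.exp_ofReal_mul_I_im, Real.cos_two_mul,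
    Real.sin_two_mul]
  have h := Real.sin_sq_add_cos_sq θ
  have hc : Real.cos θ ^ 2 = 1 - Real.sin θ ^ 2 := by linarith
  have hc4 : Real.cos θ ^ 4 = (1 - Real.sin θ ^ 2) ^ 2 := by rw [← hc]; ring
  ring_nf
  simp only [hc4, hc]
  ring

/-- Multiplication by the conjugate symbol moves the transmitted point to `1` and preserves the
noise law, so all symbols have the same error probability. Competing roots are `e^(2iθ)` with `α ≤ θ
≤ π - α`; any such root closer than `1` forces the sector event, and that event is witnessed by one
of the two neighbours of `1`. -/
lemma psk_errorSet_real {M : ℕ} (hM : 2 ≤ M) {v : ℝ} (hv : 0 < v) :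
    1 / Real.pi * (∫ θ in (0 : ℝ)..(Real.pi - Real.pi / M),
        Real.exp (-Real.sin (Real.pi / M) ^ 2 / (v * Real.sin θ ^ 2)))
        ≤ ((complexNormal v).prod (uniformOn (psk M))).real (strictErrorSet (psk M)) ∧
      ((complexNormal v).prod (uniformOn (psk M))).real (weakErrorSet (psk M))
        ≤ 1 / Real.pi * ∫ θ in (0 : ℝ)..(Real.pi - Real.pi / M),
          Real.exp (-Real.sin (Real.pi / M) ^ 2 / (v * Real.sin θ ^ 2)) := by
  have hM0 : M ≠ 0 := by omega
  have hMR : (2 : ℝ) ≤ M := by exact_mod_cast hM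
  have hMpos : (0 : ℝ) < M := by linarith
  have hpi := Real.pi_pos
  set α := Real.pi / M with hα
  have hα0 : 0 < α := by positivity
  have hα2 : α ≤ Real.pi / 2 := by rw [hα]; gcongr
  have hαM : α * M = Real.pi := by rw [hα]; field_simp
  have hsα : 0 < Real.sin α := Real.sin_pos_of_pos_of_lt_pi hα0 (by linarith)
  have hcα : 0 ≤ Real.cos α := Real.cos_nonneg_of_neg_pi_div_two_le_of_le (by linarith) hα2
  have : Nonempty (Fin M) := ⟨⟨0, by omega⟩⟩
  have hpt : ∀ m : ℕ, pskPoint M m = Complex.exp (((2 * (α * m) : ℝ) : ℂ) * Complex.I) := by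
    intro m
    rw [pskPoint, hα]; congr 3; ring
  have hcc : ∀ m : ℕ, pskPoint M m * starRingEnd ℂ (pskPoint M m) = 1 := fun m => by
    rw [Complex.mul_conj, Complex.normSq_eq_norm_sq, norm_pskPoint]; simp
  have hstar : ∀ m : ℕ, (starRingEnd ℂ (pskPoint M m)) ^ M = 1 := fun m => by
    rw [← map_pow, pskPoint_pow hM0, map_one]
  have hrot : ∀ (m : ℕ) (w ζ : ℂ), ‖1 + w * starRingEnd ℂ (pskPoint M m) - ζ‖
      = ‖pskPoint M m + w - pskPoint M m * ζ‖ := by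
    intro m w ζ
    have h1 : pskPoint M m + w - pskPoint M m * ζ
        = pskPoint M m * (1 + w * starRingEnd ℂ (pskPoint M m) - ζ) := by
      linear_combination (-w) * hcc m
    rw [h1, norm_mul, norm_pskPoint, one_mul]
  have hrotw : ∀ (m : ℕ) (w : ℂ), ‖w * starRingEnd ℂ (pskPoint M m)‖ = ‖w‖ := fun m w => by
    rw [norm_mul, RCLike.norm_conj, norm_pskPoint, mul_one]
  have h := errorSet_real_eq (pskPoint_injective hM0) hv
    (Err := fun m => {w | w * starRingEnd ℂ (pskPoint M m) ∈ sectorError α})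
    (by
      rintro m w ⟨_, ⟨j, rfl⟩, hlt⟩
      simp only at hlt
      set u := w * starRingEnd ℂ (pskPoint M m) with hu
      obtain ⟨l, hl⟩ := exists_pskPoint_of_pow_eq_one hM0
        (z := pskPoint M j * starRingEnd ℂ (pskPoint M m))
        (by rw [mul_pow, pskPoint_pow hM0, hstar, one_mul])
      have hj : pskPoint M j = pskPoint M m * pskPoint M l := by
        rw [hl]; linear_combination (-pskPoint M j) * hcc m
      rw [hj, ← hrot, ← hrotw m w, ← hu, hpt l] at hlt
      have hsq := pow_lt_pow_left₀ hlt (norm_nonneg _) two_ne_zero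
      rw [norm_sq_one_add_sub_exp] at hsq
      have hl0 : (l : ℕ) ≠ 0 := by
        intro h0
        rw [h0] at hsq
        simp at hsq
      set θ := α * (l : ℝ) with hθ
      have hl1 : (1 : ℝ) ≤ l := by exact_mod_cast Nat.one_le_iff_ne_zero.2 hl0
      have hl2 : (l : ℝ) + 1 ≤ M := by exact_mod_cast l.2
      have hθ1 : α ≤ θ := by rw [hθ]; nlinarith
      have hθ2 : θ ≤ Real.pi - α := by rw [hθ, ← hαM]; nlinarith
      have hsθ : 0 < Real.sin θ := Real.sin_pos_of_pos_of_lt_pi (by linarith) (by linarith)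
      have hlt2 : Real.sin θ * (1 + u.re) < Real.cos θ * u.im := by
        by_contra hcon
        have := mul_nonneg hsθ.le (sub_nonneg.2 (not_lt.1 hcon))
        linarith
      have hs1 : 0 ≤ Real.sin (θ - α) :=
        Real.sin_nonneg_of_nonneg_of_le_pi (by linarith) (by linarith)
      have hs2 : 0 ≤ Real.sin (θ + α) :=
        Real.sin_nonneg_of_nonneg_of_le_pi (by linarith) (by linarith)
      rw [Real.sin_sub] at hs1
      rw [Real.sin_add] at hs2
      change u ∈ sectorError α
      by_contra hu'
      simp only [sectorError, Set.mem_ofPred_eq, not_or, not_lt] at hu'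
      obtain ⟨hu1, hu2⟩ := hu'
      have k1 := mul_lt_mul_of_pos_left hlt2 hsα
      -- Eliminating `1 + u.re` leaves `u.im * sin (θ - α) < 0`, respectively `u.im * sin (θ + α) >
      -- 0`. The sign of `u.im` decides which of the two is contradictory.
      rcases le_total 0 u.im with hi | hi
      · nlinarith [mul_le_mul_of_nonneg_left hu1 hsθ.le, mul_nonneg hi hs1]
      · nlinarith [mul_le_mul_of_nonneg_left hu2 hsθ.le,
          mul_nonneg (neg_nonneg.2 hi) hs2])
    (by
      intro m w hw
      simp only [Set.mem_ofPred_eq] at hw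
      set u := w * starRingEnd ℂ (pskPoint M m) with hu
      have hζ1 : pskPoint M 1 ≠ 1 := by
        intro h1
        have h0 : pskPoint M 0 = 1 := by simp [pskPoint]
        have := pskPoint_injective hM0 (a₁ := ⟨1, by omega⟩) (a₂ := ⟨0, by omega⟩)
          (by simp only [h1, h0])
        simp at this
      have hgo : ∀ ζ : ℂ, ζ ^ M = 1 → ζ ≠ 1 → ‖1 + u - ζ‖ ^ 2 ≤ ‖u‖ ^ 2 →
          (w, pskPoint M m) ∈ weakErrorSet (Set.range fun m : Fin M => pskPoint M m) := by
        intro ζ hζM hζ hle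
        obtain ⟨j, hj⟩ := exists_pskPoint_of_pow_eq_one hM0 (z := pskPoint M m * ζ)
          (by rw [mul_pow, pskPoint_pow hM0, hζM, one_mul])
        refine ⟨_, ⟨j, rfl⟩, ?_, ?_⟩
        · simp only [hj]
          intro h2
          have hne : pskPoint M m ≠ 0 := by
            intro h0; have := norm_pskPoint M m; rw [h0] at this; simp at this
          apply hζ
          apply mul_left_cancel₀ hne
          rw [← h2, mul_one]
        · simp only [hj]
          rw [← hrot, ← hrotw m w]
          exact (pow_le_pow_iff_left₀ (norm_nonneg _) (norm_nonneg _) two_ne_zero).1 hle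
      rcases hw with hw | hw
      · refine hgo (pskPoint M 1) (pskPoint_pow hM0 1) hζ1 ?_
        rw [hpt, norm_sq_one_add_sub_exp]
        simp only [Nat.cast_one, mul_one]
        nlinarith
      · have hc1 : starRingEnd ℂ (pskPoint M 1)
            = Complex.exp (((2 * (-α) : ℝ) : ℂ) * Complex.I) := by
          rw [hpt, ← Complex.exp_conj, map_mul, Complex.conj_ofReal, Complex.conj_I]
          congr 1; push_cast; ring
        refine hgo (starRingEnd ℂ (pskPoint M 1)) (hstar 1) ?_ ?_
        · intro h1
          apply hζ1
          rw [← Complex.conj_conj (pskPoint M 1), h1, map_one]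
        · rw [hc1, norm_sq_one_add_sub_exp, Real.sin_neg, Real.cos_neg]
          nlinarith)
  have hEm : MeasurableSet (sectorError α) :=
    (measurableSet_lt measurable_const (measurable_im_mul_sub_re_mul _ _)).union
      (measurableSet_lt ((Complex.measurable_im.mul_const _).add
        (Complex.measurable_re.mul_const _)) measurable_const)
  have hsum : (∑ m : Fin M, (complexNormal v).real
      {w | w * starRingEnd ℂ (pskPoint M m) ∈ sectorError α}) / Fintype.card (Fin M)
      = 1 / Real.pi * ∫ θ in (0 : ℝ)..(Real.pi - α),
          Real.exp (-Real.sin α ^ 2 / (v * Real.sin θ ^ 2)) := by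
    have h1 : ∀ m : Fin M, (complexNormal v).real
        {w | w * starRingEnd ℂ (pskPoint M m) ∈ sectorError α}
        = (complexNormal v).real (sectorError α) := by
      intro m
      conv_rhs => rw [← map_mul_complexNormal hv.le (c := starRingEnd ℂ (pskPoint M m))
        (by rw [RCLike.norm_conj, norm_pskPoint])]
      rw [map_measureReal_apply (by fun_prop) hEm]
      congr 1
      ext w
      rw [Set.mem_preimage, mul_comm]
      rfl
    simp_rw [h1]
    rw [complexNormal_real_sectorError hv hα0 hα2]
    simp only [Finset.sum_const, Finset.card_univ, Fintype.card_fin, nsmul_eq_mul]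
    rw [mul_div_assoc, mul_div_cancel₀]
    exact hMpos.ne'
  rw [hsum] at h
  exact h

lemma continuousAt_craig {v₀ s b : ℝ} (hv : 0 < v₀) :
    ContinuousAt (fun v => 1 / Real.pi * ∫ θ in (0 : ℝ)..b,
      Real.exp (-s ^ 2 / (v * Real.sin θ ^ 2))) v₀ := by
  refine continuousAt_const.mul ?_
  refine intervalIntegral.continuousAt_of_dominated_interval (bound := fun _ => 1) ?_ ?_
    intervalIntegrable_const ?_
  · exact Eventually.of_forall fun v => (Measurable.exp (by fun_prop)).aestronglyMeasurable
  · filter_upwards [lt_mem_nhds hv] with v hv0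
    refine Eventually.of_forall fun θ _ => ?_
    rw [Real.norm_of_nonneg (Real.exp_pos _).le, Real.exp_le_one_iff]
    exact div_nonpos_of_nonpos_of_nonneg (by nlinarith [sq_nonneg s]) (by positivity)
  · refine Eventually.of_forall fun θ _ => ?_
    -- With `sin θ = 0` the quotient is `0` for every `v`, so the integrand is constant in `v`.
    by_cases h0 : Real.sin θ = 0
    · simp only [h0]
      simp only [ne_eq, OfNat.ofNat_ne_zero, not_false_eq_true, zero_pow, mul_zero, div_zero]
      exact continuousAt_const
    · have : v₀ * Real.sin θ ^ 2 ≠ 0 := mul_ne_zero hv.ne' (pow_ne_zero 2 h0)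
      exact Real.continuous_exp.continuousAt.comp
        (continuousAt_const.div (continuousAt_id.mul continuousAt_const) this)

/-! ### The limits in closed form -/

/-- One factor `1 + r` cancels, as `(1 + r)² / (1 - r²) = (1 + r) / (1 - r)`. -/
lemma limitVariance_eq {r σ β : ℝ} (hr0 : 0 ≤ r) (hr1 : r < 1) :
    limitVariance r σ β = 4 * (1 + r) * ellipticE (2 * √r / (1 + r)) ^ 2 * σ ^ 2
      / (Real.pi ^ 2 * (1 - r) * (β - 1)) := by
  have h1 : 1 - r ≠ 0 := by linarith
  have h2 : 1 + r ≠ 0 := by linarith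
  have h3 : √(1 - r ^ 2) ^ 2 = (1 - r) * (1 + r) := by
    rw [Real.sq_sqrt (by nlinarith)]; ring
  rw [limitVariance, kmsSpectralMean, mul_pow, div_pow, mul_pow, mul_pow, h3]
  field_simp
  ring

lemma continuousAt_gaussQ_div_sqrt (d : ℝ) {v : ℝ} (hv : 0 < v) :
    ContinuousAt (fun v => gaussQ (d / √(v / 2))) v := by
  refine continuous_gaussQ.continuousAt.comp (continuousAt_const.div ?_ ?_)
  · exact (Real.continuous_sqrt.comp (continuous_id.div_const 2)).continuousAt
  · positivity

lemma ellipticE_modulus_ne_zero {r : ℝ} (hr0 : 0 ≤ r) (hr1 : r < 1) :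
    ellipticE (2 * √r / (1 + r)) ≠ 0 := by
  intro h
  have := kmsSpectralMean_pos hr0 hr1
  rw [kmsSpectralMean, h, mul_zero] at this
  exact this.false

end MassiveMIMO

end

open MassiveMIMO

/-! ### The three limits in closed form. -/

theorem corollary1
    (ρ : ℂ) (hρ0 : 0 < ‖ρ‖) (hρ1 : ‖ρ‖ < 1)
    (σ η β : ℝ) (hσ : 0 < σ) (hη : η = 1 / σ ^ 2) (hβ : 1 < β)
    (M : ℕ) (hM : 2 ≤ M)
    (Nt Nr : ℕ → ℕ) (hNt : Tendsto Nt atTop atTop)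
    (hNr : ∀ n, (Nr n : ℝ) = β * (Nt n : ℝ))
    (F : ∀ n, Matrix (Fin (Nt n)) (Fin (Nt n)) ℂ)
    (hF : ∀ n, IsOptimalPrecoder (kmsMatrix ρ (Nt n)) (F n)) :
    (∀ D : ℂ → ℂ, IsHardDecision (pam M) D →
      Tendsto (fun n => averageSEP (pam M) D (kmsMatrix ρ (Nt n)) σ (Nr n) (F n)) atTop
        (𝓝 (2 * ((M : ℝ) - 1) / M *
          gaussQ (√(3 * Real.pi ^ 2 * η * (1 - ‖ρ‖) * (β - 1) /
            (2 * (1 + ‖ρ‖) * ((M : ℝ) ^ 2 - 1) *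
              ellipticE (2 * √‖ρ‖ / (1 + ‖ρ‖)) ^ 2)))))) ∧
    (∀ D : ℂ → ℂ, IsHardDecision (psk M) D →
      Tendsto (fun n => averageSEP (psk M) D (kmsMatrix ρ (Nt n)) σ (Nr n) (F n)) atTop
        (𝓝 (1 / Real.pi * ∫ θ in (0 : ℝ)..(((M : ℝ) - 1) * Real.pi / M),
          Real.exp (-(Real.pi ^ 2 * η * (1 - ‖ρ‖) * (β - 1) * Real.sin (Real.pi / M) ^ 2) /
            (4 * (1 + ‖ρ‖) * ellipticE (2 * √‖ρ‖ / (1 + ‖ρ‖)) ^ 2 * Real.sin θ ^ 2))))) ∧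
    (∀ L : ℕ, L ^ 2 = M → ∀ D : ℂ → ℂ, IsHardDecision (qam L) D →
      Tendsto (fun n => averageSEP (qam L) D (kmsMatrix ρ (Nt n)) σ (Nr n) (F n)) atTop
        (𝓝 (4 * (√(M : ℝ) - 1) / √(M : ℝ) *
            gaussQ (√(3 * Real.pi ^ 2 * η * (1 - ‖ρ‖) * (β - 1) /
              (4 * (1 + ‖ρ‖) * ((M : ℝ) - 1) *
                ellipticE (2 * √‖ρ‖ / (1 + ‖ρ‖)) ^ 2))) -
          4 * (√(M : ℝ) - 1) ^ 2 / M *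
            gaussQ (√(3 * Real.pi ^ 2 * η * (1 - ‖ρ‖) * (β - 1) /
              (4 * (1 + ‖ρ‖) * ((M : ℝ) - 1) *
                ellipticE (2 * √‖ρ‖ / (1 + ‖ρ‖)) ^ 2))) ^ 2))) := by
  have hv := limitVariance_pos (norm_nonneg ρ) hρ1 hσ hβ
  have hE := ellipticE_modulus_ne_zero (norm_nonneg ρ) hρ1
  have hveq := limitVariance_eq (σ := σ) (β := β) (norm_nonneg ρ) hρ1
  set E := ellipticE (2 * √‖ρ‖ / (1 + ‖ρ‖))
  have h1 : 1 - ‖ρ‖ ≠ 0 := by linarith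
  have h2 : 1 + ‖ρ‖ ≠ 0 := by linarith
  have h3 : β - 1 ≠ 0 := by linarith
  have hM2 : (2 : ℝ) ≤ M := by exact_mod_cast hM
  have hMsq : (M : ℝ) ^ 2 - 1 ≠ 0 := by nlinarith
  refine ⟨fun D hD => ?_, fun D hD => ?_, ?_⟩
  · have : Nonempty (Fin M) := ⟨⟨0, by omega⟩⟩
    convert tendsto_averageSEP hρ1 hσ hβ hNt hNr hF (by rw [pam_eq_range]; exact Set.finite_range _)
      (by rw [pam_eq_range]; exact Set.range_nonempty _) hD
      (fun v hv => (pam_errorSet_real hM hv).1) (fun v hv => (pam_errorSet_real hM hv).2)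
      (continuousAt_const.mul (continuousAt_gaussQ_div_sqrt _ hv)) using 4
    -- The argument of `gaussQ` is the half-distance over the standard deviation of one real
    -- coordinate, which carries half of the limiting variance.
    rw [← Real.sqrt_div (div_nonneg zero_le_three (by nlinarith)), hveq, hη]
    congr 1
    field_simp
    ring
  · have : Nonempty (Fin M) := ⟨⟨0, by omega⟩⟩
    convert tendsto_averageSEP hρ1 hσ hβ hNt hNr hF (by rw [psk_eq_range]; exact Set.finite_range _)
      (by rw [psk_eq_range]; exact Set.range_nonempty _) hD
      (fun v hv => (psk_errorSet_real hM hv).1) (fun v hv => (psk_errorSet_real hM hv).2)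
      (continuousAt_craig hv) using 3
    have hend : ((M : ℝ) - 1) * Real.pi / M = Real.pi - Real.pi / M := by field_simp
    rw [hend]
    congr 1
    funext θ
    congr 1
    -- Cancelling fractions needs `sin θ ≠ 0`; at a zero both exponents are `0` by division by zero.
    by_cases h0 : Real.sin θ = 0
    · simp [h0]
    · rw [hveq, hη]
      field_simp
  · rintro L hLM D hD
    have hL : 2 ≤ L := by
      by_contra hlt
      have : L ≤ 1 := by omega
      have := Nat.pow_le_pow_left this 2
      omega
    have hLM' : (M : ℝ) = (L : ℝ) ^ 2 := by rw [← hLM]; push_cast; rfl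
    have hL2 : (2 : ℝ) ≤ L := by exact_mod_cast hL
    have hLsq : (L : ℝ) ^ 2 - 1 ≠ 0 := by nlinarith
    have : Nonempty (Fin L) := ⟨⟨0, by omega⟩⟩
    convert tendsto_averageSEP hρ1 hσ hβ hNt hNr hF (by rw [qam_eq_range]; exact Set.finite_range _)
      (by rw [qam_eq_range]; exact Set.range_nonempty _) hD
      (fun v hv => (qam_errorSet_real hL hv).1) (fun v hv => (qam_errorSet_real hL hv).2)
      (continuousAt_const.sub ((continuousAt_const.sub (continuousAt_const.mul
        (continuousAt_gaussQ_div_sqrt _ hv))).pow 2)) using 2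
    have harg : √(3 / (2 * ((L : ℝ) ^ 2 - 1))) / √(limitVariance ‖ρ‖ σ β / 2)
        = √(3 * Real.pi ^ 2 * η * (1 - ‖ρ‖) * (β - 1) /
          (4 * (1 + ‖ρ‖) * ((M : ℝ) - 1) * E ^ 2)) := by
      rw [← Real.sqrt_div (div_nonneg zero_le_three (by nlinarith)), hveq, hη, hLM']
      congr 1
      field_simp
    -- With `√M = L`, the claim is `1 - (1 - p)² = 2p - p²` for the coordinate error probability `p
    -- = 2 (L - 1) / L * q`.
    rw [harg, hLM', Real.sqrt_sq (by linarith)]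
    field_simp
    ring
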